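/- There is a function $C:[0,\infty)\to[0,\infty)$ such that the following holds for every $n\ge 1$, every bounded domain (nonempty bounded open connected set) $\Omega\subset\mathbb{R}^n$ and every function $f:\partial\Omega\to\mathbb{R}$ that is Lipschitz continuous with constant $L$, i.e. $|f(\xi)-f(\eta)|\le L|\xi-\eta|$ for $\xi,\eta\in\partial\Omega$. Write $\Delta_\infty\phi=\sum_{i,j=1}^n \phi_{x_i}\phi_{x_j}\phi_{x_ix_j}$. A function $u\in C(\Omega)$ is a viscosity solution of $\Delta_\infty u=0$ in $\Omega$ if, for all $x_0\in\Omega$ and $\phi\in C^2(\Omega)$ with $\phi(x_0)=u(x_0)$: $\Delta_\infty\phi(x_0)\le 0$ whenever $\phi<u$ on $\Omega\setminus\{x_0\}$, and $\Delta_\infty\phi(x_0)\ge 0$ whenever $\phi>u$ on $\Omega\setminus\{x_0\}$. 1. There exists exactly one $u\in C(\overline\Omega)$ that is a viscosity solution of $\Delta_\infty u=0$ in $\Omega$ and satisfies $u=f$ on $\partial\Omega$. 2. This $u$ is Lipschitz continuous on $\overline\Omega$ with constant $C(L)$; moreover $u\in W^{1,\infty}(\Omega)$ and its weak gradient satisfies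 $\|\nabla u\|_{L^\infty(\Omega)}\le C(L)$. 3. A function $w$ on $\overline\Omega$ is a continuous viscosity solution of $\Delta_\infty w=0$ in $\Omega$ with $w=f$ on $\partial\Omega$ if and only if it is a variational solution with boundary values $f$, that is, if and only if there are real exponents $p_j>n$, $p_j\to\infty$, and functions $u_{p_j}$ such that $u_{p_j}$ minimizes $\int_\Omega|\nabla v|^{p_j}\,dx$ among all $v\in C(\overline\Omega)\cap W^{1,p_j}(\Omega)$ with $v=f$ on $\partial\Omega$, and $u_{p_j}\to w$ uniformly on $\overline\Omega$. In particular the variational solution exists, is unique, and equals $u$. -/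

import Mathlib

open MeasureTheory Filter Topology
open scoped NNReal ENNReal ContDiff

noncomputable section

/-- `n`-dimensional Euclidean space. -/
abbrev E (n : ℕ) : Type := EuclideanSpace ℝ (Fin n)

/-- A bounded domain: a nonempty, open, connected, bounded subset of Euclidean space. -/
structure IsBoundedDomain {n : ℕ} (Ω : Set (E n)) : Prop where
  isOpen : IsOpen Ω
  isConnected : IsConnected Ω
  isBounded : Bornology.IsBounded Ω

/-- The `i`-th classical partial derivative. -/
def partialDeriv {n : ℕ} (i : Fin n) (φ : E n → ℝ) (x : E n) : ℝ :=
  fderiv ℝ φ x (EuclideanSpace.single i 1)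

/-- The infinity-Laplacian `∑ φ_i φ_j φ_ij` of a `C²` function. -/
def infLaplacian {n : ℕ} (φ : E n → ℝ) (x : E n) : ℝ :=
  ∑ i, ∑ j, partialDeriv i φ x * partialDeriv j φ x * partialDeriv i (partialDeriv j φ) x

/-- `φ` touches `v` (strictly) from below at `x₀`, relative to `Ω`. -/
def TouchesFromBelow {n : ℕ} (Ω : Set (E n)) (φ v : E n → ℝ) (x₀ : E n) : Prop :=
  φ x₀ = v x₀ ∧ ∀ x ∈ Ω, x ≠ x₀ → φ x < v x

/-- `ψ` touches `u` (strictly) from above at `x₀`, relative to `Ω`. -/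
def TouchesFromAbove {n : ℕ} (Ω : Set (E n)) (ψ u : E n → ℝ) (x₀ : E n) : Prop :=
  ψ x₀ = u x₀ ∧ ∀ x ∈ Ω, x ≠ x₀ → u x < ψ x

/-- Viscosity supersolutions of `Δ_∞ v = 0` in `Ω`. -/
def IsViscositySupersolution {n : ℕ} (Ω : Set (E n)) (v : E n → ℝ) : Prop :=
  ContinuousOn v Ω ∧ ∀ x₀ ∈ Ω, ∀ φ : E n → ℝ, ContDiffOn ℝ 2 φ Ω →
    TouchesFromBelow Ω φ v x₀ → infLaplacian φ x₀ ≤ 0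

/-- Viscosity subsolutions of `Δ_∞ u = 0` in `Ω`. -/
def IsViscositySubsolution {n : ℕ} (Ω : Set (E n)) (u : E n → ℝ) : Prop :=
  ContinuousOn u Ω ∧ ∀ x₀ ∈ Ω, ∀ ψ : E n → ℝ, ContDiffOn ℝ 2 ψ Ω →
    TouchesFromAbove Ω ψ u x₀ → 0 ≤ infLaplacian ψ x₀

/-- Viscosity solutions of `Δ_∞ u = 0` in `Ω`. -/
def IsViscositySolution {n : ℕ} (Ω : Set (E n)) (u : E n → ℝ) : Prop :=
  IsViscositySupersolution Ω u ∧ IsViscositySubsolution Ω u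

/-- `u ∈ C(Ω̄)` has boundary values `f`. Only the values of `u` on `closure Ω` and those of `f` on
`frontier Ω` matter. -/
def HasBoundaryValues {n : ℕ} (Ω : Set (E n)) (f u : E n → ℝ) : Prop :=
  ContinuousOn u (closure Ω) ∧ Set.EqOn u f (frontier Ω)

/-- `u ∈ C(Ω̄)` is a viscosity solution of `Δ_∞ u = 0` in `Ω` with `u = f` on the boundary. -/
def IsViscosityDirichletSolution {n : ℕ} (Ω : Set (E n)) (f u : E n → ℝ) : Prop :=
  HasBoundaryValues Ω f u ∧ IsViscositySolution Ω u

/-- `G` is the weak (distributional) gradient of `u` in `Ω`. -/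
def HasWeakGradient {n : ℕ} (Ω : Set (E n)) (u : E n → ℝ) (G : E n → E n) : Prop :=
  LocallyIntegrableOn u Ω volume ∧ LocallyIntegrableOn G Ω volume ∧
    ∀ η : E n → ℝ, ContDiff ℝ ∞ η → HasCompactSupport η → tsupport η ⊆ Ω →
      ∀ i : Fin n, ∫ x in Ω, u x * partialDeriv i η x = - ∫ x in Ω, G x i * η x

/-- `u ∈ W^{1,p}(Ω)` with weak gradient `G`. -/
def IsSobolevWithGradient {n : ℕ} (Ω : Set (E n)) (p : ℝ≥0∞) (u : E n → ℝ) (G : E n → E n) :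
    Prop :=
  HasWeakGradient Ω u G ∧ MemLp u p (volume.restrict Ω) ∧ MemLp G p (volume.restrict Ω)

/-- `u` minimizes `∫_Ω |∇v|^p` among all `v ∈ C(Ω̄) ∩ W^{1,p}(Ω)` with boundary values `f`. -/
def IsPEnergyMinimizer {n : ℕ} (Ω : Set (E n)) (p : ℝ) (f u : E n → ℝ) : Prop :=
  HasBoundaryValues Ω f u ∧ ∃ G : E n → E n, IsSobolevWithGradient Ω (ENNReal.ofReal p) u G ∧
    ∀ (v : E n → ℝ) (H : E n → E n), HasBoundaryValues Ω f v →
      IsSobolevWithGradient Ω (ENNReal.ofReal p) v H →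
        ∫ x in Ω, ‖G x‖ ^ p ≤ ∫ x in Ω, ‖H x‖ ^ p

/-- `u` is a variational solution with boundary values `f`: a uniform limit on `closure Ω` of
minimizers `v j` of the `p j`-energies with boundary values `f`, where `n < p j` and `p j → ∞`. -/
def IsVariationalSolution {n : ℕ} (Ω : Set (E n)) (f u : E n → ℝ) : Prop :=
  ∃ (p : ℕ → ℝ) (v : ℕ → E n → ℝ), (∀ j, (n : ℝ) < p j) ∧ Tendsto p atTop atTop ∧
    (∀ j, IsPEnergyMinimizer Ω (p j) f (v j)) ∧ TendstoUniformlyOn v u atTop (closure Ω)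

end

noncomputable section

variable {n : ℕ}

/-! The constant is `C L = L`. Comparison for the infinity-Laplacian gives uniqueness and the
Lipschitz bound; limits of minimizers of the `p`-energy give existence.

Uniqueness is the finite-difference argument of Armstrong and Smart, with no doubling of variables.
Bent cones are strict classical supersolutions, so a subsolution lying below a cone of nonnegative
slope on the boundary of a set avoiding the vertex lies below it inside
(`IsViscositySubsolution.le_cone`). On a punctured ball of radius `2ε` this says that the `ε`-ball
maximum `U` of a subsolution satisfies max + min ≥ `2U` over `ε`-balls
(`IsViscositySubsolution.two_mul_ballSup_le`); the `ε`-ball minimum `W` of a supersolution satisfies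
the reverse inequality. An extremal choice among the maximum points of `U - W` shows that these
inequalities cannot hold at all of them (`not_forall_finite_difference`), while boundary ordering
and small `ε` keep a positive maximum away from the boundary. Cones of slope `L` also carry the
Lipschitz constant of `f` into the interior.

For existence, `f` is extended to an `L`-Lipschitz `F` on the whole space. By Clarkson's inequality
the gradients of a minimizing sequence are Cauchy in `L^p`, and for `p > n` Morrey's inequality
(`exists_morrey_const`) makes the functions uniformly Cauchy, so continuity and boundary values
survive the limit. Morrey is applied only to differences that vanish on the boundary; these extend
by zero (`HasWeakGradient.indicator_of_frontier`), so no regularity of the boundary is used.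
Comparing energies with `F` bounds the gradients in `L^(n+1)` uniformly in `p`, and Arzelà–Ascoli
yields a variational solution.

Every variational solution is a viscosity solution: where `Δ_∞ φ > 0`, the divergence `|∇φ|^(p-4)
(|∇φ|² Δφ + (p-2) Δ_∞ φ)` of the `p`-flux is positive for large `p`, and a minimizer cannot drop
below such a `φ` inside a set while staying above it near the boundary
(`IsPEnergyMinimizer.le_of_strict_subsolution`). The other half follows by negation. Conversely, a
viscosity solution agrees on the closure with the limit just built, so the same minimizers converge
to it. -/

/-! ### Calculus of partial derivatives and the infinity-Laplacian -/

theorem HasFDerivAt.partialDeriv_eq {φ : E n → ℝ} {φ' : E n →L[ℝ] ℝ} {x : E n}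
    (h : HasFDerivAt φ φ' x) (i : Fin n) : partialDeriv i φ x = φ' (EuclideanSpace.single i 1) := by
  rw [partialDeriv, h.fderiv]

theorem Filter.EventuallyEq.partialDeriv_eq {φ ψ : E n → ℝ} {x : E n} (h : φ =ᶠ[𝓝 x] ψ)
    (i : Fin n) : partialDeriv i φ x = partialDeriv i ψ x := by
  rw [partialDeriv, partialDeriv, h.fderiv_eq]

theorem Filter.EventuallyEq.partialDeriv {φ ψ : E n → ℝ} {x : E n} (h : φ =ᶠ[𝓝 x] ψ)
    (i : Fin n) : _root_.partialDeriv i φ =ᶠ[𝓝 x] _root_.partialDeriv i ψ :=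
  h.eventuallyEq_nhds.mono fun _ hy => hy.partialDeriv_eq i

theorem Filter.EventuallyEq.infLaplacian_eq {φ ψ : E n → ℝ} {x : E n} (h : φ =ᶠ[𝓝 x] ψ) :
    infLaplacian φ x = infLaplacian ψ x := by
  unfold infLaplacian
  refine Finset.sum_congr rfl fun i _ => Finset.sum_congr rfl fun j _ => ?_
  rw [h.partialDeriv_eq i, h.partialDeriv_eq j, (h.partialDeriv j).partialDeriv_eq i]

theorem partialDeriv_neg (i : Fin n) (φ : E n → ℝ) :
    partialDeriv i (fun x => -φ x) = fun x => -partialDeriv i φ x := by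
  funext x
  simp [partialDeriv, fderiv_fun_neg]

theorem infLaplacian_neg (φ : E n → ℝ) (x : E n) :
    infLaplacian (fun x => -φ x) x = -infLaplacian φ x := by
  simp only [infLaplacian, partialDeriv_neg, ← Finset.sum_neg_distrib]
  refine Finset.sum_congr rfl fun i _ => Finset.sum_congr rfl fun j _ => ?_
  ring

theorem ContDiffAt.differentiableAt_partialDeriv {φ : E n → ℝ} {x : E n}
    (h : ContDiffAt ℝ 2 φ x) (i : Fin n) : DifferentiableAt ℝ (partialDeriv i φ) x := by
  have h1 : ContDiffAt ℝ 1 (fderiv ℝ φ) x := h.fderiv_right (by norm_num)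
  exact (h1.differentiableAt (by norm_num)).clm_apply (differentiableAt_const _)

theorem hasFDerivAt_norm_sub_pow_four (x₀ x : E n) :
    HasFDerivAt (fun y : E n => ‖y - x₀‖ ^ 4)
      ((4 * ‖x - x₀‖ ^ 2) • innerSL ℝ (x - x₀)) x := by
  have h1 : HasFDerivAt (fun y : E n => ‖y - x₀‖ ^ 2) (2 • (innerSL ℝ (x - x₀)).comp
      (ContinuousLinearMap.id ℝ (E n))) x :=
    ((hasFDerivAt_id x).sub_const x₀).norm_sq
  have h2 := h1.pow 2
  refine (h2.congr_fderiv ?_).congr_of_eventuallyEq (Eventually.of_forall fun y => ?_)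
  · ext v; simp; ring
  · simp only [← pow_mul]

theorem partialDeriv_norm_sub_pow_four (x₀ x : E n) (i : Fin n) :
    partialDeriv i (fun y : E n => ‖y - x₀‖ ^ 4) x = (4 * ‖x - x₀‖ ^ 2) * (x i - x₀ i) := by
  rw [(hasFDerivAt_norm_sub_pow_four x₀ x).partialDeriv_eq]
  simp [innerSL_apply_apply, EuclideanSpace.inner_single_right]

/-- The quartic has vanishing derivatives up to order two at `x₀`; adding it makes a contact strict
without changing the operator there. -/
theorem infLaplacian_add_norm_pow_four {φ : E n → ℝ} {x₀ : E n} (h : ContDiffAt ℝ 2 φ x₀) :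
    infLaplacian (fun x => φ x + ‖x - x₀‖ ^ 4) x₀ = infLaplacian φ x₀ := by
  have key : ∀ j, partialDeriv j (fun x => φ x + ‖x - x₀‖ ^ 4) =ᶠ[𝓝 x₀]
      fun x => partialDeriv j φ x + (4 * ‖x - x₀‖ ^ 2) * (x j - x₀ j) := by
    intro j
    have h1 : ∀ᶠ x in 𝓝 x₀, ContDiffAt ℝ 2 φ x := h.eventually (by simp)
    filter_upwards [h1] with x hx
    have h2 : DifferentiableAt ℝ φ x := hx.differentiableAt (by norm_num)
    have h3 := hasFDerivAt_norm_sub_pow_four x₀ x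
    rw [(h2.hasFDerivAt.fun_add h3).partialDeriv_eq, ← partialDeriv_norm_sub_pow_four,
      h3.partialDeriv_eq]
    rfl
  have key2 : ∀ i j, partialDeriv i (fun x => partialDeriv j φ x +
      (4 * ‖x - x₀‖ ^ 2) * (x j - x₀ j)) x₀ = partialDeriv i (partialDeriv j φ) x₀ := by
    intro i j
    have h1 := (h.differentiableAt_partialDeriv j).hasFDerivAt
    have h2 : HasFDerivAt (fun y : E n => ‖y - x₀‖ ^ 2) (2 • (innerSL ℝ (x₀ - x₀)).comp
      (ContinuousLinearMap.id ℝ (E n))) x₀ := ((hasFDerivAt_id x₀).sub_const x₀).norm_sq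
    have h3 : HasFDerivAt (fun y : E n => y j - x₀ j)
        (EuclideanSpace.proj j : E n →L[ℝ] ℝ) x₀ :=
      (EuclideanSpace.proj j : E n →L[ℝ] ℝ).hasFDerivAt.sub_const _
    rw [(h1.fun_add ((h2.const_mul 4).fun_mul h3)).partialDeriv_eq]
    simp [partialDeriv]
  unfold infLaplacian
  refine Finset.sum_congr rfl fun i _ => Finset.sum_congr rfl fun j _ => ?_
  rw [(key i).self_of_nhds, (key j).self_of_nhds, (key j).partialDeriv_eq i, key2]
  simp

/-! ### Local test functions and comparison with cones -/

/-- A viscosity subsolution that is bounded above may be tested with functions that are only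
defined and `C²` near the contact point and touch it there locally and not necessarily strictly. -/
theorem IsViscositySubsolution.infLaplacian_nonneg {Ω : Set (E n)} {u φ : E n → ℝ}
    (hu : IsViscositySubsolution Ω u) {M : ℝ} (hM : ∀ x ∈ Ω, u x ≤ M) {x₀ : E n}
    (hx₀ : x₀ ∈ Ω) (hφ : ContDiffAt ℝ 2 φ x₀) (h : ∀ᶠ x in 𝓝 x₀, x ∈ Ω → u x ≤ φ x)
    (he : φ x₀ = u x₀) : 0 ≤ infLaplacian φ x₀ := by
  have h1 : ∀ᶠ x in 𝓝 x₀, ContDiffAt ℝ 2 φ x := hφ.eventually (by simp)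
  obtain ⟨r, hr, hball⟩ := Metric.eventually_nhds_iff_ball.1 (h1.and h)
  let χ : ContDiffBump x₀ := ⟨r / 4, r / 2, by positivity, by linarith⟩
  -- With this `g`, `ψ` is the combination of `φ + |x - x₀|^4` and the constant `M + 1` with weights
  -- `χ` and `1 - χ`. Off `x₀` both lie strictly above `u` wherever their weight is positive, so `ψ`
  -- is a global strict test function.
  set g : E n → ℝ := fun x => φ x + ‖x - x₀‖ ^ 4 - (M + 1) with hg
  set ψ : E n → ℝ := fun x => χ x * g x + (M + 1) with hψ
  have hsub : tsupport χ ⊆ Metric.ball x₀ r := by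
    rw [χ.tsupport_eq]
    exact Metric.closedBall_subset_ball (by change r / 2 < r; linarith)
  have hψs : ContDiff ℝ 2 ψ := by
    refine ContDiff.add ?_ contDiff_const
    refine contDiff_iff_contDiffAt.2 fun x => ?_
    by_cases hx : x ∈ tsupport χ
    · refine χ.contDiffAt.mul (((hball x (hsub hx)).1.add ?_).sub contDiffAt_const)
      have : (fun x : E n => ‖x - x₀‖ ^ 4) = fun x => (‖x - x₀‖ ^ 2) ^ 2 := by
        funext x; rw [← pow_mul]
      rw [this]
      exact ((contDiff_id.sub contDiff_const).norm_sq ℝ).contDiffAt.pow 2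
    · have : (fun x => χ x * g x) =ᶠ[𝓝 x] fun _ => 0 := by
        filter_upwards [(isClosed_tsupport χ).isOpen_compl.mem_nhds hx] with y hy
        rw [image_eq_zero_of_notMem_tsupport hy, zero_mul]
      exact contDiffAt_const.congr_of_eventuallyEq this
  have hψe : ψ =ᶠ[𝓝 x₀] fun x => φ x + ‖x - x₀‖ ^ 4 := by
    filter_upwards [χ.eventuallyEq_one] with x hx
    simp only [hψ, hg, hx, Pi.one_apply]; ring
  have ht : TouchesFromAbove Ω ψ u x₀ := by
    refine ⟨by rw [hψe.self_of_nhds, ← he]; simp, fun x hx hne => ?_⟩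
    have hpos : 0 < ‖x - x₀‖ ^ 4 := by
      have : 0 < ‖x - x₀‖ := norm_pos_iff.2 (sub_ne_zero.2 hne)
      positivity
    have hle := hM x hx
    simp only [hψ, hg]
    by_cases hxs : x ∈ tsupport χ
    · have h2 := (hball x (hsub hxs)).2 hx
      have h3 : (0:ℝ) ≤ χ x := χ.nonneg
      have h4 : (χ x : ℝ) ≤ 1 := χ.le_one
      rcases h3.eq_or_lt with h5 | h5
      · rw [← h5]; linarith
      · nlinarith
    · rw [image_eq_zero_of_notMem_tsupport hxs]; linarith
  have := hu.2 x₀ hx₀ ψ hψs.contDiffOn ht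
  rwa [hψe.infLaplacian_eq, infLaplacian_add_norm_pow_four hφ] at this

theorem IsViscositySupersolution.neg {Ω : Set (E n)} {v : E n → ℝ}
    (hv : IsViscositySupersolution Ω v) : IsViscositySubsolution Ω fun x => -v x := by
  refine ⟨hv.1.neg, fun x₀ hx₀ ψ hψ ht => ?_⟩
  have := hv.2 x₀ hx₀ (fun x => -ψ x) hψ.neg
    ⟨by simp [ht.1], fun x hx hne => by have := ht.2 x hx hne; simp only at this; linarith⟩
  rw [infLaplacian_neg] at this
  linarith

/-- The infinity-Laplacian of the bent cone `a + b|x - z| - c|x - z|²`. -/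
theorem infLaplacian_bent_cone (a b c : ℝ) {x z : E n} (hx : x ≠ z) :
    infLaplacian (fun y => a + b * ‖y - z‖ - c * ‖y - z‖ ^ 2) x =
      (b / ‖x - z‖ - 2 * c) ^ 2 * (-(2 * c) * ‖x - z‖ ^ 2) := by
  have hsq : ∀ y : E n, HasFDerivAt (fun y : E n => ‖y - z‖ ^ 2) (2 • (innerSL ℝ (y - z)).comp
      (ContinuousLinearMap.id ℝ (E n))) y := fun y => ((hasFDerivAt_id y).sub_const z).norm_sq
  have hn : ∀ y : E n, y ≠ z → HasFDerivAt (fun y : E n => ‖y - z‖)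
      (‖y - z‖⁻¹ • innerSL ℝ (y - z)) y := by
    intro y hy
    have hpos : 0 < ‖y - z‖ := norm_pos_iff.2 (sub_ne_zero.2 hy)
    have h1 := (hsq y).sqrt (by positivity)
    refine (h1.congr_fderiv ?_).congr_of_eventuallyEq (Eventually.of_forall fun w => ?_)
    · ext v
      simp [Real.sqrt_sq hpos.le]
      field_simp
    · simp [Real.sqrt_sq (norm_nonneg _)]
  have h1 : ∀ y : E n, y ≠ z → ∀ j, partialDeriv j
      (fun y => a + b * ‖y - z‖ - c * ‖y - z‖ ^ 2) y = (b * ‖y - z‖⁻¹ - 2 * c) * (y j - z j) := by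
    intro y hy j
    rw [((((hn y hy).const_mul b).const_add a).fun_sub ((hsq y).const_mul c)).partialDeriv_eq]
    simp [innerSL_apply_apply, EuclideanSpace.inner_single_right]
    ring
  have hpos : 0 < ‖x - z‖ := norm_pos_iff.2 (sub_ne_zero.2 hx)
  have h2 : ∀ i j, partialDeriv i (partialDeriv j
      (fun y => a + b * ‖y - z‖ - c * ‖y - z‖ ^ 2)) x =
      -(b * (‖x - z‖⁻¹) ^ 3) * (x i - z i) * (x j - z j) +
        (b * ‖x - z‖⁻¹ - 2 * c) * (if i = j then 1 else 0) := by
    intro i j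
    have he : partialDeriv j (fun y => a + b * ‖y - z‖ - c * ‖y - z‖ ^ 2) =ᶠ[𝓝 x]
        fun y => (b * ‖y - z‖⁻¹ - 2 * c) * (y j - z j) := by
      filter_upwards [isOpen_ne.mem_nhds hx] with y hy
      exact h1 y hy j
    have h3 : HasFDerivAt (fun y : E n => y j - z j)
        (EuclideanSpace.proj j : E n →L[ℝ] ℝ) x :=
      (EuclideanSpace.proj j : E n →L[ℝ] ℝ).hasFDerivAt.sub_const _
    have h4 : HasFDerivAt (fun y : E n => ‖y - z‖⁻¹)
        ((-(‖x - z‖ ^ 2)⁻¹) • (‖x - z‖⁻¹ • innerSL ℝ (x - z))) x :=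
      (hasDerivAt_inv hpos.ne').comp_hasFDerivAt x (hn x hx)
    rw [he.partialDeriv_eq, (((h4.const_mul b).sub_const _).fun_mul h3).partialDeriv_eq]
    simp [innerSL_apply_apply, EuclideanSpace.inner_single_right,]
    by_cases hij : j = i
    · subst hij; simp; field_simp; ring
    · simp [hij, Ne.symm hij]; field_simp
  unfold infLaplacian
  simp_rw [h1 x hx, h2]
  have hS : ∑ i, (x i - z i) * (x i - z i) = ‖x - z‖ ^ 2 := by
    rw [EuclideanSpace.real_norm_sq_eq]; simp [sq]
  set k := b * ‖x - z‖⁻¹ - 2 * c with hk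
  have hsum : ∀ i j, k * (x i - z i) * (k * (x j - z j)) *
      (-(b * (‖x - z‖⁻¹) ^ 3) * (x i - z i) * (x j - z j) + k * (if i = j then 1 else 0)) =
      -(k ^ 2 * b * (‖x - z‖⁻¹) ^ 3) * (((x i - z i) * (x i - z i)) * ((x j - z j) * (x j - z j))) +
      (if i = j then k ^ 3 * ((x j - z j) * (x j - z j)) else 0) := by
    intro i j
    by_cases hij : i = j
    · subst hij; simp; ring
    · simp [hij]; ring
  simp_rw [hsum, Finset.sum_add_distrib, Finset.sum_ite_eq, Finset.mem_univ, if_true,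
    ← Finset.mul_sum, ← Finset.sum_mul, hS]
  rw [div_eq_mul_inv, ← hk]
  have : k ^ 3 = k ^ 2 * (b * ‖x - z‖⁻¹ - 2 * c) := by rw [pow_succ, hk]
  rw [this]
  field_simp
  ring

/-- Comparison with cones of nonnegative slope from above. -/
theorem IsViscositySubsolution.le_cone {Ω V : Set (E n)} {u : E n → ℝ}
    (hu : IsViscositySubsolution Ω u) {M : ℝ} (hM : ∀ x ∈ Ω, u x ≤ M) (hV : IsOpen V)
    (hVb : Bornology.IsBounded V) (hVΩ : V ⊆ Ω) (hc : ContinuousOn u (closure V)) {z : E n}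
    (hz : z ∉ V) {a b : ℝ} (hb : 0 ≤ b) (hbd : ∀ x ∈ frontier V, u x ≤ a + b * ‖x - z‖) :
    ∀ x ∈ V, u x ≤ a + b * ‖x - z‖ := by
  intro y hy
  by_contra! hlt
  set δ := u y - (a + b * ‖y - z‖) with hδ
  have hδ0 : 0 < δ := by linarith
  have hK : IsCompact (closure V) := hVb.isCompact_closure
  obtain ⟨D, hD⟩ : ∃ D, ∀ x ∈ closure V, ‖x - z‖ ≤ D :=
    hK.exists_bound_of_continuousOn (f := fun x => x - z) (by fun_prop)
  have hne : ∀ x ∈ V, 0 < ‖x - z‖ := fun x hx =>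
    norm_pos_iff.2 (sub_ne_zero.2 fun h => hz (h ▸ hx))
  have hD0 : 0 < D := (hne y hy).trans_le (hD y (subset_closure hy))
  -- The factor 6 bounds the added slope term `3cD|x - z|` by `3cD² = δ/2`, so `u - ψ` is still
  -- positive at `y`.
  set c := δ / (6 * D ^ 2) with hcdef
  have hc0 : 0 < c := by positivity
  have hcD : c * D ^ 2 = δ / 6 := by rw [hcdef]; field_simp
  -- As `|x - z| ≤ D`, the extra slope outweighs the quadratic term: `ψ` stays above the cone on the
  -- boundary, and its radial derivative stays positive even when `b = 0`.
  set ψ : E n → ℝ := fun x => a + (b + 3 * c * D) * ‖x - z‖ - c * ‖x - z‖ ^ 2 with hψ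
  have hψc : Continuous ψ := by fun_prop
  obtain ⟨x₀, hx₀, hmax⟩ := hK.exists_isMaxOn ⟨y, subset_closure hy⟩ (hc.sub hψc.continuousOn)
  have hmax' : ∀ x ∈ closure V, u x - ψ x ≤ u x₀ - ψ x₀ := fun x hx => hmax hx
  have hpos : 0 < u x₀ - ψ x₀ := by
    refine lt_of_lt_of_le ?_ (hmax' y (subset_closure hy))
    have h1 := hD y (subset_closure hy)
    have h2 : c * D * ‖y - z‖ ≤ c * D ^ 2 := by nlinarith [mul_pos hc0 hD0]
    have h3 : 0 ≤ c * ‖y - z‖ ^ 2 := by positivity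
    simp only [hψ]
    nlinarith
  have hx₀V : x₀ ∈ V := by
    by_contra hcon
    have hfr : x₀ ∈ frontier V := by rw [hV.frontier_eq]; exact ⟨hx₀, hcon⟩
    have h1 := hbd x₀ hfr
    have h2 := hD x₀ hx₀
    have h3 : c * ‖x₀ - z‖ ^ 2 ≤ c * D * ‖x₀ - z‖ := by
      nlinarith [mul_nonneg hc0.le (norm_nonneg (x₀ - z))]
    have h4 : 0 ≤ c * D * ‖x₀ - z‖ := by positivity
    simp only [hψ] at hpos
    nlinarith
  have hxz := hne x₀ hx₀V
  have hxz' : x₀ ≠ z := fun h => by simp [h] at hxz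
  have hsm : ContDiffAt ℝ 2 (fun x => (a + (u x₀ - ψ x₀)) + (b + 3 * c * D) * ‖x - z‖ -
      c * ‖x - z‖ ^ 2) x₀ := by
    have h1 : ContDiffAt ℝ 2 (fun x : E n => ‖x - z‖) x₀ :=
      (contDiffAt_id.sub contDiffAt_const).norm ℝ (by simpa [sub_eq_zero] using hxz')
    exact (contDiffAt_const.add (contDiffAt_const.mul h1)).sub (contDiffAt_const.mul (h1.pow 2))
  have hkey := hu.infLaplacian_nonneg hM (hVΩ hx₀V) hsm (by
    filter_upwards [hV.mem_nhds hx₀V] with x hx _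
    have := hmax' x (subset_closure hx)
    simp only [hψ] at this ⊢
    linarith) (by simp only [hψ]; ring)
  rw [infLaplacian_bent_cone _ _ _ hxz'] at hkey
  have hslope : 0 < (b + 3 * c * D) / ‖x₀ - z‖ - 2 * c := by
    rw [sub_pos, lt_div_iff₀ hxz]
    have := hD x₀ hx₀
    nlinarith
  have : 0 < ((b + 3 * c * D) / ‖x₀ - z‖ - 2 * c) ^ 2 * ((2 * c) * ‖x₀ - z‖ ^ 2) := by positivity
  linarith

/-! ### Finite differences and the comparison principle -/

/-- The maximum of `u` over the closed ball of radius `ε` about `x`. -/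
def ballSup (u : E n → ℝ) (ε : ℝ) (x : E n) : ℝ :=
  sSup ((fun e => u (x + e)) '' Metric.closedBall 0 ε)

theorem continuous_ballSup {u : E n → ℝ} (hu : Continuous u) (ε : ℝ) :
    Continuous (ballSup u ε) :=
  (isCompact_closedBall (0 : E n) ε).continuous_sSup (f := fun x e => u (x + e))
    (by simp only [Function.HasUncurry.uncurry]; fun_prop)

theorem le_ballSup {u : E n → ℝ} (hu : Continuous u) {ε : ℝ} {x y : E n} (h : ‖y - x‖ ≤ ε) :
    u y ≤ ballSup u ε x := by
  refine le_csSup ((isCompact_closedBall (0 : E n) ε).image (by fun_prop)).bddAbove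
    ⟨y - x, by simpa using h, by simp⟩

theorem exists_eq_ballSup {u : E n → ℝ} (hu : Continuous u) {ε : ℝ} (hε : 0 ≤ ε) (x : E n) :
    ∃ y, ‖y - x‖ ≤ ε ∧ u y = ballSup u ε x := by
  obtain ⟨e, he, h⟩ := ((isCompact_closedBall (0 : E n) ε).image
    (f := fun e => u (x + e)) (by fun_prop)).sSup_mem
      ((Metric.nonempty_closedBall.2 hε).image _)
  exact ⟨x + e, by simpa using he, h⟩

/-- The ball maximum of a subsolution satisfies the finite difference inequality. -/
theorem IsViscositySubsolution.two_mul_ballSup_le {Ω : Set (E n)} {u : E n → ℝ}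
    (hu : IsViscositySubsolution Ω u) (huc : Continuous u) {M : ℝ} (hM : ∀ x ∈ Ω, u x ≤ M)
    {ε : ℝ} (hε : 0 < ε) {x : E n} (hx : Metric.closedBall x (2 * ε) ⊆ Ω) {y : E n}
    (hy : ‖y - x‖ ≤ ε) :
    ∃ z, ‖z - x‖ ≤ ε ∧ 2 * ballSup u ε x ≤ ballSup u ε z + ballSup u ε y := by
  obtain ⟨y₀, hy₀, hy₀e⟩ := exists_eq_ballSup huc hε.le x
  obtain ⟨z₀, hz₀, hz₀e⟩ := exists_eq_ballSup huc (by linarith : 0 ≤ 2 * ε) x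
  -- The midpoint is within `ε` of both `x` and `z₀`, so its `ε`-ball sees the maximum of `u` over
  -- the `2ε`-ball.
  refine ⟨midpoint ℝ x z₀, ?_, ?_⟩
  · rw [← dist_eq_norm, dist_midpoint_left, dist_eq_norm, norm_sub_rev]
    norm_num; linarith
  have h1 : u z₀ ≤ ballSup u ε (midpoint ℝ x z₀) := by
    refine le_ballSup huc ?_
    rw [← dist_eq_norm, dist_comm, dist_midpoint_right, dist_eq_norm, norm_sub_rev]
    norm_num; linarith
  have h2 : u x ≤ ballSup u ε y := le_ballSup huc (by rwa [norm_sub_rev])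
  have h3 : u x ≤ u z₀ := by rw [hz₀e]; exact le_ballSup huc (by simp; linarith)
  -- The cone with vertex `x` that reaches `u z₀` at distance `2ε` bounds `u` on the boundary of the
  -- punctured ball. At distance at most `ε` it is at most the average of `u x` and `u z₀`.
  have h4 : u y₀ ≤ u x + (u z₀ - u x) / (2 * ε) * ‖y₀ - x‖ := by
    by_cases hyx : y₀ = x
    · simp [hyx]
    refine hu.le_cone hM (V := Metric.ball x (2 * ε) \ {x})
      (Metric.isOpen_ball.sdiff isClosed_singleton) (Metric.isBounded_ball.subset Set.sdiff_subset)
      (Set.sdiff_subset.trans (Metric.ball_subset_closedBall.trans hx)) huc.continuousOn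
      (by simp) (div_nonneg (by linarith) (by linarith)) (fun w hw => ?_) y₀
      ⟨by rw [Metric.mem_ball, dist_eq_norm]; linarith, hyx⟩
    have hw1 : w ∈ Metric.closedBall x (2 * ε) :=
      closure_minimal (Set.sdiff_subset.trans Metric.ball_subset_closedBall)
        Metric.isClosed_closedBall hw.1
    rw [mem_closedBall_iff_norm] at hw1
    by_cases hwx : w = x
    · simp [hwx]
    have hw2 : 2 * ε ≤ ‖w - x‖ := by
      by_contra! hcon
      exact hw.2 (by
        rw [(Metric.isOpen_ball.sdiff isClosed_singleton).interior_eq]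
        exact ⟨by rwa [mem_ball_iff_norm], hwx⟩)
    have hw3 : ‖w - x‖ = 2 * ε := le_antisymm hw1 hw2
    have : u w ≤ u z₀ := by rw [hz₀e]; exact le_ballSup huc hw1
    rw [hw3, div_mul_cancel₀ _ (by positivity)]
    linarith
  have h5 : (u z₀ - u x) / (2 * ε) * ‖y₀ - x‖ ≤ (u z₀ - u x) / (2 * ε) * ε :=
    mul_le_mul_of_nonneg_left hy₀ (div_nonneg (by linarith) (by linarith))
  have h6 : (u z₀ - u x) / (2 * ε) * ε = (u z₀ - u x) / 2 := by field_simp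
  linarith

/-- The comparison argument of Armstrong and Smart for finite difference sub- and supersolutions:
the maximum of `U - W` over a compact set cannot be attained only at points where the finite
difference inequalities hold. -/
theorem not_forall_finite_difference (hn : 0 < n) {A : Set (E n)} (hA : IsCompact A)
    {U W : E n → ℝ} (hU : Continuous U) (hW : Continuous W) {ε m : ℝ} (hε : 0 < ε)
    (hm : ∀ x ∈ A, U x - W x ≤ m) (hne : ∃ x ∈ A, U x - W x = m)
    (hball : ∀ x ∈ A, U x - W x = m → Metric.closedBall x ε ⊆ A)
    (hUd : ∀ x ∈ A, U x - W x = m → ∀ y, ‖y - x‖ ≤ ε → ∃ z, ‖z - x‖ ≤ ε ∧ 2 * U x ≤ U z + U y)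
    (hWd : ∀ x ∈ A, U x - W x = m → ∀ z, ‖z - x‖ ≤ ε → ∃ y, ‖y - x‖ ≤ ε ∧ W z + W y ≤ 2 * W x) :
    False := by
  -- Three successive maximizations: `U - W`, then `U` among its maximizers, then the first
  -- coordinate. The last one replaces a connectedness argument.
  set P : Set (E n) := A ∩ {x | U x - W x = m} with hP
  have hPc : IsCompact P := hA.inter_right (isClosed_eq (hU.sub hW) continuous_const)
  obtain ⟨x₁, hx₁, hmax₁⟩ := hPc.exists_isMaxOn hne hU.continuousOn
  set Q : Set (E n) := P ∩ {x | U x = U x₁} with hQ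
  have hQc : IsCompact Q := hPc.inter_right (isClosed_eq hU continuous_const)
  obtain ⟨x₀, ⟨⟨hx₀A, hx₀m⟩, hx₀U⟩, hmax₀⟩ := hQc.exists_isMaxOn ⟨x₁, hx₁, rfl⟩
    (f := fun x : E n => x ⟨0, hn⟩) (by fun_prop)
  simp only [Set.mem_ofPred_eq] at hx₀m hx₀U
  have hB := hball x₀ hx₀A hx₀m
  have hBm : ∀ y, ‖y - x₀‖ ≤ ε → U y - W y ≤ m := fun y hy =>
    hm y (hB (by rwa [mem_closedBall_iff_norm]))
  obtain ⟨z, hz, hzmax⟩ := (isCompact_closedBall x₀ ε).exists_isMaxOn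
    (Metric.nonempty_closedBall.2 hε.le) hU.continuousOn
  rw [mem_closedBall_iff_norm] at hz
  have hzmax' : ∀ y, ‖y - x₀‖ ≤ ε → U y ≤ U z := fun y hy =>
    hzmax (by rwa [mem_closedBall_iff_norm] : y ∈ Metric.closedBall x₀ ε)
  -- The rise of `W` towards `w` is at most its drop towards some `y`. By maximality of `U - W` at
  -- `x₀` that drop is at most the drop of `U`, which is at most the largest rise of `U`.
  have hWU : ∀ w, ‖w - x₀‖ ≤ ε → W w - W x₀ ≤ U z - U x₀ := by
    intro w hw
    obtain ⟨y, hy, hy2⟩ := hWd x₀ hx₀A hx₀m w hw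
    obtain ⟨z', hz', hz2⟩ := hUd x₀ hx₀A hx₀m y hy
    linarith [hBm y hy, hzmax' z' hz']
  have hzP : z ∈ P := ⟨hB (by rwa [mem_closedBall_iff_norm]), by
    simp only [Set.mem_ofPred_eq]
    linarith [hWU z hz, hBm z hz]⟩
  have hzle : U z ≤ U x₀ := by rw [hx₀U]; exact hmax₁ hzP
  -- Now `U ≤ U x₀` on the ball, and the difference inequality forces equality. Stepping by `ε` in
  -- the first coordinate therefore stays in `Q`, against the choice of `x₀`.
  set w : E n := x₀ + EuclideanSpace.single ⟨0, hn⟩ ε with hw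
  have hwx : ‖w - x₀‖ ≤ ε := by simp [hw, abs_of_pos hε]
  have hUw : U w = U x₀ := by
    obtain ⟨z', hz', hz2⟩ := hUd x₀ hx₀A hx₀m w hwx
    linarith [hzmax' w hwx, hzmax' z' hz']
  have hwQ : w ∈ Q := by
    refine ⟨⟨hB (by rwa [mem_closedBall_iff_norm]), ?_⟩, ?_⟩
    · simp only [Set.mem_ofPred_eq]
      linarith [hWU w hwx, hBm w hwx]
    · simp only [Set.mem_ofPred_eq]; linarith
  have : w ⟨0, hn⟩ ≤ x₀ ⟨0, hn⟩ := hmax₀ hwQ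
  simp [hw] at this
  linarith

theorem IsViscositySubsolution.congr {Ω : Set (E n)} {u w : E n → ℝ}
    (hu : IsViscositySubsolution Ω u) (h : Set.EqOn w u Ω) : IsViscositySubsolution Ω w :=
  ⟨hu.1.congr h, fun x₀ hx₀ ψ hψ ht => hu.2 x₀ hx₀ ψ hψ
    ⟨by rw [ht.1, h hx₀], fun x hx hne => by rw [← h hx]; exact ht.2 x hx hne⟩⟩

theorem IsViscositySupersolution.congr {Ω : Set (E n)} {u w : E n → ℝ}
    (hu : IsViscositySupersolution Ω u) (h : Set.EqOn w u Ω) : IsViscositySupersolution Ω w :=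
  ⟨hu.1.congr h, fun x₀ hx₀ ψ hψ ht => hu.2 x₀ hx₀ ψ hψ
    ⟨by rw [ht.1, h hx₀], fun x hx hne => by rw [← h hx]; exact ht.2 x hx hne⟩⟩

theorem IsBoundedDomain.isCompact_closure {Ω : Set (E n)} (hΩ : IsBoundedDomain Ω) :
    IsCompact (closure Ω) :=
  hΩ.isBounded.isCompact_closure

theorem exists_continuous_extension {K : Set (E n)} (hK : IsClosed K) {u : E n → ℝ}
    (hu : ContinuousOn u K) : ∃ U : E n → ℝ, Continuous U ∧ Set.EqOn U u K := by
  obtain ⟨g, hg⟩ := ContinuousMap.exists_restrict_eq hK ⟨K.domRestrict u, hu.domRestrict⟩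
  exact ⟨g, g.continuous, fun x hx => congrArg (fun k => k ⟨x, hx⟩) hg⟩

/-- Replacing `u` by its `ε`-ball maximum and `v` by its `ε`-ball minimum can only enlarge `u - v`,
and produces the two finite difference inequalities. Uniform continuity keeps the maximum points
away from the boundary, which rules out a positive difference. -/
theorem comparison_of_continuous (hn : 0 < n) {Ω : Set (E n)} (hΩ : IsOpen Ω)
    (hΩb : Bornology.IsBounded Ω) {u v : E n → ℝ} (hu : IsViscositySubsolution Ω u)
    (hv : IsViscositySupersolution Ω v) (huc : Continuous u) (hvc : Continuous v)
    (hbd : ∀ x ∈ frontier Ω, u x ≤ v x) : ∀ x ∈ Ω, u x ≤ v x := by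
  intro y hy
  by_contra! hlt
  set m := u y - v y with hm
  have hm0 : 0 < m := by linarith
  have hK : IsCompact (closure Ω) := hΩb.isCompact_closure
  have hbdd : ∀ g : E n → ℝ, Continuous g → ∃ M, ∀ x ∈ Ω, g x ≤ M := fun g hg => by
    obtain ⟨M, hM⟩ := hK.bddAbove_image hg.continuousOn
    exact ⟨M, fun x hx => hM ⟨x, subset_closure hx, rfl⟩⟩
  obtain ⟨Mu, hMu⟩ := hbdd u huc
  obtain ⟨Mv, hMv⟩ := hbdd (fun x => -v x) hvc.neg
  -- uniform continuity near the closure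
  have hK1 : IsCompact (Metric.cthickening 1 (closure Ω)) := hK.cthickening
  have hunif : ∀ g : E n → ℝ, Continuous g → ∃ δ > 0, ∀ x ∈ closure Ω, ∀ z, ‖z - x‖ < δ →
      |g z - g x| < m / 2 := by
    intro g hg
    obtain ⟨δ, hδ, h⟩ := Metric.uniformContinuousOn_iff.1
      (hK1.uniformContinuousOn_of_continuous hg.continuousOn) (m / 2) (by positivity)
    refine ⟨min δ 1, by positivity, fun x hx z hz => ?_⟩
    have hzx : dist z x < min δ 1 := by rwa [dist_eq_norm]
    exact h z (Metric.mem_cthickening_of_dist_le z x _ _ hx (hzx.le.trans (min_le_right _ _))) x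
      (Metric.self_subset_cthickening _ hx) (hzx.trans_le (min_le_left _ _))
  obtain ⟨δu, hδu, hUu⟩ := hunif u huc
  obtain ⟨δv, hδv, hUv⟩ := hunif v hvc
  -- A maximizer of `u` or minimizer of `v` over the `ε`-ball about `x` is within `3ε` of any
  -- boundary point at distance at most `2ε` from `x`, so `3ε` must be below both moduli.
  set ε := min δu δv / 4 with hε
  have hmin : 0 < min δu δv := lt_min hδu hδv
  have hε0 : 0 < ε := by positivity
  have hεu : 3 * ε < δu := by have := min_le_left δu δv; rw [hε]; linarith
  have hεv : 3 * ε < δv := by have := min_le_right δu δv; rw [hε]; linarith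
  set U := ballSup u ε with hU
  set W : E n → ℝ := fun x => -ballSup (fun x => -v x) ε x with hW
  have hUc : Continuous U := continuous_ballSup huc ε
  have hWc : Continuous W := (continuous_ballSup hvc.neg ε).neg
  have huU : ∀ x, u x ≤ U x := fun x => le_ballSup huc (by simp; exact hε0.le)
  have hWv : ∀ x, W x ≤ v x := fun x => by
    have := le_ballSup hvc.neg (ε := ε) (x := x) (y := x) (by simp; exact hε0.le)
    simp only [Pi.neg_apply] at this
    have h2 : W x = -ballSup (fun x => -v x) ε x := rfl
    have h3 : ballSup (-v) ε x = ballSup (fun x => -v x) ε x := rfl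
    rw [h2]; linarith
  obtain ⟨x₁, hx₁, hmax⟩ := hK.exists_isMaxOn ⟨y, subset_closure hy⟩ (hUc.sub hWc).continuousOn
  have hmax' : ∀ x ∈ closure Ω, U x - W x ≤ U x₁ - W x₁ := fun x hx => hmax hx
  have hbig : m ≤ U x₁ - W x₁ := by
    have := hmax' y (subset_closure hy)
    linarith [huU y, hWv y]
  -- maximum points are at distance more than `2 ε` from the complement
  have hin : ∀ x ∈ closure Ω, U x - W x = U x₁ - W x₁ → Metric.closedBall x (2 * ε) ⊆ Ω := by
    intro x hx hxe
    by_contra hcon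
    obtain ⟨w, hw, hwΩ⟩ := Set.not_subset.1 hcon
    -- A closed ball meeting both `Ω` and its complement meets the frontier, because it is
    -- connected.
    have hseg : ∃ p ∈ frontier Ω, ‖p - x‖ ≤ 2 * ε := by
      by_cases hxΩ : x ∈ Ω
      · have hpre : IsPreconnected (Metric.closedBall x (2 * ε)) :=
          (convex_closedBall x (2 * ε)).isPreconnected
        by_contra! hcon2
        have hsub : ∀ p ∈ Metric.closedBall x (2 * ε), p ∉ Ω → p ∈ (closure Ω)ᶜ :=
          fun p hp hpΩ hpc => (hcon2 p (by rw [hΩ.frontier_eq]; exact ⟨hpc, hpΩ⟩)).not_ge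
            (by rwa [mem_closedBall_iff_norm] at hp)
        obtain ⟨p, -, hp1, hp2⟩ := hpre Ω (closure Ω)ᶜ hΩ isClosed_closure.isOpen_compl
          (fun p hp => (em (p ∈ Ω)).imp id (hsub p hp))
          ⟨x, Metric.mem_closedBall_self (by linarith), hxΩ⟩ ⟨w, hw, hsub w hw hwΩ⟩
        exact hp2 (subset_closure hp1)
      · exact ⟨x, by rw [hΩ.frontier_eq]; exact ⟨hx, hxΩ⟩, by simp; linarith⟩
    obtain ⟨p, hpf, hp⟩ := hseg
    obtain ⟨a, ha, hae⟩ := exists_eq_ballSup huc hε0.le x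
    obtain ⟨b, hb, hbe⟩ := exists_eq_ballSup hvc.neg hε0.le x
    have hap : ‖a - p‖ < 3 * ε + 0 + (δu - 3 * ε) := by
      have := norm_sub_le_norm_sub_add_norm_sub a x p
      rw [norm_sub_rev x p] at this; linarith
    have hbp : ‖b - p‖ < 3 * ε + 0 + (δv - 3 * ε) := by
      have := norm_sub_le_norm_sub_add_norm_sub b x p
      rw [norm_sub_rev x p] at this; linarith
    have h1 := abs_lt.1 (hUu p hpf.1 a (by linarith))
    have h2 := abs_lt.1 (hUv p hpf.1 b (by linarith))
    have h3 := hbd p hpf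
    have h4 : W x = v b := by
      have : W x = -ballSup (-v) ε x := rfl
      rw [this, ← hbe]; simp
    have h5 : U x = u a := hae.symm
    linarith [h1.2, h2.1]
  refine not_forall_finite_difference hn hK hUc hWc hε0 hmax' ⟨x₁, hx₁, rfl⟩
    (fun x hx hxe => ((Metric.closedBall_subset_closedBall (by linarith)).trans
      (hin x hx hxe)).trans subset_closure)
    (fun x hx hxe y hy => hu.two_mul_ballSup_le huc hMu hε0 (hin x hx hxe) hy)
    (fun x hx hxe z hz => ?_)
  obtain ⟨y, hy, h⟩ := hv.neg.two_mul_ballSup_le hvc.neg hMv hε0 (hin x hx hxe) hz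
  refine ⟨y, hy, ?_⟩
  simp only [hW]
  linarith

/-- The comparison principle for the infinity-Laplacian. -/
theorem viscosity_comparison (hn : 0 < n) {Ω : Set (E n)} (hΩ : IsBoundedDomain Ω)
    {u v : E n → ℝ} (hu : IsViscositySubsolution Ω u) (hv : IsViscositySupersolution Ω v)
    (huc : ContinuousOn u (closure Ω)) (hvc : ContinuousOn v (closure Ω))
    (hbd : ∀ x ∈ frontier Ω, u x ≤ v x) : ∀ x ∈ closure Ω, u x ≤ v x := by
  obtain ⟨U, hU, hUe⟩ := exists_continuous_extension isClosed_closure huc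
  obtain ⟨V, hV, hVe⟩ := exists_continuous_extension isClosed_closure hvc
  intro x hx
  by_cases hxΩ : x ∈ Ω
  · rw [← hUe hx, ← hVe hx]
    refine comparison_of_continuous hn hΩ.isOpen hΩ.isBounded
      (hu.congr (hUe.mono subset_closure)) (hv.congr (hVe.mono subset_closure)) hU hV
      (fun y hy => ?_) x hxΩ
    rw [hUe hy.1, hVe hy.1]
    exact hbd y hy
  · exact hbd x (by rw [hΩ.isOpen.frontier_eq]; exact ⟨hx, hxΩ⟩)

theorem IsViscosityDirichletSolution.eqOn (hn : 0 < n) {Ω : Set (E n)} (hΩ : IsBoundedDomain Ω)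
    {f u w : E n → ℝ} (hw : IsViscosityDirichletSolution Ω f w)
    (hu : IsViscosityDirichletSolution Ω f u) : Set.EqOn w u (closure Ω) := by
  intro x hx
  refine le_antisymm
    (viscosity_comparison hn hΩ hw.2.2 hu.2.1 hw.1.1 hu.1.1 (fun y hy => ?_) x hx)
    (viscosity_comparison hn hΩ hu.2.2 hw.2.1 hu.1.1 hw.1.1 (fun y hy => ?_) x hx)
  · rw [hw.1.2 hy, hu.1.2 hy]
  · rw [hw.1.2 hy, hu.1.2 hy]

/-! ### Lipschitz bounds from cones -/

/-- One-sided Lipschitz estimate for subsolutions with Lipschitz boundary values. -/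
theorem IsViscositySubsolution.sub_le_mul_norm {Ω : Set (E n)} (hΩ : IsBoundedDomain Ω)
    {u : E n → ℝ} (hu : IsViscositySubsolution Ω u) (huc : ContinuousOn u (closure Ω)) {L : ℝ}
    (hL : 0 ≤ L) {y : E n} (hbd : ∀ x ∈ frontier Ω, u x - u y ≤ L * ‖x - y‖) :
    ∀ x ∈ closure Ω, u x - u y ≤ L * ‖x - y‖ := by
  intro x hx
  by_cases hxf : x ∈ frontier Ω
  · exact hbd x hxf
  have hxΩ : x ∈ Ω := by
    by_contra h
    exact hxf (by rw [hΩ.isOpen.frontier_eq]; exact ⟨hx, h⟩)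
  by_cases hxy : x = y
  · simp [hxy]
  obtain ⟨M, hM⟩ := hΩ.isCompact_closure.bddAbove_image huc
  have hopen : IsOpen (Ω \ {y}) := hΩ.isOpen.sdiff isClosed_singleton
  -- Deleting `y` makes it an admissible vertex even when it is interior; the only new boundary
  -- point is `y`, where the cone equals `u`.
  have := hu.le_cone (M := M) (fun x hx => hM ⟨x, subset_closure hx, rfl⟩) (V := Ω \ {y})
    hopen (hΩ.isBounded.subset Set.sdiff_subset) Set.sdiff_subset
    (huc.mono (closure_mono Set.sdiff_subset)) (z := y) (by simp) (a := u y) hL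
    (fun w hw => by
      by_cases hwy : w = y
      · simp [hwy]
      have hwf : w ∈ frontier Ω := by
        rw [hΩ.isOpen.frontier_eq]
        rw [hopen.frontier_eq] at hw
        exact ⟨closure_mono Set.sdiff_subset hw.1, fun h => hw.2 ⟨h, hwy⟩⟩
      linarith [hbd w hwf]) x ⟨hxΩ, hxy⟩
  linarith

/-- Cones with vertex on the frontier, used for `u` and for `-u`, control all pairs with one point
on the frontier. This is the boundary hypothesis needed to put the vertex anywhere in the closure.
-/
theorem IsViscosityDirichletSolution.lipschitzOnWith {Ω : Set (E n)} (hΩ : IsBoundedDomain Ω)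
    {f u : E n → ℝ} (hu : IsViscosityDirichletSolution Ω f u) {L : ℝ≥0}
    (hf : LipschitzOnWith L f (frontier Ω)) : LipschitzOnWith L u (closure Ω) := by
  have hb : ∀ x ∈ frontier Ω, ∀ y ∈ frontier Ω, |u x - u y| ≤ L * ‖x - y‖ := by
    intro x hx y hy
    rw [hu.1.2 hx, hu.1.2 hy]
    simpa [Real.dist_eq, dist_eq_norm] using hf.dist_le_mul x hx y hy
  have hneg : ContinuousOn (fun x => -u x) (closure Ω) := hu.1.1.neg
  have h1 : ∀ y ∈ frontier Ω, ∀ x ∈ closure Ω, u x - u y ≤ L * ‖x - y‖ := fun y hy =>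
    hu.2.2.sub_le_mul_norm hΩ hu.1.1 L.coe_nonneg fun x hx => (le_abs_self _).trans (hb x hx y hy)
  have h2 : ∀ y ∈ frontier Ω, ∀ x ∈ closure Ω, -u x - -u y ≤ L * ‖x - y‖ := fun y hy =>
    hu.2.1.neg.sub_le_mul_norm hΩ hneg L.coe_nonneg fun x hx => by
      have := (neg_abs_le _).trans' (neg_le_neg (hb x hx y hy))
      linarith
  have h3 : ∀ y ∈ closure Ω, ∀ x ∈ closure Ω, u x - u y ≤ L * ‖x - y‖ := fun y hy =>
    hu.2.2.sub_le_mul_norm hΩ hu.1.1 L.coe_nonneg fun x hx => by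
      have := h2 x hx y hy
      rw [norm_sub_rev] at this
      linarith
  refine LipschitzOnWith.of_dist_le_mul fun x hx y hy => ?_
  rw [Real.dist_eq, dist_eq_norm, abs_le]
  have := h3 x hx y hy
  rw [norm_sub_rev] at this
  exact ⟨by linarith, h3 y hy x hx⟩

/-! ### Weak gradients: linearity and the classical case -/

theorem ContDiff.continuous_partialDeriv {η : E n → ℝ} {k : WithTop ℕ∞} (h : ContDiff ℝ k η)
    (hk : k ≠ 0) (i : Fin n) : Continuous (partialDeriv i η) :=
  (h.continuous_fderiv hk).clm_apply continuous_const

theorem support_partialDeriv_subset (η : E n → ℝ) (i : Fin n) :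
    Function.support (partialDeriv i η) ⊆ tsupport η := by
  intro x hx
  refine support_fderiv_subset ℝ (fun h => hx ?_)
  simp [partialDeriv, h]

theorem tsupport_partialDeriv_subset (η : E n → ℝ) (i : Fin n) :
    tsupport (partialDeriv i η) ⊆ tsupport η :=
  closure_minimal (support_partialDeriv_subset η i) (isClosed_tsupport η)

theorem HasCompactSupport.partialDeriv {η : E n → ℝ} (h : HasCompactSupport η) (i : Fin n) :
    HasCompactSupport (partialDeriv i η) :=
  h.mono' (support_partialDeriv_subset η i)

theorem MeasureTheory.LocallyIntegrableOn.integrable_mul {Ω : Set (E n)} {u g : E n → ℝ}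
    (hu : LocallyIntegrableOn u Ω volume) (hg : Continuous g) (hgc : HasCompactSupport g)
    (hgΩ : tsupport g ⊆ Ω) : Integrable (fun x => u x * g x) volume := by
  have h1 : IntegrableOn u (tsupport g) := hu.integrableOn_compact_subset hgΩ hgc
  have h2 : IntegrableOn (fun x => u x * g x) (tsupport g) :=
    h1.mul_continuousOn hg.continuousOn hgc
  refine (integrableOn_iff_integrable_of_support_subset ?_).1 h2
  exact (Function.support_mul_subset_right u g).trans (subset_tsupport g)

theorem MeasureTheory.LocallyIntegrableOn.apply {Ω : Set (E n)} {G : E n → E n}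
    (hG : LocallyIntegrableOn G Ω volume) (i : Fin n) :
    LocallyIntegrableOn (fun x => G x i) Ω volume :=
  (EuclideanSpace.proj i : E n →L[ℝ] ℝ).locallyIntegrableOn_comp hG

theorem MeasureTheory.locallyIntegrableOn_of_forall_apply {Ω : Set (E n)} {G : E n → E n}
    (hG : ∀ i, LocallyIntegrableOn (fun x => G x i) Ω volume) :
    LocallyIntegrableOn G Ω volume := by
  intro x hx
  choose s hs hsi using fun i => hG i x hx
  refine ⟨⋂ i, s i, Filter.iInter_mem.2 hs, ?_⟩
  refine Integrable.of_eval_piLp fun i => ?_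
  exact (hsi i).mono_set (Set.iInter_subset _ i)

theorem setIntegral_mul_eq_of_tsupport_subset {Ω : Set (E n)} {u g : E n → ℝ}
    (hg : Function.support g ⊆ Ω) : ∫ x in Ω, u x * g x = ∫ x, u x * g x := by
  refine setIntegral_eq_integral_of_forall_compl_eq_zero fun x hx => ?_
  have : g x = 0 := by
    by_contra h
    exact hx (hg h)
  simp [this]

theorem HasWeakGradient.integral_eq {Ω : Set (E n)} {u : E n → ℝ} {G : E n → E n}
    (h : HasWeakGradient Ω u G) {η : E n → ℝ} (hη : ContDiff ℝ ∞ η) (hc : HasCompactSupport η)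
    (hs : tsupport η ⊆ Ω) (i : Fin n) :
    ∫ x, u x * partialDeriv i η x = -∫ x, G x i * η x := by
  rw [← setIntegral_mul_eq_of_tsupport_subset ((support_partialDeriv_subset η i).trans hs),
    ← setIntegral_mul_eq_of_tsupport_subset ((subset_tsupport η).trans hs)]
  exact h.2.2 η hη hc hs i

theorem hasWeakGradient_of_integral_eq {Ω : Set (E n)} {u : E n → ℝ} {G : E n → E n}
    (hu : LocallyIntegrableOn u Ω volume) (hG : LocallyIntegrableOn G Ω volume)
    (h : ∀ η : E n → ℝ, ContDiff ℝ ∞ η → HasCompactSupport η → tsupport η ⊆ Ω →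
      ∀ i : Fin n, ∫ x, u x * partialDeriv i η x = -∫ x, G x i * η x) :
    HasWeakGradient Ω u G := by
  refine ⟨hu, hG, fun η hη hc hs i => ?_⟩
  rw [setIntegral_mul_eq_of_tsupport_subset ((support_partialDeriv_subset η i).trans hs),
    setIntegral_mul_eq_of_tsupport_subset ((subset_tsupport η).trans hs)]
  exact h η hη hc hs i

theorem HasWeakGradient.mono {Ω V : Set (E n)} {u : E n → ℝ} {G : E n → E n}
    (h : HasWeakGradient Ω u G) (hV : V ⊆ Ω) : HasWeakGradient V u G :=
  hasWeakGradient_of_integral_eq (h.1.mono_set hV) (h.2.1.mono_set hV)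
    fun _ hη hc hs i => h.integral_eq hη hc (hs.trans hV) i

theorem HasWeakGradient.add {Ω : Set (E n)} {u v : E n → ℝ} {G H : E n → E n}
    (hu : HasWeakGradient Ω u G) (hv : HasWeakGradient Ω v H) :
    HasWeakGradient Ω (fun x => u x + v x) (fun x => G x + H x) := by
  refine hasWeakGradient_of_integral_eq (hu.1.add hv.1) (hu.2.1.add hv.2.1)
    fun η hη hc hs i => ?_
  have hd := hη.continuous_partialDeriv (by simp) i
  have hds := (tsupport_partialDeriv_subset η i).trans hs
  simp only [PiLp.add_apply, add_mul]
  rw [integral_add (hu.1.integrable_mul hd (hc.partialDeriv i) hds)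
    (hv.1.integrable_mul hd (hc.partialDeriv i) hds),
    integral_add ((hu.2.1.apply i).integrable_mul hη.continuous hc hs)
    ((hv.2.1.apply i).integrable_mul hη.continuous hc hs),
    hu.integral_eq hη hc hs, hv.integral_eq hη hc hs]
  ring

theorem HasWeakGradient.const_mul {Ω : Set (E n)} {u : E n → ℝ} {G : E n → E n}
    (hu : HasWeakGradient Ω u G) (c : ℝ) :
    HasWeakGradient Ω (fun x => c * u x) (fun x => c • G x) := by
  refine hasWeakGradient_of_integral_eq (hu.1.smul c) (hu.2.1.smul c) fun η hη hc hs i => ?_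
  simp only [PiLp.smul_apply, smul_eq_mul, mul_assoc]
  rw [integral_const_mul, integral_const_mul, hu.integral_eq hη hc hs]
  ring

theorem HasWeakGradient.neg {Ω : Set (E n)} {u : E n → ℝ} {G : E n → E n}
    (hu : HasWeakGradient Ω u G) : HasWeakGradient Ω (fun x => -u x) (fun x => -G x) := by
  simpa using hu.const_mul (-1)

theorem HasWeakGradient.sub {Ω : Set (E n)} {u v : E n → ℝ} {G H : E n → E n}
    (hu : HasWeakGradient Ω u G) (hv : HasWeakGradient Ω v H) :
    HasWeakGradient Ω (fun x => u x - v x) (fun x => G x - H x) := by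
  simpa [sub_eq_add_neg] using hu.add hv.neg

/-- The vector of classical partial derivatives. -/
def classicalGradient (φ : E n → ℝ) (x : E n) : E n :=
  WithLp.toLp 2 fun i => partialDeriv i φ x

@[simp]
theorem classicalGradient_apply (φ : E n → ℝ) (x : E n) (i : Fin n) :
    classicalGradient φ x i = partialDeriv i φ x := rfl

theorem ContDiffOn.continuousOn_partialDeriv {Ω : Set (E n)} (hΩ : IsOpen Ω) {φ : E n → ℝ}
    {k : WithTop ℕ∞} (hφ : ContDiffOn ℝ k φ Ω) (hk : 1 ≤ k) (i : Fin n) :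
    ContinuousOn (partialDeriv i φ) Ω :=
  (hφ.continuousOn_fderiv_of_isOpen hΩ hk).clm_apply continuousOn_const

/-- Integration by parts for a function that is `C¹` near the support of the other one. -/
theorem integral_mul_partialDeriv_eq {Ω : Set (E n)} (hΩ : IsOpen Ω) {φ η : E n → ℝ}
    (hφ : ContDiffOn ℝ 1 φ Ω) (hη : ContDiff ℝ 1 η) (hc : HasCompactSupport η)
    (hs : tsupport η ⊆ Ω) (i : Fin n) :
    ∫ x, φ x * partialDeriv i η x = -∫ x, partialDeriv i φ x * η x := by
  have hd := hη.continuous_partialDeriv (by simp) i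
  have hφl : LocallyIntegrableOn φ Ω volume :=
    hφ.continuousOn.locallyIntegrableOn hΩ.measurableSet
  have hφl' : LocallyIntegrableOn (partialDeriv i φ) Ω volume :=
    (hφ.continuousOn_partialDeriv hΩ le_rfl i).locallyIntegrableOn hΩ.measurableSet
  exact integral_mul_fderiv_eq_neg_fderiv_mul_of_integrable
    (hφl'.integrable_mul hη.continuous hc hs)
    (hφl.integrable_mul hd (hc.partialDeriv i) ((tsupport_partialDeriv_subset η i).trans hs))
    (hφl.integrable_mul hη.continuous hc hs)
    (fun x hx => (hφ.contDiffAt (hΩ.mem_nhds (hs hx))).differentiableAt (by simp))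
    (fun x _ => hη.differentiable (by simp) x)

theorem hasWeakGradient_classicalGradient {Ω : Set (E n)} (hΩ : IsOpen Ω) {φ : E n → ℝ}
    (hφ : ContDiffOn ℝ 1 φ Ω) : HasWeakGradient Ω φ (classicalGradient φ) :=
  hasWeakGradient_of_integral_eq (hφ.continuousOn.locallyIntegrableOn hΩ.measurableSet)
    (locallyIntegrableOn_of_forall_apply fun i =>
      (hφ.continuousOn_partialDeriv hΩ le_rfl i).locallyIntegrableOn hΩ.measurableSet)
    fun _ hη hc hs i => integral_mul_partialDeriv_eq hΩ hφ (hη.of_le (by simp)) hc hs i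

/-! ### Mollification -/

/-- Convolution of `g` with a normalized bump function. -/
def mollify (φ : ContDiffBump (0 : E n)) (g : E n → ℝ) : E n → ℝ :=
  convolution (φ.normed volume) g (ContinuousLinearMap.lsmul ℝ ℝ) volume

theorem mollify_apply (φ : ContDiffBump (0 : E n)) (g : E n → ℝ) (x : E n) :
    mollify φ g x = ∫ t, φ.normed volume (x - t) * g t :=
  convolution_lsmul_swap

theorem abs_mollify_le (φ : ContDiffBump (0 : E n)) {g : E n → ℝ} {C : ℝ} (hC : ∀ x, |g x| ≤ C)
    (x : E n) : |mollify φ g x| ≤ C := by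
  have h1 : ∫ t, φ.normed volume t * C = C := by
    rw [integral_mul_const, φ.integral_normed, one_mul]
  rw [← h1, ← Real.norm_eq_abs]
  refine norm_integral_le_of_norm_le (φ.integrable_normed.mul_const C)
    (Eventually.of_forall fun t => ?_)
  simp only [ContinuousLinearMap.lsmul_apply, smul_eq_mul, norm_mul, Real.norm_eq_abs]
  rw [abs_of_nonneg (φ.nonneg_normed t)]
  exact mul_le_mul_of_nonneg_left (hC _) (φ.nonneg_normed t)

theorem tsupport_mollify_subset (φ : ContDiffBump (0 : E n)) (g : E n → ℝ) :
    tsupport (mollify φ g) ⊆ Metric.cthickening φ.rOut (tsupport g) := by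
  refine closure_minimal ?_ Metric.isClosed_cthickening
  refine (support_convolution_subset _).trans ?_
  rintro _ ⟨a, ha, b, hb, rfl⟩
  rw [φ.support_normed_eq, mem_ball_zero_iff] at ha
  refine Metric.mem_cthickening_of_dist_le _ b _ _ (subset_tsupport g hb) ?_
  simpa [dist_eq_norm] using ha.le

theorem hasCompactSupport_mollify (φ : ContDiffBump (0 : E n)) {g : E n → ℝ}
    (hg : HasCompactSupport g) : HasCompactSupport (mollify φ g) :=
  φ.hasCompactSupport_normed.convolution _ hg

theorem contDiff_mollify (φ : ContDiffBump (0 : E n)) {g : E n → ℝ}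
    (hg : LocallyIntegrable g volume) : ContDiff ℝ ∞ (mollify φ g) :=
  φ.hasCompactSupport_normed.contDiff_convolution_left _ φ.contDiff_normed hg

theorem partialDeriv_mollify (φ : ContDiffBump (0 : E n)) {g : E n → ℝ} (hg : ContDiff ℝ 1 g)
    (hgc : HasCompactSupport g) (i : Fin n) :
    partialDeriv i (mollify φ g) = mollify φ (partialDeriv i g) := by
  funext x
  have hφ : LocallyIntegrable (φ.normed volume) volume :=
    φ.continuous_normed.locallyIntegrable
  rw [mollify, (hgc.hasFDerivAt_convolution_right _ hφ hg x).partialDeriv_eq,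
    convolution_precompR_apply _ hφ (hgc.fderiv ℝ) (hg.continuous_fderiv (by simp))]
  rfl

theorem partialDeriv_mollify_eq_integral (φ : ContDiffBump (0 : E n)) {u : E n → ℝ}
    (hu : LocallyIntegrable u volume) (i : Fin n) (y : E n) :
    partialDeriv i (mollify φ u) y = ∫ x, u x * partialDeriv i (φ.normed volume) (y - x) := by
  have h1 : ContDiff ℝ 1 (φ.normed volume) := φ.contDiff_normed (n := 1)
  have h2 := φ.hasCompactSupport_normed (μ := (volume : Measure (E n)))
  rw [mollify, (h2.hasFDerivAt_convolution_left _ h1 hu y).partialDeriv_eq]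
  have hex := (h2.fderiv ℝ).convolutionExists_left
    ((ContinuousLinearMap.lsmul ℝ ℝ : ℝ →L[ℝ] ℝ →L[ℝ] ℝ).precompL (E n))
    (h1.continuous_fderiv (by simp)) hu y
  rw [convolution_def, ContinuousLinearMap.integral_apply hex.integrable]
  rw [← integral_sub_left_eq_self _ volume y]
  refine integral_congr_ae (Eventually.of_forall fun x => ?_)
  simp [ContinuousLinearMap.precompL_apply, partialDeriv, mul_comm]

theorem partialDeriv_comp_sub_left {g : E n → ℝ} (hg : Differentiable ℝ g) (y : E n) (i : Fin n)
    (x : E n) : partialDeriv i (fun x => g (y - x)) x = -partialDeriv i g (y - x) := by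
  have h : HasFDerivAt (fun x => g (y - x)) _ x :=
    (hg (y - x)).hasFDerivAt.comp x ((hasFDerivAt_id x).const_sub y)
  rw [h.partialDeriv_eq]
  simp [partialDeriv]

/-- Near a compact subset, mollification commutes with the weak gradient. -/
theorem HasWeakGradient.partialDeriv_mollify {Ω : Set (E n)} {u : E n → ℝ} {G : E n → E n}
    (h : HasWeakGradient Ω u G) (hu : LocallyIntegrable u volume) (φ : ContDiffBump (0 : E n))
    {y : E n} (hy : Metric.closedBall y φ.rOut ⊆ Ω) (i : Fin n) :
    partialDeriv i (mollify φ u) y = ∫ x, G x i * φ.normed volume (y - x) := by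
  have hts : tsupport (fun x => φ.normed volume (y - x)) ⊆ Metric.closedBall y φ.rOut := by
    refine closure_minimal (fun x hx => ?_) Metric.isClosed_closedBall
    have : y - x ∈ Function.support (φ.normed (volume : Measure (E n))) := hx
    rw [φ.support_normed_eq, mem_ball_zero_iff] at this
    rw [mem_closedBall_iff_norm, norm_sub_rev]
    exact this.le
  have hcs : HasCompactSupport (fun x => φ.normed volume (y - x)) :=
    (isCompact_closedBall y φ.rOut).of_isClosed_subset (isClosed_tsupport _) hts
  have := h.integral_eq (η := fun x => φ.normed volume (y - x))
    (φ.contDiff_normed.comp (contDiff_const.sub contDiff_id)) hcs (hts.trans hy) i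
  have hd : Differentiable ℝ (φ.normed (volume : Measure (E n))) :=
    (φ.contDiff_normed (n := 1)).differentiable (by simp)
  simp only [partialDeriv_comp_sub_left hd, mul_neg, integral_neg, neg_inj] at this
  rw [partialDeriv_mollify_eq_integral φ hu, this]

/-- Fubini together with the evenness of the kernel: the mollification moves from `γ` to `g`. Limits
then need only pointwise convergence of mollified continuous functions, not `L^1` convergence of
mollified gradients. -/
theorem integral_mollify_mul (φ : ContDiffBump (0 : E n)) {γ g : E n → ℝ}
    (hγ : Integrable γ volume) (hg : Integrable g volume) :
    ∫ y, (∫ x, γ x * φ.normed volume (y - x)) * g y = ∫ x, γ x * mollify φ g x := by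
  have hint : Integrable (fun z : E n × E n => (φ.normed volume (z.1 - z.2)) * (g z.1 * γ z.2))
      (volume.prod volume) := by
    refine (hg.mul_prod hγ).bdd_mul (c := ⨆ t, ‖φ.normed volume t‖) ?_
      (Eventually.of_forall fun z => ?_)
    · exact (φ.continuous_normed.comp (continuous_fst.sub continuous_snd)).aestronglyMeasurable
    · refine le_ciSup (f := fun t => ‖φ.normed volume t‖) ?_ (z.1 - z.2)
      exact φ.continuous_normed.norm.bddAbove_range_of_hasCompactSupport
        φ.hasCompactSupport_normed.norm
  have hswap := integral_integral_swap (f := fun y x =>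
    φ.normed volume (y - x) * (g y * γ x)) hint
  calc ∫ y, (∫ x, γ x * φ.normed volume (y - x)) * g y
      = ∫ y, ∫ x, φ.normed volume (y - x) * (g y * γ x) := by
        refine integral_congr_ae (Eventually.of_forall fun y => ?_)
        simp only [← integral_mul_const]
        refine integral_congr_ae (Eventually.of_forall fun x => ?_)
        simp only; ring
    _ = ∫ x, ∫ y, φ.normed volume (y - x) * (g y * γ x) := hswap
    _ = ∫ x, γ x * mollify φ g x := by
        refine integral_congr_ae (Eventually.of_forall fun x => ?_)
        simp only [mollify_apply, ← integral_const_mul]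
        refine integral_congr_ae (Eventually.of_forall fun y => ?_)
        simp only
        rw [← φ.normed_neg, neg_sub]; ring

theorem HasWeakGradient.congr {Ω : Set (E n)} (hΩ : IsOpen Ω) {u v : E n → ℝ} {G H : E n → E n}
    (h : HasWeakGradient Ω u G) (hu : Set.EqOn u v Ω) (hG : Set.EqOn G H Ω) :
    HasWeakGradient Ω v H := by
  refine ⟨h.1.congr ((ae_restrict_iff' hΩ.measurableSet).2 (Eventually.of_forall hu)),
    h.2.1.congr ((ae_restrict_iff' hΩ.measurableSet).2 (Eventually.of_forall hG)),
    fun η hη hc hs i => ?_⟩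
  rw [← setIntegral_congr_fun hΩ.measurableSet (fun x hx => by simp only [hu hx] :
      Set.EqOn (fun x => u x * partialDeriv i η x) (fun x => v x * partialDeriv i η x) Ω),
    ← setIntegral_congr_fun hΩ.measurableSet (fun x hx => by simp only [hG hx] :
      Set.EqOn (fun x => G x i * η x) (fun x => H x i * η x) Ω)]
  exact h.2.2 η hη hc hs i

/-- A sequence of bump functions whose supports shrink to the origin. -/
def bumpSeq {n : ℕ} (δ : ℝ) (hδ : 0 < δ) (k : ℕ) : ContDiffBump (0 : E n) where
  rIn := δ / (k + 2)
  rOut := δ / (k + 1)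
  rIn_pos := by positivity
  rIn_lt_rOut := by gcongr; linarith

theorem bumpSeq_rOut_le {δ : ℝ} (hδ : 0 < δ) (k : ℕ) : (bumpSeq (n := n) δ hδ k).rOut ≤ δ :=
  div_le_self hδ.le (by linarith [(Nat.cast_nonneg k : (0 : ℝ) ≤ k)])

theorem tendsto_bumpSeq_rOut {δ : ℝ} (hδ : 0 < δ) :
    Tendsto (fun k => (bumpSeq (n := n) δ hδ k).rOut) atTop (𝓝 0) := by
  have := tendsto_one_div_add_atTop_nhds_zero_nat (𝕜 := ℝ)
  simpa [bumpSeq, div_eq_mul_inv] using this.const_mul δ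

theorem tendsto_mollify {φ : ℕ → ContDiffBump (0 : E n)}
    (hφ : Tendsto (fun k => (φ k).rOut) atTop (𝓝 0)) {g : ℕ → E n → ℝ}
    (hgm : ∀ k, Continuous (g k)) {k : ℕ → E n} {x : E n} {z : ℝ}
    (hlim : Tendsto (Function.uncurry g) (atTop ×ˢ 𝓝 x) (𝓝 z))
    (hk : Tendsto k atTop (𝓝 x)) : Tendsto (fun j => mollify (φ j) (g j) (k j)) atTop (𝓝 z) :=
  ContDiffBump.convolution_tendsto_right hφ
    (Eventually.of_forall fun k => (hgm k).aestronglyMeasurable) hlim hk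

/-- The limit is joint in the index and the point because these mollified functions occur inside a
second mollification in the chain rule. -/
theorem tendsto_uncurry_mollify {φ : ℕ → ContDiffBump (0 : E n)}
    (hφ : Tendsto (fun k => (φ k).rOut) atTop (𝓝 0)) {g : E n → ℝ} (hg : Continuous g) (x : E n) :
    Tendsto (Function.uncurry fun k => mollify (φ k) g) (atTop ×ˢ 𝓝 x) (𝓝 (g x)) := by
  rw [Metric.tendsto_nhds]
  intro ε hε
  obtain ⟨r, hr, hball⟩ := Metric.continuous_iff.1 hg x (ε / 3) (by positivity)
  have h1 : ∀ᶠ k in atTop, (φ k).rOut < r / 2 := hφ.eventually (gt_mem_nhds (by positivity))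
  have h2 : ∀ᶠ y in 𝓝 x, dist y x < r / 2 := Metric.ball_mem_nhds x (by positivity)
  filter_upwards [h1.prod_mk h2] with ⟨k, y⟩ ⟨hk, hy⟩
  have h3 : dist (g y) (g x) < ε / 3 := hball y (by linarith)
  have h4 : dist (mollify (φ k) g y) (g y) ≤ 2 * (ε / 3) := by
    refine (φ k).dist_normed_convolution_le hg.aestronglyMeasurable fun z hz => ?_
    rw [Metric.mem_ball] at hz
    have h5 : dist (g z) (g x) < ε / 3 := hball z (by linarith [dist_triangle z y x])
    linarith [dist_triangle_right (g z) (g y) (g x)]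
  simp only [Function.uncurry]
  linarith [dist_triangle (mollify (φ k) g y) (g y) (g x)]

/-- Passage to the limit in integrals against mollified functions supported in a fixed compact
set. -/
theorem tendsto_integral_mul_mollify {Ω K : Set (E n)} {γ : E n → ℝ}
    (hγ : LocallyIntegrableOn γ Ω volume) {φ : ℕ → ContDiffBump (0 : E n)}
    (hφ : Tendsto (fun k => (φ k).rOut) atTop (𝓝 0)) (hK : IsCompact K) (hKΩ : K ⊆ Ω)
    {g : ℕ → E n → ℝ} {g₀ : E n → ℝ} {C : ℝ} (hgm : ∀ k, Continuous (g k))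
    (hgC : ∀ k x, |g k x| ≤ C) (hs : ∀ k, ∀ x ∉ K, mollify (φ k) (g k) x = 0)
    (hlim : ∀ x, Tendsto (Function.uncurry g) (atTop ×ˢ 𝓝 x) (𝓝 (g₀ x))) :
    Tendsto (fun k => ∫ x, γ x * mollify (φ k) (g k) x) atTop (𝓝 (∫ x, γ x * g₀ x)) := by
  have hγK : IntegrableOn γ K := hγ.integrableOn_compact_subset hKΩ hK
  have hpt : ∀ x, Tendsto (fun k => mollify (φ k) (g k) x) atTop (𝓝 (g₀ x)) := fun x =>
    tendsto_mollify hφ hgm (hlim x) tendsto_const_nhds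
  have hg₀ : ∀ x ∉ K, g₀ x = 0 := fun x hx =>
    tendsto_nhds_unique (hpt x) (by simp [hs _ x hx])
  have hi : Integrable (K.indicator γ) := hγK.integrable_indicator hK.measurableSet
  have h1 : ∀ k, (fun x => γ x * mollify (φ k) (g k) x) =
      fun x => K.indicator γ x * mollify (φ k) (g k) x := by
    intro k; funext x
    by_cases hx : x ∈ K
    · simp [hx]
    · simp [hx, hs k x hx]
  have h2 : (fun x => γ x * g₀ x) = fun x => K.indicator γ x * g₀ x := by
    funext x
    by_cases hx : x ∈ K
    · simp [hx]
    · simp [hx, hg₀ x hx]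
  simp_rw [h1, h2]
  refine tendsto_integral_of_dominated_convergence (fun x => |K.indicator γ x| * C)
    (fun k => ?_) (hi.abs.mul_const C) (fun k => Eventually.of_forall fun x => ?_)
    (Eventually.of_forall fun x => (hpt x).const_mul _)
  · exact hi.aestronglyMeasurable.mul
      (contDiff_mollify (φ k) (hgm k).locallyIntegrable).continuous.aestronglyMeasurable
  · rw [norm_mul, Real.norm_eq_abs, Real.norm_eq_abs]
    exact mul_le_mul_of_nonneg_left (abs_mollify_le _ (hgC k) x) (abs_nonneg _)

theorem HasCompactSupport.exists_abs_le {g : E n → ℝ} (hc : HasCompactSupport g)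
    (hg : Continuous g) : ∃ C, 0 ≤ C ∧ ∀ x, |g x| ≤ C := by
  obtain ⟨C, hC⟩ := hg.bounded_above_of_compact_support hc
  exact ⟨C, (norm_nonneg _).trans (hC 0), hC⟩

/-! ### Chain rule, cutoffs and Lipschitz functions -/

/-- The weak gradient may be tested with `C¹` functions of compact support. -/
theorem HasWeakGradient.integral_eq_of_contDiff_one {Ω : Set (E n)} (hΩ : IsOpen Ω) {u : E n → ℝ}
    {G : E n → E n} (h : HasWeakGradient Ω u G) {η : E n → ℝ} (hη : ContDiff ℝ 1 η)
    (hc : HasCompactSupport η) (hs : tsupport η ⊆ Ω) (i : Fin n) :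
    ∫ x, u x * partialDeriv i η x = -∫ x, G x i * η x := by
  obtain ⟨δ, hδ, hδΩ⟩ := hc.isCompact.exists_cthickening_subset_open hΩ hs
  have hK : IsCompact (Metric.cthickening δ (tsupport η)) := hc.isCompact.cthickening
  have hd := hη.continuous_partialDeriv (by simp) i
  have hzero : ∀ g : E n → ℝ, tsupport g ⊆ tsupport η → ∀ k,
      tsupport (mollify (bumpSeq δ hδ k) g) ⊆ Metric.cthickening δ (tsupport η) := fun g hg k =>
    (tsupport_mollify_subset _ _).trans ((Metric.cthickening_mono (bumpSeq_rOut_le hδ k) _).trans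
      (Metric.cthickening_subset_of_subset _ hg))
  obtain ⟨C, -, hC⟩ := hc.exists_abs_le hη.continuous
  obtain ⟨D, -, hD⟩ := (hc.partialDeriv i).exists_abs_le hd
  have hcont : ∀ g : E n → ℝ, Continuous g → ∀ x,
      Tendsto (Function.uncurry fun _ : ℕ => g) (atTop ×ˢ 𝓝 x) (𝓝 (g x)) := fun g hg x =>
    (hg.tendsto x).comp tendsto_snd
  have h1 := tendsto_integral_mul_mollify h.1 (tendsto_bumpSeq_rOut hδ) hK hδΩ
    (fun _ => hd) (fun _ => hD) (fun k x hx => image_eq_zero_of_notMem_tsupport fun hx' =>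
      hx (hzero _ (tsupport_partialDeriv_subset η i) k hx')) (hcont _ hd)
  have h2 := tendsto_integral_mul_mollify (h.2.1.apply i) (tendsto_bumpSeq_rOut hδ) hK hδΩ
    (fun _ => hη.continuous) (fun _ => hC) (fun k x hx => image_eq_zero_of_notMem_tsupport
      fun hx' => hx (hzero _ subset_rfl k hx')) (hcont _ hη.continuous)
  refine tendsto_nhds_unique h1 (h2.neg.congr fun k => ?_)
  rw [← _root_.partialDeriv_mollify _ hη hc]
  exact (h.integral_eq (contDiff_mollify _ hη.continuous.locallyIntegrable)
    (hasCompactSupport_mollify _ hc) ((hzero _ subset_rfl k).trans hδΩ) i).symm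

/-- A Tietze extension, truncated so that all its mollifications obey one bound. -/
theorem exists_bounded_continuous_extension {K : Set (E n)} (hK : IsCompact K) {u : E n → ℝ}
    (hu : ContinuousOn u K) : ∃ U : E n → ℝ, Continuous U ∧ Set.EqOn U u K ∧
      ∃ M, ∀ x, |U x| ≤ M := by
  obtain ⟨V, hV, hVe⟩ := exists_continuous_extension hK.isClosed hu
  obtain ⟨M, hM⟩ := hK.exists_bound_of_continuousOn hu
  refine ⟨fun x => max (-|M|) (min |M| (V x)), by fun_prop, fun x hx => ?_, |M|, fun x => ?_⟩
  · have := abs_le.1 ((hM x hx).trans (le_abs_self M))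
    simp only [hVe hx]
    rw [min_eq_right this.2, max_eq_right this.1]
  · exact abs_le.2 ⟨le_max_left _ _, max_le (by linarith [abs_nonneg M]) (min_le_left _ _)⟩

theorem partialDeriv_comp {h : ℝ → ℝ} {w : E n → ℝ} {x : E n} (hh : DifferentiableAt ℝ h (w x))
    (hw : DifferentiableAt ℝ w x) (i : Fin n) :
    partialDeriv i (fun y => h (w y)) x = deriv h (w x) * partialDeriv i w x := by
  have : HasFDerivAt (fun y => h (w y)) (deriv h (w x) • fderiv ℝ w x) x :=
    hh.hasDerivAt.comp_hasFDerivAt x hw.hasFDerivAt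
  rw [this.partialDeriv_eq]
  rfl

/-- The chain rule for weak gradients of continuous functions. -/
theorem HasWeakGradient.comp_contDiff {Ω : Set (E n)} (hΩ : IsOpen Ω) {u : E n → ℝ}
    {G : E n → E n} (hu : HasWeakGradient Ω u G) (huc : ContinuousOn u Ω) {h : ℝ → ℝ}
    (hh : ContDiff ℝ 1 h) {C : ℝ} (hC : ∀ t, |deriv h t| ≤ C) :
    HasWeakGradient Ω (fun x => h (u x)) (fun x => deriv h (u x) • G x) := by
  have hh' : Continuous (deriv h) := hh.continuous_deriv le_rfl
  refine hasWeakGradient_of_integral_eq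
    ((hh.continuous.comp_continuousOn huc).locallyIntegrableOn hΩ.measurableSet)
    (hu.2.1.continuousOn_smul hΩ.isLocallyClosed (hh'.comp_continuousOn huc))
    fun η hη hc hs i => ?_
  obtain ⟨δ, hδ, hδΩ⟩ := hc.isCompact.exists_cthickening_subset_open hΩ hs
  set K := Metric.cthickening δ (tsupport η) with hKdef
  have hK : IsCompact K := hc.isCompact.cthickening
  have hηK : tsupport η ⊆ K := Metric.self_subset_cthickening _
  obtain ⟨U, hUc, hUe, M, hM⟩ := exists_bounded_continuous_extension hK (huc.mono hδΩ)
  set V := Metric.thickening δ (tsupport η) with hVdef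
  have hVK : V ⊆ K := Metric.thickening_subset_cthickening _ _
  set H : E n → E n := K.indicator G with hH
  have hUV : HasWeakGradient V U H := (hu.mono (hVK.trans hδΩ)).congr Metric.isOpen_thickening
    (fun x hx => (hUe (hVK hx)).symm) (fun x hx => by simp [hH, hVK hx])
  have hHi : ∀ i, Integrable (fun x => H x i) := fun i => by
    have h1 : IntegrableOn G K := hu.2.1.integrableOn_compact_subset hδΩ hK
    exact (EuclideanSpace.proj i : E n →L[ℝ] ℝ).integrable_comp
      (h1.integrable_indicator hK.measurableSet)
  -- Mollifying at radius at most `δ/2` keeps every ball around the support of `η` inside `V`, where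
  -- `H` is the weak gradient of `U`.
  have hδ2 : 0 < δ / 2 := by positivity
  set φ := fun k => bumpSeq (n := n) (δ / 2) hδ2 k with hφdef
  have hφ : Tendsto (fun k => (φ k).rOut) atTop (𝓝 0) := tendsto_bumpSeq_rOut hδ2
  have hφle : ∀ k, (φ k).rOut ≤ δ / 2 := bumpSeq_rOut_le hδ2
  set w := fun k => mollify (φ k) U with hw
  have hws : ∀ k, ContDiff ℝ ∞ (w k) := fun k => contDiff_mollify _ hUc.locallyIntegrable
  have hwU : ∀ x, Tendsto (Function.uncurry w) (atTop ×ˢ 𝓝 x) (𝓝 (U x)) :=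
    tendsto_uncurry_mollify hφ hUc
  have hwM : ∀ k x, |w k x| ≤ M := fun k x => abs_mollify_le _ hM x
  have hdη := hη.continuous_partialDeriv (by simp) i
  -- the left-hand side
  obtain ⟨B, hB⟩ := (isCompact_Icc (a := -M) (b := M)).exists_bound_of_continuousOn
    hh.continuous.continuousOn
  have hleft : Tendsto (fun k => ∫ x, h (w k x) * partialDeriv i η x) atTop
      (𝓝 (∫ x, h (u x) * partialDeriv i η x)) := by
    have he : (fun x => h (u x) * partialDeriv i η x) = fun x => h (U x) * partialDeriv i η x := by
      funext x
      by_cases hx : x ∈ tsupport η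
      · rw [hUe (hηK hx)]
      · have : partialDeriv i η x = 0 := by
          by_contra hne
          exact hx (support_partialDeriv_subset η i hne)
        simp [this]
    rw [he]
    refine tendsto_integral_of_dominated_convergence (fun x => B * |partialDeriv i η x|)
      (fun k => ?_) ?_ (fun k => Eventually.of_forall fun x => ?_)
      (Eventually.of_forall fun x => ?_)
    · exact ((hh.continuous.comp (hws k).continuous).mul hdη).aestronglyMeasurable
    · exact ((hdη.integrable_of_hasCompactSupport (hc.partialDeriv i)).abs).const_mul B
    · rw [norm_mul, Real.norm_eq_abs (partialDeriv i η x)]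
      exact mul_le_mul_of_nonneg_right (hB _ (abs_le.1 (hwM k x))) (abs_nonneg _)
    · have hwx : Tendsto (fun k => w k x) atTop (𝓝 (U x)) :=
        tendsto_mollify hφ (fun _ => hUc) ((hUc.tendsto x).comp tendsto_snd) tendsto_const_nhds
      exact ((hh.continuous.tendsto _).comp hwx).mul_const _
  -- the right-hand side
  set g := fun k x => deriv h (w k x) * η x with hg
  have hgc : ∀ k, Continuous (g k) := fun k => (hh'.comp (hws k).continuous).mul hη.continuous
  obtain ⟨D, hD0, hD⟩ := hc.exists_abs_le hη.continuous
  have hgs : ∀ k, tsupport (g k) ⊆ tsupport η := fun k => closure_mono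
    (Function.support_mul_subset_right _ _)
  have hright : Tendsto (fun k => ∫ x, H x i * mollify (φ k) (g k) x) atTop
      (𝓝 (∫ x, H x i * (deriv h (U x) * η x))) := by
    refine tendsto_integral_mul_mollify (Ω := Set.univ) (K := K) (C := C * D)
      ((hHi i).locallyIntegrable.locallyIntegrableOn _) hφ hK (Set.subset_univ _) hgc
      (fun k x => ?_) (fun k x hx => ?_) (fun x => ?_)
    · simp only [hg]
      rw [abs_mul]
      exact mul_le_mul (hC _) (hD x) (abs_nonneg _) ((abs_nonneg _).trans (hC 0))
    · refine image_eq_zero_of_notMem_tsupport fun hx' => hx ?_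
      exact Metric.cthickening_mono ((hφle k).trans (by linarith)) _
        (Metric.cthickening_subset_of_subset _ (hgs k) (tsupport_mollify_subset _ _ hx'))
    · exact ((hh'.tendsto _).comp (hwU x)).mul ((hη.continuous.tendsto x).comp tendsto_snd)
  have hlim : ∫ x, (deriv h (u x) • G x) i * η x = ∫ x, H x i * (deriv h (U x) * η x) := by
    refine integral_congr_ae (Eventually.of_forall fun x => ?_)
    by_cases hx : x ∈ tsupport η
    · simp only [hH, Set.indicator_of_mem (hηK hx), hUe (hηK hx), PiLp.smul_apply, smul_eq_mul]
      ring
    · simp [image_eq_zero_of_notMem_tsupport hx]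
  rw [hlim]
  refine tendsto_nhds_unique hleft (hright.neg.congr fun k => ?_)
  have hhw : ContDiff ℝ 1 fun x => h (w k x) := hh.comp ((hws k).of_le (by simp))
  rw [integral_mul_partialDeriv_eq isOpen_univ hhw.contDiffOn (hη.of_le (by simp)) hc
    (Set.subset_univ _), ← integral_mollify_mul _ (hHi i)
    ((hgc k).integrable_of_hasCompactSupport (hc.of_isClosed_subset (isClosed_tsupport _) (hgs k)))]
  congr 1
  refine integral_congr_ae (Eventually.of_forall fun y => ?_)
  by_cases hy : y ∈ tsupport η
  · have hyV : Metric.closedBall y (φ k).rOut ⊆ V := fun x hx => by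
      refine Metric.mem_thickening_iff.2 ⟨y, hy, ?_⟩
      rw [Metric.mem_closedBall] at hx
      linarith [hφle k]
    simp only [hg]
    rw [partialDeriv_comp (hh.differentiable (by simp) _) ((hws k).differentiable (by simp) _),
      ← hUV.partialDeriv_mollify hUc.locallyIntegrable (φ k) hyV i]
    ring
  · simp [hg, image_eq_zero_of_notMem_tsupport hy]

theorem exists_smooth_cutoff {K V : Set (E n)} (hK : IsCompact K) (hV : IsOpen V) (hKV : K ⊆ V) :
    ∃ χ : E n → ℝ, ContDiff ℝ ∞ χ ∧ HasCompactSupport χ ∧ tsupport χ ⊆ V ∧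
      (∀ x ∈ K, χ =ᶠ[𝓝 x] 1) ∧ ∀ x, 0 ≤ χ x := by
  obtain ⟨δ, hδ, hδV⟩ := hK.exists_cthickening_subset_open hV hKV
  have hint : K ⊆ interior (Metric.cthickening δ K) :=
    (Metric.self_subset_thickening hδ K).trans
      (interior_maximal (Metric.thickening_subset_cthickening _ _) Metric.isOpen_thickening)
  obtain ⟨f, h1, h0, hf⟩ := exists_contMDiffMap_one_nhds_of_subset_interior (n := (⊤ : ℕ∞))
    (modelWithCornersSelf ℝ (E n)) hK.isClosed hint
  have hts : tsupport f ⊆ Metric.cthickening δ K :=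
    closure_minimal (fun x hx => by_contra fun h => hx (h0 x h)) Metric.isClosed_cthickening
  exact ⟨f, f.contMDiff.contDiff, hK.cthickening.of_isClosed_subset (isClosed_tsupport _) hts,
    hts.trans hδV, fun x hx => (eventually_nhdsSet_iff_forall.1 h1) x hx, fun x => (hf x).1⟩

/-- A function that vanishes outside a compact subset of `V` may be extended by zero. -/
theorem HasWeakGradient.indicator_of_isCompact {V K : Set (E n)} (hV : IsOpen V) {w : E n → ℝ}
    {H : E n → E n} (h : HasWeakGradient V w H) (hK : IsCompact K) (hKV : K ⊆ V)
    (hw : ∀ x ∈ V, x ∉ K → w x = 0) (hH : ∀ x ∈ V, x ∉ K → H x = 0) :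
    HasWeakGradient Set.univ (V.indicator w) (V.indicator H) := by
  have hwK : V.indicator w = K.indicator w := by
    funext x
    by_cases hx : x ∈ K
    · simp [hx, hKV hx]
    · by_cases hxV : x ∈ V <;> simp [hx, hxV, hw]
  have hHK : V.indicator H = K.indicator H := by
    funext x
    by_cases hx : x ∈ K
    · simp [hx, hKV hx]
    · by_cases hxV : x ∈ V <;> simp [hx, hxV, hH]
  have hwi : IntegrableOn w K := h.1.integrableOn_compact_subset hKV hK
  have hHi : IntegrableOn H K := h.2.1.integrableOn_compact_subset hKV hK
  -- Since `χ = 1` near `K`, an arbitrary test function `η` may be replaced by `χη`, which is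
  -- supported in `V`.
  obtain ⟨χ, hχ, hχc, hχV, hχ1, -⟩ := exists_smooth_cutoff hK hV hKV
  refine hasWeakGradient_of_integral_eq ?_ ?_ fun η hη hc _ i => ?_
  · rw [hwK]
    exact (hwi.integrable_indicator hK.measurableSet).locallyIntegrable.locallyIntegrableOn _
  · rw [hHK]
    exact (hHi.integrable_indicator hK.measurableSet).locallyIntegrable.locallyIntegrableOn _
  have hts : tsupport (fun x => χ x * η x) ⊆ V :=
    (closure_mono (Function.support_mul_subset_left _ _)).trans hχV
  have key := h.integral_eq (η := fun x => χ x * η x) (hχ.mul hη) hχc.mul_right hts i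
  have e1 : ∫ x, V.indicator w x * partialDeriv i η x =
      ∫ x, w x * partialDeriv i (fun x => χ x * η x) x := by
    refine integral_congr_ae (Eventually.of_forall fun x => ?_)
    by_cases hxK : x ∈ K
    · have : (fun x => χ x * η x) =ᶠ[𝓝 x] η := by
        filter_upwards [hχ1 x hxK] with y hy
        simp [hy]
      simp [hKV hxK, this.partialDeriv_eq i]
    · by_cases hxV : x ∈ V
      · simp [hxV, hw x hxV hxK]
      · have : partialDeriv i (fun x => χ x * η x) x = 0 := by
          by_contra hne
          exact hxV (hts (support_partialDeriv_subset _ i hne))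
        simp [hxV, this]
  have e2 : ∫ x, V.indicator H x i * η x = ∫ x, H x i * (χ x * η x) := by
    refine integral_congr_ae (Eventually.of_forall fun x => ?_)
    by_cases hxK : x ∈ K
    · simp [hKV hxK, (hχ1 x hxK).self_of_nhds]
    · by_cases hxV : x ∈ V
      · simp [hxV, hH x hxV hxK]
      · have : χ x = 0 := image_eq_zero_of_notMem_tsupport fun h => hxV (hχV h)
        simp [hxV, this]
  rw [e1, e2, key]

theorem fderiv_apply_eq_sum (φ : E n → ℝ) (x v : E n) :
    fderiv ℝ φ x v = ∑ i, v i * partialDeriv i φ x := by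
  have hv : v = ∑ i, v i • EuclideanSpace.single i (1 : ℝ) := by
    simpa using ((EuclideanSpace.basisFun (Fin n) ℝ).sum_repr v).symm
  conv_lhs => rw [hv]
  simp [partialDeriv]

theorem inner_classicalGradient (φ : E n → ℝ) (x v : E n) :
    inner ℝ (classicalGradient φ x) v = fderiv ℝ φ x v := by
  rw [fderiv_apply_eq_sum, PiLp.inner_apply]
  simp

theorem norm_classicalGradient_le {φ : E n → ℝ} {x : E n} {L : ℝ} (h : ‖fderiv ℝ φ x‖ ≤ L) :
    ‖classicalGradient φ x‖ ≤ L := by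
  have h1 := (fderiv ℝ φ x).le_opNorm (classicalGradient φ x)
  rw [← inner_classicalGradient, real_inner_self_eq_norm_sq, norm_pow, norm_norm] at h1
  rcases (norm_nonneg (classicalGradient φ x)).eq_or_lt with h2 | h2
  · rw [← h2]; exact (norm_nonneg _).trans h
  · nlinarith

theorem measurable_classicalGradient (φ : E n → ℝ) : Measurable (classicalGradient φ) := by
  have : Measurable fun x => fun i => partialDeriv i φ x :=
    measurable_pi_lambda _ fun i => measurable_fderiv_apply_const ℝ φ _
  exact (WithLp.measurable_toLp 2 _).comp this

theorem LipschitzWith.norm_classicalGradient_le {u : E n → ℝ} {L : ℝ≥0} (hu : LipschitzWith L u)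
    (x : E n) : ‖classicalGradient u x‖ ≤ L :=
  _root_.norm_classicalGradient_le (norm_fderiv_le_of_lipschitz ℝ hu)

theorem locallyIntegrable_of_norm_le {G : E n → E n} (hG : Measurable G) {L : ℝ}
    (hL : ∀ x, ‖G x‖ ≤ L) : LocallyIntegrable G volume :=
  (locallyIntegrable_const L).mono hG.aestronglyMeasurable
    (Eventually.of_forall fun x => (hL x).trans (le_abs_self L))

/-- Rademacher's theorem identifies line derivatives with `fderiv` almost everywhere; the default
value at points of nondifferentiability is harmless. Integration by parts is the known formula for
line derivatives of Lipschitz functions. -/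
theorem LipschitzWith.hasWeakGradient {u : E n → ℝ} {L : ℝ≥0} (hu : LipschitzWith L u) :
    HasWeakGradient Set.univ u (classicalGradient u) := by
  refine hasWeakGradient_of_integral_eq (hu.continuous.locallyIntegrable.locallyIntegrableOn _)
    ((locallyIntegrable_of_norm_le (measurable_classicalGradient u)
      hu.norm_classicalGradient_le).locallyIntegrableOn _) fun η hη hc _ i => ?_
  obtain ⟨D, hD⟩ := (hη.of_le (by simp) : ContDiff ℝ 1 η).lipschitzWith_of_hasCompactSupport hc
    (by simp)
  have key := hu.integral_lineDeriv_mul_eq (μ := volume) hD hc (EuclideanSpace.single i 1)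
  have h1 : ∫ x, classicalGradient u x i * η x =
      ∫ x, lineDeriv ℝ u x (EuclideanSpace.single i 1) * η x := by
    refine integral_congr_ae ?_
    filter_upwards [hu.ae_differentiableAt (μ := volume)] with x hx
    rw [hx.lineDeriv_eq_fderiv]
    rfl
  have h2 : ∫ x, u x * partialDeriv i η x =
      -∫ x, lineDeriv ℝ η x (-EuclideanSpace.single i 1) * u x := by
    rw [← integral_neg]
    refine integral_congr_ae (Eventually.of_forall fun x => ?_)
    simp only
    rw [(hη.differentiable (by simp) x).lineDeriv_eq_fderiv, map_neg]
    simp [partialDeriv, mul_comm]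
  rw [h1, key, h2]

/-! ### Truncation and extension by zero -/

/-- The primitive of `θ` vanishing at the origin. -/
def primitive (θ : ℝ → ℝ) (t : ℝ) : ℝ := ∫ s in (0 : ℝ)..t, θ s

theorem hasDerivAt_primitive {θ : ℝ → ℝ} (hθ : Continuous θ) (t : ℝ) :
    HasDerivAt (primitive θ) (θ t) t :=
  (hθ.integral_hasStrictDerivAt 0 t).hasDerivAt

theorem deriv_primitive {θ : ℝ → ℝ} (hθ : Continuous θ) : deriv (primitive θ) = θ :=
  funext fun t => (hasDerivAt_primitive hθ t).deriv

theorem contDiff_primitive {θ : ℝ → ℝ} (hθ : Continuous θ) : ContDiff ℝ 1 (primitive θ) := by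
  rw [contDiff_one_iff_deriv, deriv_primitive hθ]
  exact ⟨fun t => (hasDerivAt_primitive hθ t).differentiableAt, hθ⟩

theorem abs_primitive_le {θ : ℝ → ℝ} (h : ∀ t, |θ t| ≤ 1) (t : ℝ) : |primitive θ t| ≤ |t| := by
  have := intervalIntegral.norm_integral_le_of_norm_le_const (a := 0) (b := t) (C := 1) (f := θ)
    fun s _ => h s
  simpa [primitive] using this

/-- Continuous approximations of the indicator function of `{t | t ≠ 0}` vanishing near `0`. -/
def truncDeriv (k : ℕ) (s : ℝ) : ℝ := Real.smoothTransition ((k + 1) * |s| - 1)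

theorem continuous_truncDeriv (k : ℕ) : Continuous (truncDeriv k) :=
  Real.smoothTransition.continuous.comp (by fun_prop)

theorem abs_truncDeriv_le (k : ℕ) (s : ℝ) : |truncDeriv k s| ≤ 1 := by
  rw [truncDeriv, abs_of_nonneg (Real.smoothTransition.nonneg _)]
  exact Real.smoothTransition.le_one _

theorem truncDeriv_of_abs_le {k : ℕ} {s : ℝ} (h : |s| ≤ 1 / (k + 1)) : truncDeriv k s = 0 := by
  refine Real.smoothTransition.zero_of_nonpos ?_
  rw [le_div_iff₀ (by positivity)] at h
  linarith

theorem tendsto_truncDeriv {s : ℝ} (hs : s ≠ 0) :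
    Tendsto (fun k => truncDeriv k s) atTop (𝓝 1) := by
  refine tendsto_const_nhds.congr' ?_
  obtain ⟨N, hN⟩ := exists_nat_gt (2 / |s|)
  filter_upwards [eventually_ge_atTop N] with k hk
  refine (Real.smoothTransition.one_of_one_le ?_).symm
  have h1 : 0 < |s| := abs_pos.2 hs
  rw [div_lt_iff₀ h1] at hN
  have h2 : (N : ℝ) ≤ k := by exact_mod_cast hk
  nlinarith

theorem primitive_truncDeriv_of_abs_le {k : ℕ} {t : ℝ} (h : |t| ≤ 1 / (k + 1)) :
    primitive (truncDeriv k) t = 0 := by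
  refine intervalIntegral.integral_zero_ae (Eventually.of_forall fun s hs => ?_)
  refine truncDeriv_of_abs_le (le_trans ?_ h)
  have := Set.abs_sub_left_of_mem_uIcc (Set.uIoc_subset_uIcc hs)
  simpa using this

theorem tendsto_primitive_truncDeriv (t : ℝ) :
    Tendsto (fun k => primitive (truncDeriv k) t) atTop (𝓝 t) := by
  have h : Tendsto (fun k => primitive (truncDeriv k) t) atTop (𝓝 (∫ _ in (0 : ℝ)..t, (1 : ℝ))) := by
    refine intervalIntegral.tendsto_integral_filter_of_dominated_convergence (fun _ => 1)
      (Eventually.of_forall fun k => (continuous_truncDeriv k).aestronglyMeasurable)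
      (Eventually.of_forall fun k => Eventually.of_forall fun s _ => abs_truncDeriv_le k s)
      intervalIntegrable_const ?_
    filter_upwards [compl_mem_ae_iff.2 (measure_singleton (0 : ℝ))] with s hs _
    exact tendsto_truncDeriv hs
  simpa using h

/-- A Sobolev function that vanishes continuously at the boundary may be extended by zero. -/
theorem HasWeakGradient.indicator_of_frontier {Ω : Set (E n)} (hΩ : IsOpen Ω)
    (hΩb : Bornology.IsBounded Ω) {w : E n → ℝ} {G : E n → E n} (h : HasWeakGradient Ω w G)
    (hwc : ContinuousOn w (closure Ω)) (hw0 : ∀ x ∈ frontier Ω, w x = 0) (hG : IntegrableOn G Ω) :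
    HasWeakGradient Set.univ (Ω.indicator w) ((Ω ∩ {x | w x ≠ 0}).indicator G) := by
  have hK : IsCompact (closure Ω) := hΩb.isCompact_closure
  have hwi : Integrable (Ω.indicator w) :=
    ((hwc.integrableOn_compact hK).mono_set subset_closure).integrable_indicator hΩ.measurableSet
  have hopen : IsOpen (Ω ∩ {x | w x ≠ 0}) :=
    (hwc.mono subset_closure).isOpen_inter_preimage hΩ isOpen_ne
  have hGi : Integrable ((Ω ∩ {x | w x ≠ 0}).indicator G) :=
    (hG.mono_set Set.inter_subset_left).integrable_indicator hopen.measurableSet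
  have hGΩ : Integrable (Ω.indicator G) := hG.integrable_indicator hΩ.measurableSet
  refine hasWeakGradient_of_integral_eq (hwi.locallyIntegrable.locallyIntegrableOn _)
    (hGi.locallyIntegrable.locallyIntegrableOn _) fun η hη hc hs i => ?_
  -- The truncated function vanishes where `|w| ≤ 1/(k+1)`, hence off a compact subset of `Ω`,
  -- because `w = 0` on the frontier. In the limit the gradient is cut off on `{w = 0}`, so it need
  -- not be shown that `G` vanishes there almost everywhere.
  have key : ∀ k : ℕ, HasWeakGradient Set.univ
      (Ω.indicator fun x => primitive (truncDeriv k) (w x))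
      (Ω.indicator fun x => truncDeriv k (w x) • G x) := by
    intro k
    have h1 := h.comp_contDiff hΩ (hwc.mono subset_closure)
      (contDiff_primitive (continuous_truncDeriv k)) (C := 1) (fun t => by
        rw [deriv_primitive (continuous_truncDeriv k)]; exact abs_truncDeriv_le k t)
    simp only [deriv_primitive (continuous_truncDeriv k)] at h1
    set Kk : Set (E n) := closure Ω ∩ {x | 1 / ((k : ℝ) + 1) ≤ |w x|} with hKk
    have hKkc : IsCompact Kk := by
      refine hK.of_isClosed_subset ?_ Set.inter_subset_left
      exact hwc.abs.preimage_isClosed_of_isClosed isClosed_closure isClosed_Ici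
    refine h1.indicator_of_isCompact hΩ hKkc (fun x hx => ?_) (fun x hx hxK => ?_)
      (fun x hx hxK => ?_)
    · by_contra hxΩ
      have h2 := hw0 x (by rw [hΩ.frontier_eq]; exact ⟨hx.1, hxΩ⟩)
      have h3 : 1 / ((k : ℝ) + 1) ≤ |w x| := hx.2
      rw [h2, abs_zero] at h3
      have : 0 < 1 / ((k : ℝ) + 1) := by positivity
      linarith
    · exact primitive_truncDeriv_of_abs_le (le_of_lt (not_le.1 fun h2 =>
        hxK ⟨subset_closure hx, h2⟩))
    · rw [truncDeriv_of_abs_le (le_of_lt (not_le.1 fun h2 => hxK ⟨subset_closure hx, h2⟩)),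
        zero_smul]
  have hdη := hη.continuous_partialDeriv (by simp) i
  obtain ⟨C, -, hC⟩ := hc.exists_abs_le hη.continuous
  obtain ⟨D, -, hD⟩ := (hc.partialDeriv i).exists_abs_le hdη
  have hleft : Tendsto (fun k : ℕ => ∫ x, Ω.indicator (fun x => primitive (truncDeriv k) (w x)) x *
      partialDeriv i η x) atTop (𝓝 (∫ x, Ω.indicator w x * partialDeriv i η x)) := by
    refine tendsto_integral_of_dominated_convergence (fun x => |Ω.indicator w x| * D)
      (fun k => ?_) (hwi.abs.mul_const D) (fun k => Eventually.of_forall fun x => ?_)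
      (Eventually.of_forall fun x => ?_)
    · refine AEStronglyMeasurable.mul ?_ hdη.aestronglyMeasurable
      exact ((locallyIntegrableOn_univ.1 (key k).1)).aestronglyMeasurable
    · rw [norm_mul, Real.norm_eq_abs, Real.norm_eq_abs]
      refine mul_le_mul ?_ (hD x) (abs_nonneg _) (abs_nonneg _)
      by_cases hx : x ∈ Ω
      · simpa [hx] using abs_primitive_le (abs_truncDeriv_le k) (w x)
      · simp [hx]
    · refine Tendsto.mul_const _ ?_
      by_cases hx : x ∈ Ω
      · simpa [hx] using tendsto_primitive_truncDeriv (w x)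
      · simp [hx]
  have hright : Tendsto (fun k : ℕ => ∫ x, Ω.indicator (fun x => truncDeriv k (w x) • G x) x i *
      η x) atTop (𝓝 (∫ x, (Ω ∩ {x | w x ≠ 0}).indicator G x i * η x)) := by
    refine tendsto_integral_of_dominated_convergence (fun x => ‖Ω.indicator G x‖ * C)
      (fun k => ?_) (hGΩ.norm.mul_const C) (fun k => Eventually.of_forall fun x => ?_)
      (Eventually.of_forall fun x => ?_)
    · refine AEStronglyMeasurable.mul ?_ hη.continuous.aestronglyMeasurable
      exact (locallyIntegrableOn_univ.1 ((key k).2.1.apply i)).aestronglyMeasurable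
    · rw [norm_mul, Real.norm_eq_abs (η x)]
      refine mul_le_mul ?_ (hC x) (abs_nonneg _) (norm_nonneg _)
      refine (PiLp.norm_apply_le _ i).trans ?_
      by_cases hx : x ∈ Ω
      · simp only [hx, Set.indicator_of_mem, norm_smul]
        exact mul_le_of_le_one_left (norm_nonneg _) (abs_truncDeriv_le k (w x))
      · simp [hx]
    · refine Tendsto.mul_const _ ?_
      by_cases hx : x ∈ Ω
      · by_cases hwx : w x = 0
        · have : ∀ k : ℕ, truncDeriv k 0 = 0 := fun k =>
            truncDeriv_of_abs_le (by simp; positivity)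
          simp [hx, hwx, this]
        · simpa [hx, hwx] using (tendsto_truncDeriv hwx).mul_const (G x i)
      · simp [hx]
  exact tendsto_nhds_unique hleft (hright.neg.congr fun k =>
    ((key k).integral_eq hη hc hs i).symm)

/-! ### Morrey's inequality by varying the averaging scale -/

theorem setIntegral_norm_le_rpow {G : E n → E n} {p : ℝ} (hp : 1 ≤ p)
    (hG : MemLp G (ENNReal.ofReal p) volume) {B : Set (E n)} (hB : volume B ≠ ⊤) :
    ∫ x in B, ‖G x‖ ≤ (eLpNorm G (ENNReal.ofReal p) volume).toReal *
      (volume B).toReal ^ (1 - 1 / p) := by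
  have h1 : ENNReal.ofReal 1 ≤ ENNReal.ofReal p := ENNReal.ofReal_le_ofReal hp
  rw [ENNReal.ofReal_one] at h1
  have h2 := eLpNorm_le_eLpNorm_mul_rpow_measure_univ h1 (hG.1.restrict (s := B))
  rw [ENNReal.toReal_one, ENNReal.toReal_ofReal (by linarith), Measure.restrict_apply_univ,
    div_one] at h2
  rw [integral_norm_eq_lintegral_enorm hG.1.restrict, ← eLpNorm_one_eq_lintegral_enorm]
  have hexp : 0 ≤ 1 - 1 / p := by
    rw [sub_nonneg, div_le_one (by linarith)]; exact hp
  have h3 : eLpNorm G 1 (volume.restrict B) ≤ eLpNorm G (ENNReal.ofReal p) volume *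
      volume B ^ (1 - 1 / p) :=
    h2.trans (mul_le_mul_left (eLpNorm_mono_measure _ Measure.restrict_le_self) _)
  refine (ENNReal.toReal_mono (ENNReal.mul_ne_top hG.2.ne
    (ENNReal.rpow_ne_top_of_nonneg hexp hB)) h3).trans_eq ?_
  rw [ENNReal.toReal_mul, ENNReal.toReal_rpow]

/-- The average of `w` with respect to the kernel `σ` centred at `x` and scaled to size `1 / c`. -/
def scaledAverage (σ w : E n → ℝ) (x : E n) (c : ℝ) : ℝ :=
  ∫ z, w z * (c ^ n * σ (c • (z - x)))

theorem scaledAverage_eq (σ w : E n → ℝ) (x : E n) {c : ℝ} (hc : 0 < c) :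
    scaledAverage σ w x c = ∫ y, w (x + c⁻¹ • y) * σ y := by
  have h1 := Measure.integral_comp_smul (volume : Measure (E n))
    (fun y => w (x + c⁻¹ • y) * σ y) c
  have h2 : scaledAverage σ w x c = ∫ z, w (x + z) * (c ^ n * σ (c • z)) := by
    rw [scaledAverage, ← integral_add_left_eq_self _ x]
    simp
  rw [h2]
  simp only [smul_smul, inv_mul_cancel₀ hc.ne', one_smul, finrank_euclideanSpace_fin,
    smul_eq_mul] at h1
  rw [abs_of_pos (by positivity)] at h1
  have h3 : ∀ z, w (x + z) * (c ^ n * σ (c • z)) = c ^ n * (w (x + z) * σ (c • z)) := fun z => by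
    ring
  simp_rw [h3]
  rw [integral_const_mul, h1, ← mul_assoc, mul_inv_cancel₀ (by positivity), one_mul]

theorem tendsto_scaledAverage {σ w : E n → ℝ} (hσ : Continuous σ) (hσc : HasCompactSupport σ)
    (hσ1 : ∫ y, σ y = 1) (hw : Continuous w) {B : ℝ} (hB : ∀ x, |w x| ≤ B) (x : E n) :
    Tendsto (scaledAverage σ w x) atTop (𝓝 (w x)) := by
  have h1 : Tendsto (fun c : ℝ => ∫ y, w (x + c⁻¹ • y) * σ y) atTop (𝓝 (∫ y, w x * σ y)) := by
    refine tendsto_integral_filter_of_dominated_convergence (fun y => B * |σ y|)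
      (Eventually.of_forall fun c => ?_) (Eventually.of_forall fun c => Eventually.of_forall
        fun y => ?_) ?_ (Eventually.of_forall fun y => ?_)
    · exact Continuous.aestronglyMeasurable (by fun_prop)
    · rw [norm_mul, Real.norm_eq_abs, Real.norm_eq_abs]
      exact mul_le_mul_of_nonneg_right (hB _) (abs_nonneg _)
    · exact (hσ.integrable_of_hasCompactSupport hσc).abs.const_mul B
    · refine Tendsto.mul_const _ ?_
      have h2 : Tendsto (fun c : ℝ => x + c⁻¹ • y) atTop (𝓝 (x + (0 : ℝ) • y)) :=
        tendsto_const_nhds.add (tendsto_inv_atTop_zero.smul_const y)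
      rw [zero_smul, add_zero] at h2
      exact (hw.tendsto x).comp h2
  rw [integral_const_mul, hσ1, mul_one] at h1
  refine h1.congr' ?_
  filter_upwards [eventually_gt_atTop 0] with c hc
  exact (scaledAverage_eq σ w x hc).symm

theorem hasFDerivAt_comp_smul_sub {σ : E n → ℝ} (hσ : Differentiable ℝ σ) (x z : E n) (c : ℝ) :
    HasFDerivAt (fun z => σ (c • (z - x))) (c • fderiv ℝ σ (c • (z - x))) z := by
  have h1 : HasFDerivAt (fun z : E n => c • (z - x)) (c • ContinuousLinearMap.id ℝ (E n)) z :=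
    ((hasFDerivAt_id z).sub_const x).const_smul c
  have h2 : HasFDerivAt (fun z => σ (c • (z - x))) _ z := (hσ (c • (z - x))).hasFDerivAt.comp z h1
  exact h2.congr_fderiv (by ext v; simp)

/-- The divergence of the radial field `σ(c (z - x)) (z - x)`. -/
theorem sum_partialDeriv_radial {σ : E n → ℝ} (hσ : Differentiable ℝ σ) (x z : E n) (c a : ℝ) :
    ∑ i, partialDeriv i (fun z => a * σ (c • (z - x)) * (z i - x i)) z =
      a * (n * σ (c • (z - x)) + c * fderiv ℝ σ (c • (z - x)) (z - x)) := by
  have h1 : ∀ i : Fin n, partialDeriv i (fun z => a * σ (c • (z - x)) * (z i - x i)) z =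
      a * σ (c • (z - x)) + a * c * ((z - x) i * partialDeriv i σ (c • (z - x))) := by
    intro i
    have h3 : HasFDerivAt (fun y : E n => y i - x i) (EuclideanSpace.proj i : E n →L[ℝ] ℝ) z :=
      (EuclideanSpace.proj i : E n →L[ℝ] ℝ).hasFDerivAt.sub_const _
    rw [(((hasFDerivAt_comp_smul_sub hσ x z c).const_mul a).fun_mul h3).partialDeriv_eq]
    simp [partialDeriv]
    ring
  simp_rw [h1]
  rw [Finset.sum_add_distrib, ← Finset.mul_sum _ _ (a * c), ← fderiv_apply_eq_sum]
  simp
  ring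

/-- The derivative in the scale is the divergence in `z` of `c^(n-1) σ(c(z - x))(z - x)`
(`sum_partialDeriv_radial`), so the change of the average with `c` can be integrated by parts onto
the gradient. -/
theorem hasDerivAt_scaled_kernel {σ : E n → ℝ} (hσ : Differentiable ℝ σ) (hn : 0 < n) (x z : E n)
    (c : ℝ) : HasDerivAt (fun c : ℝ => c ^ n * σ (c • (z - x)))
      (c ^ (n - 1) * (n * σ (c • (z - x)) + c * fderiv ℝ σ (c • (z - x)) (z - x))) c := by
  have h1 : HasDerivAt (fun c : ℝ => c • (z - x)) ((1 : ℝ) • (z - x)) c :=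
    (hasDerivAt_id c).smul_const (z - x)
  have h2 : HasDerivAt (fun c : ℝ => σ (c • (z - x))) _ c :=
    (hσ (c • (z - x))).hasFDerivAt.comp_hasDerivAt c h1
  refine ((hasDerivAt_pow n c).fun_mul h2).congr_deriv ?_
  rw [one_smul, ← pow_sub_one_mul hn.ne' c]
  ring

theorem hasDerivAt_scaledAverage (hn : 0 < n) {σ w : E n → ℝ} (hσ : ContDiff ℝ ∞ σ)
    (hσs : tsupport σ ⊆ Metric.closedBall 0 2) (hw : Continuous w) {B : ℝ}
    (hB : ∀ x, |w x| ≤ B) (x : E n) {c₀ : ℝ} (hc₀ : 0 < c₀) :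
    HasDerivAt (scaledAverage σ w x)
      (∫ z, w z * (c₀ ^ (n - 1) * (n * σ (c₀ • (z - x)) +
        c₀ * fderiv ℝ σ (c₀ • (z - x)) (z - x)))) c₀ := by
  have hd : Differentiable ℝ σ := hσ.differentiable (by simp)
  have hσ' : Continuous (fderiv ℝ σ) := hσ.continuous_fderiv (by simp)
  have hσc := hσ.continuous
  have hB0 : 0 ≤ B := (abs_nonneg _).trans (hB 0)
  set F' : ℝ × E n → ℝ := fun q => q.1 ^ (n - 1) * (n * σ (q.1 • (q.2 - x)) +
    q.1 * fderiv ℝ σ (q.1 • (q.2 - x)) (q.2 - x)) with hF'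
  have hF'c : Continuous F' := by
    refine Continuous.mul (by fun_prop) (Continuous.add (by fun_prop) (Continuous.mul (by fun_prop)
      (Continuous.clm_apply (hσ'.comp (by fun_prop)) (by fun_prop))))
  obtain ⟨K, hK⟩ := (isCompact_Icc.prod (isCompact_closedBall x (4 / c₀))).exists_bound_of_continuousOn
    (hF'c.continuousOn (s := Set.Icc (c₀ / 2) (2 * c₀) ×ˢ Metric.closedBall x (4 / c₀)))
  -- The kernel at scale `c` lives in the ball of radius `2/c < 4/c₀`, giving one dominating
  -- function for all nearby scales.
  have hzero : ∀ c, c₀ / 2 < c → ∀ z ∉ Metric.closedBall x (4 / c₀),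
      c • (z - x) ∉ tsupport σ := by
    intro c hc z hz hmem
    have h1 := hσs hmem
    rw [mem_closedBall_zero_iff, norm_smul, Real.norm_eq_abs, abs_of_pos (by linarith)] at h1
    rw [mem_closedBall_iff_norm, not_le, div_lt_iff₀ hc₀] at hz
    nlinarith [norm_nonneg (z - x)]
  refine (hasDerivAt_integral_of_dominated_loc_of_deriv_le (μ := volume)
    (F := fun c z => w z * (c ^ n * σ (c • (z - x)))) (F' := fun c z => w z * F' (c, z))
    (s := Set.Ioo (c₀ / 2) (2 * c₀)) (bound := (Metric.closedBall x (4 / c₀)).indicator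
      fun _ => B * K) (Ioo_mem_nhds (by linarith) (by linarith)) (Eventually.of_forall fun c => ?_)
      ?_ ?_ (Eventually.of_forall fun z c hc => ?_) ?_ (Eventually.of_forall fun z c _ => ?_)).2
  · exact Continuous.aestronglyMeasurable (by fun_prop)
  · refine Continuous.integrable_of_hasCompactSupport (by fun_prop) ?_
    refine HasCompactSupport.intro (isCompact_closedBall x (4 / c₀)) fun z hz => ?_
    rw [image_eq_zero_of_notMem_tsupport (hzero c₀ (by linarith) z hz)]
    simp
  · exact (hw.mul (hF'c.comp (by fun_prop))).aestronglyMeasurable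
  · by_cases hz : z ∈ Metric.closedBall x (4 / c₀)
    · rw [Set.indicator_of_mem hz, norm_mul]
      exact mul_le_mul (hB z) (hK (c, z) ⟨⟨hc.1.le, hc.2.le⟩, hz⟩) (norm_nonneg _) hB0
    · have h1 := hzero c hc.1 z hz
      have h2 : fderiv ℝ σ (c • (z - x)) = 0 := by
        by_contra hne
        exact h1 (support_fderiv_subset ℝ hne)
      rw [Set.indicator_of_notMem hz]
      simp [hF', image_eq_zero_of_notMem_tsupport h1, h2]
  · exact (integrableOn_const (isCompact_closedBall x (4 / c₀)).measure_lt_top.ne).integrable_indicator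
      Metric.isClosed_closedBall.measurableSet
  · exact (hasDerivAt_scaled_kernel hd hn x z c).const_mul (w z)

/-- The derivative bound makes `M c + (A/β) c^(-β)` nonincreasing, so it stays above its limit `l`
at infinity. -/
theorem sub_le_of_deriv_le_rpow {M M' : ℝ → ℝ} {A β : ℝ} (hβ : 0 < β)
    (hM : ∀ c, 0 < c → HasDerivAt M (M' c) c) (hM' : ∀ c, 0 < c → |M' c| ≤ A * c ^ (-β - 1)) {l : ℝ}
    (hl : Tendsto M atTop (𝓝 l)) {c : ℝ} (hc : 0 < c) : l - M c ≤ A / β * c ^ (-β) := by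
  have hd : ∀ c, 0 < c → HasDerivAt (fun c => M c + A / β * c ^ (-β))
      (M' c - A * c ^ (-β - 1)) c := by
    intro c hc
    refine ((hM c hc).add ((Real.hasDerivAt_rpow_const (p := -β) (Or.inl hc.ne')).const_mul
      (A / β))).congr_deriv ?_
    field_simp
    ring
  have hanti : AntitoneOn (fun c => M c + A / β * c ^ (-β)) (Set.Ioi 0) := by
    refine antitoneOn_of_deriv_nonpos (convex_Ioi 0)
      (fun c hc => (hd c hc).continuousAt.continuousWithinAt)
      (fun c hc => ?_) (fun c hc => ?_)
    · rw [interior_Ioi] at hc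
      exact (hd c hc).differentiableAt.differentiableWithinAt
    · rw [interior_Ioi] at hc
      rw [(hd c hc).deriv]
      linarith [le_abs_self (M' c), hM' c hc]
  have hlim : Tendsto (fun c => M c + A / β * c ^ (-β)) atTop (𝓝 (l + A / β * 0)) :=
    hl.add ((tendsto_rpow_neg_atTop hβ).const_mul _)
  have := le_of_tendsto hlim (by
    filter_upwards [eventually_ge_atTop c] with c' hc'
    exact hanti hc (lt_of_lt_of_le hc hc' : (0 : ℝ) < c') hc')
  simp only at this
  linarith

/-- After integration by parts the radial field has size at most `2R c^(n-2)` on a ball of radius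
`2/c`. Hölder contributes `c^(-n(1-1/p))`, and the exponents add up to `n/p - 2`, integrable at
infinity because `p > n`. -/
theorem abs_integral_radial_le (hn : 0 < n) {p : ℝ} (hp : (n : ℝ) < p) {σ w : E n → ℝ}
    {G : E n → E n} (hσ : ContDiff ℝ ∞ σ) (hσs : tsupport σ ⊆ Metric.closedBall 0 2) {R : ℝ}
    (hR : ∀ x, |σ x| ≤ R) (hwG : HasWeakGradient Set.univ w G)
    (hG : MemLp G (ENNReal.ofReal p) volume) (x : E n) {c : ℝ} (hc : 0 < c) :
    |∫ z, w z * (c ^ (n - 1) * (n * σ (c • (z - x)) + c * fderiv ℝ σ (c • (z - x)) (z - x)))| ≤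
      2 * R * (2 ^ n * (volume (Metric.ball (0 : E n) 1)).toReal) ^ (1 - 1 / p) *
        (eLpNorm G (ENNReal.ofReal p) volume).toReal * c ^ (-(1 - n / p) - 1) := by
  have hp1 : 1 ≤ p := le_trans (by exact_mod_cast hn) hp.le
  have hp0 : 0 < p := by linarith
  have hd : Differentiable ℝ σ := hσ.differentiable (by simp)
  have hσc := hσ.continuous
  have hR0 : 0 ≤ R := (abs_nonneg _).trans (hR 0)
  set V : Fin n → E n → ℝ := fun i z => c ^ (n - 1) * σ (c • (z - x)) * (z i - x i) with hV
  have hnot : ∀ z ∉ Metric.closedBall x (2 / c), c • (z - x) ∉ tsupport σ := by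
    intro z hz hmem
    have h1 := hσs hmem
    rw [mem_closedBall_zero_iff, norm_smul, Real.norm_eq_abs, abs_of_pos hc] at h1
    rw [mem_closedBall_iff_norm, not_le, div_lt_iff₀ hc] at hz
    nlinarith
  have hVc : ∀ i, HasCompactSupport (V i) := fun i =>
    HasCompactSupport.intro (isCompact_closedBall x (2 / c)) fun z hz => by
      simp [hV, image_eq_zero_of_notMem_tsupport (hnot z hz)]
  have hVs : ∀ i, ContDiff ℝ ∞ (V i) := by
    intro i
    have h1 : ContDiff ℝ ∞ fun z : E n => z i := (EuclideanSpace.proj i : E n →L[ℝ] ℝ).contDiff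
    exact (contDiff_const.mul (hσ.comp ((contDiff_id.sub contDiff_const).const_smul c))).mul
      (h1.sub contDiff_const)
  have hwl := hwG.1
  have h1 : ∫ z, w z * (c ^ (n - 1) * (n * σ (c • (z - x)) +
      c * fderiv ℝ σ (c • (z - x)) (z - x))) = -∫ z, ∑ i, G z i * V i z := by
    simp_rw [← sum_partialDeriv_radial hd x _ c (c ^ (n - 1)), Finset.mul_sum]
    rw [integral_finsetSum, integral_finsetSum, ← Finset.sum_neg_distrib]
    · exact Finset.sum_congr rfl fun i _ =>
        hwG.integral_eq (hVs i) (hVc i) (Set.subset_univ _) i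
    · exact fun i _ => (hwG.2.1.apply i).integrable_mul (hVs i).continuous (hVc i)
        (Set.subset_univ _)
    · exact fun i _ => hwl.integrable_mul ((hVs i).continuous_partialDeriv (by simp) i)
        ((hVc i).partialDeriv i) (Set.subset_univ _)
  have hGl : LocallyIntegrable G := locallyIntegrableOn_univ.1 hwG.2.1
  have hGB : IntegrableOn (fun z => ‖G z‖) (Metric.closedBall x (2 / c)) :=
    (hGl.integrableOn_isCompact (isCompact_closedBall x (2 / c))).norm
  have h2 : ∀ z, |∑ i, G z i * V i z| ≤ (Metric.closedBall x (2 / c)).indicator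
      (fun z => ‖G z‖ * (c ^ (n - 1) * R * (2 / c))) z := by
    intro z
    have h3 : ∑ i, G z i * V i z = c ^ (n - 1) * σ (c • (z - x)) * inner ℝ (G z) (z - x) := by
      rw [PiLp.inner_apply, Finset.mul_sum]
      refine Finset.sum_congr rfl fun i _ => ?_
      simp [hV]
      ring
    rw [h3]
    by_cases hz : z ∈ Metric.closedBall x (2 / c)
    · rw [Set.indicator_of_mem hz, abs_mul, abs_mul, abs_of_pos (by positivity : 0 < c ^ (n - 1))]
      rw [mem_closedBall_iff_norm] at hz
      have h4 := abs_real_inner_le_norm (G z) (z - x)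
      have h5 : |inner ℝ (G z) (z - x)| ≤ ‖G z‖ * (2 / c) :=
        h4.trans (mul_le_mul_of_nonneg_left hz (norm_nonneg _))
      calc c ^ (n - 1) * |σ (c • (z - x))| * |inner ℝ (G z) (z - x)|
          ≤ c ^ (n - 1) * R * (‖G z‖ * (2 / c)) :=
            mul_le_mul (mul_le_mul_of_nonneg_left (hR _) (by positivity)) h5 (abs_nonneg _)
              (by positivity)
        _ = _ := by ring
    · rw [Set.indicator_of_notMem hz, image_eq_zero_of_notMem_tsupport (hnot z hz)]
      simp
  rw [h1, abs_neg, ← Real.norm_eq_abs]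
  refine (norm_integral_le_of_norm_le ((integrable_indicator_iff
    Metric.isClosed_closedBall.measurableSet).2 (hGB.mul_const _)) (Eventually.of_forall h2)).trans ?_
  rw [integral_indicator Metric.isClosed_closedBall.measurableSet, integral_mul_const]
  have hvol : (volume (Metric.closedBall x (2 / c))).toReal =
      (2 ^ n * (volume (Metric.ball (0 : E n) 1)).toReal) * (c ^ n)⁻¹ := by
    rw [Measure.addHaar_closedBall _ _ (by positivity), ENNReal.toReal_mul,
      ENNReal.toReal_ofReal (by positivity), finrank_euclideanSpace_fin, div_pow]
    field_simp
  have h6 := setIntegral_norm_le_rpow hp1 hG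
    (isCompact_closedBall x (2 / c)).measure_lt_top.ne
  rw [hvol, Real.mul_rpow (by positivity) (by positivity)] at h6
  refine (mul_le_mul_of_nonneg_right h6 (by positivity)).trans_eq ?_
  have h7 : ((c ^ n)⁻¹) ^ (1 - 1 / p) * c ^ (n - 1) * c⁻¹ = c ^ (-(1 - n / p) - 1) := by
    rw [← Real.rpow_natCast c n, ← Real.rpow_natCast c (n - 1), ← Real.rpow_neg hc.le,
      ← Real.rpow_mul hc.le, ← Real.rpow_neg_one c, ← Real.rpow_add hc, ← Real.rpow_add hc,
      Nat.cast_sub hn]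
    congr 1
    field_simp
    push_cast
    ring
  rw [← h7]
  ring

/-- The Morrey inequality, with a constant depending only on `n` and `p`. -/
theorem exists_morrey_const (hn : 0 < n) {p : ℝ} (hp : (n : ℝ) < p) :
    ∃ C : ℝ, 0 ≤ C ∧ ∀ (w : E n → ℝ) (G : E n → E n), Continuous w → (∃ B, ∀ x, |w x| ≤ B) →
      HasWeakGradient Set.univ w G → MemLp G (ENNReal.ofReal p) volume →
      ∀ x y, |w x - w y| ≤ C * (eLpNorm G (ENNReal.ofReal p) volume).toReal *
        ‖x - y‖ ^ (1 - n / p) := by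
  have hp0 : 0 < p := lt_of_le_of_lt (Nat.cast_nonneg n) hp
  set β : ℝ := 1 - n / p with hβdef
  have hβ : 0 < β := by rw [hβdef, sub_pos, div_lt_one hp0]; exact hp
  set ρ : E n → ℝ := (bumpSeq (n := n) 1 one_pos 0).normed volume with hρ
  have hρs : ContDiff ℝ ∞ ρ := ContDiffBump.contDiff_normed _
  have hρ1 : ∫ y, ρ y = 1 := ContDiffBump.integral_normed _
  have hρt : tsupport ρ ⊆ Metric.closedBall 0 1 := by
    rw [hρ, ContDiffBump.tsupport_normed_eq]
    exact Metric.closedBall_subset_closedBall (bumpSeq_rOut_le _ _)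
  have hρc : HasCompactSupport ρ := ContDiffBump.hasCompactSupport_normed _
  obtain ⟨R, hR0, hR⟩ := hρc.exists_abs_le hρs.continuous
  set A : ℝ := 2 * R * (2 ^ n * (volume (Metric.ball (0 : E n) 1)).toReal) ^ (1 - 1 / p) with hA
  have hA0 : 0 ≤ A := by positivity
  refine ⟨2 * (A / β), by positivity, fun w G hw ⟨B, hB⟩ hwG hG x y => ?_⟩
  set N := (eLpNorm G (ENNReal.ofReal p) volume).toReal with hN
  by_cases hxy : x = y
  · simp [hxy, Real.zero_rpow hβ.ne']
  have hr : 0 < ‖x - y‖ := norm_pos_iff.2 (sub_ne_zero.2 hxy)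
  -- kernels shifted by a vector of norm at most one
  have hshift : ∀ v : E n, ‖v‖ ≤ 1 → ∀ (w : E n → ℝ) (G : E n → E n), Continuous w →
      (∀ x, |w x| ≤ B) → HasWeakGradient Set.univ w G → MemLp G (ENNReal.ofReal p) volume →
      ∀ x c, 0 < c → w x - scaledAverage (fun y => ρ (y - v)) w x c ≤
        A * (eLpNorm G (ENNReal.ofReal p) volume).toReal / β * c ^ (-β) := by
    intro v hv w G hw hB hwG hG x c hc
    have hs : ContDiff ℝ ∞ fun y => ρ (y - v) := hρs.comp (contDiff_id.sub contDiff_const)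
    have ht : tsupport (fun y => ρ (y - v)) ⊆ Metric.closedBall 0 2 := by
      refine closure_minimal (fun y hy => ?_) Metric.isClosed_closedBall
      have h1 := hρt (subset_tsupport ρ hy)
      rw [mem_closedBall_zero_iff] at h1 ⊢
      have := norm_le_norm_sub_add y v
      linarith
    have hcs : HasCompactSupport fun y => ρ (y - v) :=
      (isCompact_closedBall 0 2).of_isClosed_subset (isClosed_tsupport _) ht
    have h1 : ∫ y, ρ (y - v) = 1 := by rw [integral_sub_right_eq_self]; exact hρ1
    exact sub_le_of_deriv_le_rpow hβ
      (fun c hc => hasDerivAt_scaledAverage hn hs ht hw hB x hc)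
      (fun c hc => abs_integral_radial_le hn hp hs ht (fun y => hR (y - v)) hwG hG x hc)
      (tendsto_scaledAverage hs.continuous hcs h1 hw hB x) hc
  -- The one-sided bound is applied to `w` and to `-w`.
  have hboth : ∀ v : E n, ‖v‖ ≤ 1 → ∀ x, ∀ c, 0 < c →
      |w x - scaledAverage (fun y => ρ (y - v)) w x c| ≤ A * N / β * c ^ (-β) := by
    intro v hv x c hc
    have h1 := hshift v hv w G hw hB hwG hG x c hc
    have h2 := hshift v hv (fun x => -w x) (fun x => -G x) hw.neg (fun x => by
      rw [abs_neg]; exact hB x) hwG.neg hG.neg x c hc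
    have h3 : scaledAverage (fun y => ρ (y - v)) (fun x => -w x) x c =
        -scaledAverage (fun y => ρ (y - v)) w x c := by
      simp only [scaledAverage, neg_mul, integral_neg]
    have h4 : eLpNorm (fun x => -G x) (ENNReal.ofReal p) volume =
        eLpNorm G (ENNReal.ofReal p) volume := eLpNorm_neg (f := G) ..
    rw [h3, h4] at h2
    rw [abs_le]
    exact ⟨by linarith, h1⟩
  have hscaled : ∀ v x : E n, ∀ c, 0 < c → scaledAverage (fun y => ρ (y - v)) w x c =
      ∫ y, w (x + c⁻¹ • v + c⁻¹ • y) * ρ y := by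
    intro v x c hc
    rw [scaledAverage_eq _ _ _ hc, ← integral_add_right_eq_self _ v]
    refine integral_congr_ae (Eventually.of_forall fun y => ?_)
    simp only [add_sub_cancel_right]
    congr 2
    rw [smul_add]; abel
  set c := ‖x - y‖⁻¹ with hc
  have hc0 : 0 < c := inv_pos.2 hr
  -- At scale `1/c = |x - y|` the shift by `v` moves the centre from `x` to the midpoint, and `-v`
  -- does so from `y`; both points are compared with the same average.
  set v := (c / 2) • (y - x) with hv
  have hv1 : ‖v‖ ≤ 1 := by
    rw [hv, norm_smul, norm_sub_rev, Real.norm_eq_abs, abs_of_pos (by positivity), hc]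
    field_simp; norm_num
  have hmid : scaledAverage (fun z => ρ (z - v)) w x c =
      scaledAverage (fun z => ρ (z - (-v))) w y c := by
    rw [hscaled _ _ _ hc0, hscaled _ _ _ hc0]
    have h1 : x + c⁻¹ • v = y + c⁻¹ • -v := by
      have h2 : c⁻¹ • v = (1 / 2 : ℝ) • (y - x) := by
        rw [hv, smul_smul]; congr 1; field_simp
      rw [smul_neg, h2]
      module
    rw [h1]
  have h1 := abs_le.1 (hboth v hv1 x c hc0)
  have h2 := abs_le.1 (hboth (-v) (by rwa [norm_neg]) y c hc0)
  rw [hmid] at h1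
  have h3 : c ^ (-β) = ‖x - y‖ ^ β := by
    rw [hc, Real.inv_rpow hr.le, Real.rpow_neg hr.le, inv_inv]
  rw [h3] at h1 h2
  have h4 : 2 * (A / β) * N * ‖x - y‖ ^ β = 2 * (A * N / β * ‖x - y‖ ^ β) := by ring
  rw [h4, abs_le]
  exact ⟨by linarith [h1.1, h2.2], by linarith [h1.2, h2.1]⟩

/-! ### Estimates for zero boundary values -/

/-- The `L^p` norm over `Ω` as a real number. -/
def lpNormOn (Ω : Set (E n)) (p : ℝ) (G : E n → E n) : ℝ :=
  (eLpNorm G (ENNReal.ofReal p) (volume.restrict Ω)).toReal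

theorem lpNormOn_nonneg (Ω : Set (E n)) (p : ℝ) (G : E n → E n) : 0 ≤ lpNormOn Ω p G :=
  ENNReal.toReal_nonneg

theorem setIntegral_norm_rpow_eq {Ω : Set (E n)} {p : ℝ} (hp : 0 < p) {G : E n → E n}
    (hG : MemLp G (ENNReal.ofReal p) (volume.restrict Ω)) :
    ∫ x in Ω, ‖G x‖ ^ p = lpNormOn Ω p G ^ p := by
  have h0 : 0 ≤ ∫ x in Ω, ‖G x‖ ^ p := integral_nonneg fun x => by positivity
  rw [lpNormOn, hG.eLpNorm_eq_integral_rpow_norm (by simpa using hp) ENNReal.ofReal_ne_top,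
    ENNReal.toReal_ofReal hp.le, ENNReal.toReal_ofReal (by positivity), ← Real.rpow_mul h0,
    inv_mul_cancel₀ hp.ne', Real.rpow_one]

theorem MeasureTheory.MemLp.integrable_rpow_norm {Ω : Set (E n)} {p : ℝ} (hp : 0 < p)
    {G : E n → E n} (hG : MemLp G (ENNReal.ofReal p) (volume.restrict Ω)) :
    Integrable (fun x => ‖G x‖ ^ p) (volume.restrict Ω) := by
  have := hG.integrable_norm_rpow (by simpa using hp) ENNReal.ofReal_ne_top
  rwa [ENNReal.toReal_ofReal hp.le] at this

theorem isFiniteMeasure_restrict {Ω : Set (E n)} (hΩ : Bornology.IsBounded Ω) :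
    IsFiniteMeasure (volume.restrict Ω) :=
  ⟨by rw [Measure.restrict_apply_univ]; exact hΩ.measure_lt_top⟩

theorem lpNormOn_le_mul {Ω : Set (E n)} (hΩ : Bornology.IsBounded Ω) {q p : ℝ} (hq : 0 < q)
    (hqp : q ≤ p) {G : E n → E n} (hG : MemLp G (ENNReal.ofReal p) (volume.restrict Ω)) :
    lpNormOn Ω q G ≤ lpNormOn Ω p G * (volume Ω).toReal ^ (1 / q - 1 / p) := by
  have h2 := eLpNorm_le_eLpNorm_mul_rpow_measure_univ (ENNReal.ofReal_le_ofReal hqp) hG.1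
  rw [ENNReal.toReal_ofReal hq.le, ENNReal.toReal_ofReal (by linarith),
    Measure.restrict_apply_univ] at h2
  have hexp : 0 ≤ 1 / q - 1 / p := sub_nonneg.2 (one_div_le_one_div_of_le hq hqp)
  refine (ENNReal.toReal_mono (ENNReal.mul_ne_top hG.2.ne
    (ENNReal.rpow_ne_top_of_nonneg hexp hΩ.measure_lt_top.ne)) h2).trans_eq ?_
  rw [ENNReal.toReal_mul, ENNReal.toReal_rpow]
  rfl

theorem setIntegral_norm_le_lpNormOn {Ω : Set (E n)} (hΩ : Bornology.IsBounded Ω) {p : ℝ}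
    (hp : 1 ≤ p) {G : E n → E n} (hG : MemLp G (ENNReal.ofReal p) (volume.restrict Ω)) :
    ∫ x in Ω, ‖G x‖ ≤ lpNormOn Ω p G * (volume Ω).toReal ^ (1 - 1 / p) := by
  have h := lpNormOn_le_mul hΩ one_pos hp hG
  have h1 : ∫ x in Ω, ‖G x‖ = lpNormOn Ω 1 G := by
    rw [integral_norm_eq_lintegral_enorm hG.1, ← eLpNorm_one_eq_lintegral_enorm, lpNormOn,
      ENNReal.ofReal_one]
  rw [h1]
  simpa using h

/-- The Morrey estimate for Sobolev functions with zero boundary values. -/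
theorem exists_zero_boundary_holder_const (hn : 0 < n) {p : ℝ} (hp : (n : ℝ) < p) :
    ∃ C : ℝ, 0 ≤ C ∧ ∀ (Ω : Set (E n)), IsOpen Ω → Bornology.IsBounded Ω →
      ∀ (w : E n → ℝ) (G : E n → E n), HasBoundaryValues Ω 0 w → HasWeakGradient Ω w G →
      MemLp G (ENNReal.ofReal p) (volume.restrict Ω) →
      ∀ x ∈ closure Ω, ∀ y ∈ closure Ω, |w x - w y| ≤ C * lpNormOn Ω p G *
        ‖x - y‖ ^ (1 - n / p) := by
  obtain ⟨C, hC, hmor⟩ := exists_morrey_const hn hp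
  have hp1 : 1 ≤ p := le_trans (by exact_mod_cast hn) hp.le
  refine ⟨C, hC, fun Ω hΩ hΩb w G hw hwG hG x hx y hy => ?_⟩
  have := isFiniteMeasure_restrict hΩb
  have hGi : IntegrableOn G Ω := hG.integrable (by
    rw [← ENNReal.ofReal_one]; exact ENNReal.ofReal_le_ofReal hp1)
  have hw0 : ∀ x ∈ frontier Ω, w x = 0 := fun x hx => hw.2 hx
  have hind : ∀ x ∈ closure Ω, Ω.indicator w x = w x := by
    intro x hx
    by_cases hxΩ : x ∈ Ω
    · simp [hxΩ]
    · rw [Set.indicator_of_notMem hxΩ, hw0 x (by rw [hΩ.frontier_eq]; exact ⟨hx, hxΩ⟩)]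
  have hcont : Continuous (Ω.indicator w) := continuous_indicator hw0 hw.1
  have hbdd : ∃ B, ∀ x, |Ω.indicator w x| ≤ B := by
    obtain ⟨B, hB⟩ := hΩb.isCompact_closure.exists_bound_of_continuousOn hw.1
    refine ⟨|B|, fun x => ?_⟩
    by_cases hxΩ : x ∈ Ω
    · simpa [hxΩ] using (hB x (subset_closure hxΩ)).trans (le_abs_self B)
    · simp [hxΩ]
  have hext := hwG.indicator_of_frontier hΩ hΩb hw.1 hw0 hGi
  have hopen : IsOpen (Ω ∩ {x | w x ≠ 0}) :=
    (hw.1.mono subset_closure).isOpen_inter_preimage hΩ isOpen_ne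
  have hle : eLpNorm ((Ω ∩ {x | w x ≠ 0}).indicator G) (ENNReal.ofReal p) volume ≤
      eLpNorm G (ENNReal.ofReal p) (volume.restrict Ω) := by
    rw [eLpNorm_indicator_eq_eLpNorm_restrict hopen.measurableSet]
    exact eLpNorm_mono_measure _ (Measure.restrict_mono Set.inter_subset_left le_rfl)
  have hmem : MemLp ((Ω ∩ {x | w x ≠ 0}).indicator G) (ENNReal.ofReal p) volume := by
    rw [memLp_indicator_iff_restrict hopen.measurableSet]
    exact hG.mono_measure (Measure.restrict_mono Set.inter_subset_left le_rfl)
  have := hmor _ _ hcont hbdd hext hmem x y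
  rw [hind x hx, hind y hy] at this
  refine this.trans (mul_le_mul_of_nonneg_right (mul_le_mul_of_nonneg_left ?_ hC) (by positivity))
  exact ENNReal.toReal_mono hG.2.ne hle

theorem IsBoundedDomain.frontier_nonempty (hn : 0 < n) {Ω : Set (E n)} (hΩ : IsBoundedDomain Ω) :
    (frontier Ω).Nonempty := by
  rw [nonempty_frontier_iff]
  refine ⟨hΩ.isConnected.nonempty, fun h => ?_⟩
  have : Nonempty (Fin n) := ⟨⟨0, hn⟩⟩
  have : Nontrivial (E n) := inferInstance
  exact NormedSpace.unbounded_univ ℝ (E n) (h ▸ hΩ.isBounded)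

/-- The Hölder estimate is taken against a frontier point, where `w` vanishes; distances to it are
bounded on the closure. -/
theorem IsBoundedDomain.exists_zero_boundary_sup_const (hn : 0 < n) {Ω : Set (E n)}
    (hΩ : IsBoundedDomain Ω) {p : ℝ} (hp : (n : ℝ) < p) :
    ∃ C : ℝ, 0 ≤ C ∧ ∀ (w : E n → ℝ) (G : E n → E n), HasBoundaryValues Ω 0 w →
      HasWeakGradient Ω w G → MemLp G (ENNReal.ofReal p) (volume.restrict Ω) →
      ∀ x ∈ closure Ω, |w x| ≤ C * lpNormOn Ω p G := by
  have hp0 : 0 < p := lt_of_le_of_lt (Nat.cast_nonneg n) hp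
  obtain ⟨C, hC, h⟩ := exists_zero_boundary_holder_const hn hp
  obtain ⟨y, hy⟩ := hΩ.frontier_nonempty hn
  obtain ⟨D, hD⟩ : ∃ D, ∀ x ∈ closure Ω, ‖x - y‖ ≤ D :=
    hΩ.isCompact_closure.exists_bound_of_continuousOn (f := fun x => x - y) (by fun_prop)
  have hD0 : 0 ≤ D := (norm_nonneg _).trans (hD y hy.1)
  refine ⟨C * D ^ (1 - n / p), by positivity, fun w G hw hwG hG x hx => ?_⟩
  have h1 := h Ω hΩ.isOpen hΩ.isBounded w G hw hwG hG x hx y hy.1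
  have h2 : w y = 0 := hw.2 hy
  rw [h2, sub_zero] at h1
  refine h1.trans ?_
  have h3 : ‖x - y‖ ^ (1 - n / p) ≤ D ^ (1 - n / p) := Real.rpow_le_rpow (norm_nonneg _) (hD x hx)
    (by rw [sub_nonneg, div_le_one hp0]; exact hp.le)
  calc _ ≤ C * lpNormOn Ω p G * D ^ (1 - n / p) :=
        mul_le_mul_of_nonneg_left h3 (mul_nonneg hC (lpNormOn_nonneg _ _ _))
    _ = _ := by ring

/-! ### Clarkson's inequality and existence of minimizers -/

/-- The Clarkson inequality in an inner product space. -/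
theorem norm_half_add_rpow_add_norm_half_sub_rpow_le {F : Type*} [NormedAddCommGroup F]
    [InnerProductSpace ℝ F] {p : ℝ} (hp : 2 ≤ p) (a b : F) :
    ‖(1 / 2 : ℝ) • (a + b)‖ ^ p + ‖(1 / 2 : ℝ) • (a - b)‖ ^ p ≤ (‖a‖ ^ p + ‖b‖ ^ p) / 2 := by
  have hs : 1 ≤ p / 2 := by linarith
  have hpow : ∀ v : F, ‖v‖ ^ p = (‖v‖ ^ 2) ^ (p / 2) := fun v => by
    rw [← Real.rpow_natCast, ← Real.rpow_mul (norm_nonneg v)]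
    congr 1; push_cast; ring
  have hpar : ‖(1 / 2 : ℝ) • (a + b)‖ ^ 2 + ‖(1 / 2 : ℝ) • (a - b)‖ ^ 2 =
      (1 / 2 : ℝ) * ‖a‖ ^ 2 + (1 / 2 : ℝ) * ‖b‖ ^ 2 := by
    have := parallelogram_law_with_norm ℝ a b
    rw [norm_smul, norm_smul]
    norm_num
    nlinarith
  simp only [hpow]
  -- Superadditivity of `t^(p/2)`, the parallelogram law, and convexity of `t^(p/2)`; the outer two
  -- need `p ≥ 2`.
  calc _ ≤ (‖(1 / 2 : ℝ) • (a + b)‖ ^ 2 + ‖(1 / 2 : ℝ) • (a - b)‖ ^ 2) ^ (p / 2) :=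
        Real.add_rpow_le_rpow_add (by positivity) (by positivity) hs
    _ = ((1 / 2 : ℝ) • ‖a‖ ^ 2 + (1 / 2 : ℝ) • ‖b‖ ^ 2) ^ (p / 2) := by rw [hpar]; rfl
    _ ≤ (1 / 2 : ℝ) • (‖a‖ ^ 2) ^ (p / 2) + (1 / 2 : ℝ) • (‖b‖ ^ 2) ^ (p / 2) :=
        (convexOn_rpow hs).2 (Set.mem_Ici.2 (by positivity)) (Set.mem_Ici.2 (by positivity))
          (by norm_num) (by norm_num) (by norm_num)
    _ = _ := by simp only [smul_eq_mul]; ring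

/-- Clarkson's pointwise inequality, integrated: two gradients of nearly minimal energy must be
close in `L^p`, since their midpoint cannot have smaller energy. -/
theorem lpNormOn_half_sub_rpow_le {Ω : Set (E n)} {p : ℝ} (hp : 2 ≤ p) {G H : E n → E n}
    (hG : MemLp G (ENNReal.ofReal p) (volume.restrict Ω))
    (hH : MemLp H (ENNReal.ofReal p) (volume.restrict Ω)) :
    (∫ x in Ω, ‖(1 / 2 : ℝ) • (G x + H x)‖ ^ p) + (1 / 2 * lpNormOn Ω p (G - H)) ^ p ≤
      ((∫ x in Ω, ‖G x‖ ^ p) + ∫ x in Ω, ‖H x‖ ^ p) / 2 := by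
  have hp0 : 0 < p := by linarith
  have h1 := ((hG.add hH).const_smul (1 / 2 : ℝ))
  have h2 := ((hG.sub hH).const_smul (1 / 2 : ℝ))
  have h3 : 1 / 2 * lpNormOn Ω p (G - H) = lpNormOn Ω p ((1 / 2 : ℝ) • (G - H)) := by
    rw [lpNormOn, lpNormOn, eLpNorm_const_smul, ENNReal.toReal_mul]
    norm_num
  rw [h3, ← setIntegral_norm_rpow_eq hp0 h2]
  have i1 := h1.integrable_rpow_norm hp0
  have i2 := h2.integrable_rpow_norm hp0
  have i3 := hG.integrable_rpow_norm hp0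
  have i4 := hH.integrable_rpow_norm hp0
  rw [← integral_add i3 i4, ← integral_div]
  refine (integral_add i1 i2).symm.trans_le
    (integral_mono (i1.add i2) ((i3.add i4).div_const 2) fun x => ?_)
  exact norm_half_add_rpow_add_norm_half_sub_rpow_le hp (G x) (H x)

theorem HasBoundaryValues.memLp {Ω : Set (E n)} (hΩ : IsBoundedDomain Ω) {f u : E n → ℝ}
    (hu : HasBoundaryValues Ω f u) (q : ℝ≥0∞) : MemLp u q (volume.restrict Ω) := by
  have := isFiniteMeasure_restrict hΩ.isBounded
  obtain ⟨B, hB⟩ := hΩ.isCompact_closure.exists_bound_of_continuousOn hu.1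
  refine MemLp.of_bound ((hu.1.mono subset_closure).aestronglyMeasurable hΩ.isOpen.measurableSet)
    B ?_
  exact (ae_restrict_iff' hΩ.isOpen.measurableSet).2
    (Eventually.of_forall fun x hx => hB x (subset_closure hx))

theorem LipschitzWith.isSobolevWithGradient {Ω : Set (E n)} (hΩ : IsBoundedDomain Ω) {u : E n → ℝ}
    {L : ℝ≥0} (hu : LipschitzWith L u) (q : ℝ≥0∞) :
    IsSobolevWithGradient Ω q u (classicalGradient u) := by
  have := isFiniteMeasure_restrict hΩ.isBounded
  refine ⟨hu.hasWeakGradient.mono (Set.subset_univ _),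
    HasBoundaryValues.memLp (f := u) hΩ ⟨hu.continuous.continuousOn, fun _ _ => rfl⟩ q, ?_⟩
  exact MemLp.of_bound (measurable_classicalGradient u).aestronglyMeasurable L
    (Eventually.of_forall hu.norm_classicalGradient_le)

theorem HasBoundaryValues.sub {Ω : Set (E n)} {f u v : E n → ℝ} (hu : HasBoundaryValues Ω f u)
    (hv : HasBoundaryValues Ω f v) : HasBoundaryValues Ω 0 (fun x => u x - v x) :=
  ⟨hu.1.sub hv.1, fun x hx => by simp [hu.2 hx, hv.2 hx]⟩

theorem HasBoundaryValues.of_tendstoUniformlyOn {Ω : Set (E n)} {f u : E n → ℝ}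
    {v : ℕ → E n → ℝ} (hv : ∀ k, HasBoundaryValues Ω f (v k))
    (h : TendstoUniformlyOn v u atTop (closure Ω)) : HasBoundaryValues Ω f u := by
  refine ⟨h.continuousOn (Frequently.of_forall fun k => (hv k).1), fun x hx => ?_⟩
  refine tendsto_nhds_unique (h.tendsto_at hx.1) (tendsto_const_nhds.congr fun k => ?_)
  exact ((hv k).2 hx).symm

/-- Weak gradients pass to the limit. -/
theorem HasWeakGradient.of_tendsto {Ω : Set (E n)} (hΩ : IsOpen Ω) (hΩb : Bornology.IsBounded Ω)
    {p : ℝ} (hp : 1 ≤ p) {v : ℕ → E n → ℝ} {H : ℕ → E n → E n} {u : E n → ℝ} {G : E n → E n}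
    (hvH : ∀ k, HasWeakGradient Ω (v k) (H k)) (hu : ContinuousOn u Ω)
    (huv : TendstoUniformlyOn v u atTop Ω)
    (hH : ∀ k, MemLp (H k) (ENNReal.ofReal p) (volume.restrict Ω))
    (hG : MemLp G (ENNReal.ofReal p) (volume.restrict Ω))
    (hHG : Tendsto (fun k => lpNormOn Ω p (H k - G)) atTop (𝓝 0)) : HasWeakGradient Ω u G := by
  have := isFiniteMeasure_restrict hΩb
  have hul : LocallyIntegrableOn u Ω volume := hu.locallyIntegrableOn hΩ.measurableSet
  have hp' : 1 ≤ ENNReal.ofReal p := by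
    rw [← ENNReal.ofReal_one]; exact ENNReal.ofReal_le_ofReal hp
  have hGi : IntegrableOn G Ω := hG.integrable hp'
  refine hasWeakGradient_of_integral_eq hul hGi.locallyIntegrableOn fun η hη hc hs i => ?_
  have hd := hη.continuous_partialDeriv (by simp) i
  have hdc := hc.partialDeriv i
  have hds := (tsupport_partialDeriv_subset η i).trans hs
  have hleft : Tendsto (fun k => ∫ x, v k x * partialDeriv i η x) atTop
      (𝓝 (∫ x, u x * partialDeriv i η x)) := by
    refine tendsto_integral_filter_of_dominated_convergence
      (fun x => |u x * partialDeriv i η x| + |partialDeriv i η x|)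
      (Eventually.of_forall fun k => ((hvH k).1.integrable_mul hd hdc hds).aestronglyMeasurable)
      ?_ ((hul.integrable_mul hd hdc hds).abs.add (hd.integrable_of_hasCompactSupport hdc).abs)
      (Eventually.of_forall fun x => ?_)
    · filter_upwards [Metric.tendstoUniformlyOn_iff.1 huv 1 one_pos] with k hk
      refine Eventually.of_forall fun x => ?_
      by_cases hx : x ∈ Ω
      · have h1 := hk x hx
        rw [dist_comm, Real.dist_eq] at h1
        have h2 : |v k x| ≤ |u x| + 1 := by
          have := abs_sub_abs_le_abs_sub (v k x) (u x)
          linarith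
        rw [norm_mul, Real.norm_eq_abs, Real.norm_eq_abs, abs_mul]
        nlinarith [abs_nonneg (partialDeriv i η x)]
      · have : partialDeriv i η x = 0 := image_eq_zero_of_notMem_tsupport fun h => hx (hds h)
        simp [this]
    · by_cases hx : x ∈ Ω
      · exact (huv.tendsto_at hx).mul_const _
      · have : partialDeriv i η x = 0 := image_eq_zero_of_notMem_tsupport fun h => hx (hds h)
        simp [this]
  obtain ⟨D, hD0, hD⟩ := hc.exists_abs_le hη.continuous
  have hright : Tendsto (fun k => ∫ x, H k x i * η x) atTop (𝓝 (∫ x, G x i * η x)) := by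
    rw [tendsto_iff_dist_tendsto_zero]
    have hbound : Tendsto (fun k => lpNormOn Ω p (H k - G) *
        (volume Ω).toReal ^ (1 - 1 / p) * D) atTop (𝓝 0) := by
      simpa using (hHG.mul_const ((volume Ω).toReal ^ (1 - 1 / p))).mul_const D
    refine squeeze_zero (fun _ => dist_nonneg) (fun k => ?_) hbound
    rw [Real.dist_eq, ← integral_sub (((hvH k).2.1.apply i).integrable_mul hη.continuous hc hs)
      ((hGi.locallyIntegrableOn.apply i).integrable_mul hη.continuous hc hs)]
    have h1 : ∫ x, (H k x i * η x - G x i * η x) = ∫ x in Ω, (H k - G) x i * η x := by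
      rw [setIntegral_mul_eq_of_tsupport_subset ((subset_tsupport η).trans hs)]
      refine integral_congr_ae (Eventually.of_forall fun x => ?_)
      simp [sub_mul]
    rw [h1, ← Real.norm_eq_abs]
    have h2 := setIntegral_norm_le_lpNormOn hΩb hp ((hH k).sub hG)
    have h3 : Integrable (fun x => ‖(H k - G) x‖ * D) (volume.restrict Ω) :=
      (((hH k).sub hG).integrable hp').norm.mul_const D
    refine (norm_integral_le_of_norm_le h3 (Eventually.of_forall fun x => ?_)).trans ?_
    · rw [norm_mul]
      exact mul_le_mul (PiLp.norm_apply_le _ i) (hD x) (norm_nonneg _) (norm_nonneg _)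
    · rw [integral_mul_const]
      exact mul_le_mul_of_nonneg_right h2 hD0
  exact tendsto_nhds_unique hleft (hright.neg.congr fun k =>
    ((hvH k).integral_eq hη hc hs i).symm)

/-- Existence of continuous minimizers of the `p`-energy for Lipschitz boundary values. -/
theorem IsBoundedDomain.exists_isPEnergyMinimizer (hn : 0 < n) {Ω : Set (E n)}
    (hΩ : IsBoundedDomain Ω) {p : ℝ} (hp : (n : ℝ) < p) (hp2 : 2 ≤ p) {f F : E n → ℝ} {L : ℝ≥0}
    (hF : LipschitzWith L F) (hFf : HasBoundaryValues Ω f F) :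
    ∃ u, IsPEnergyMinimizer Ω p f u := by
  have hp0 : 0 < p := by linarith
  have hp1 : 1 ≤ p := by linarith
  have : Fact (1 ≤ ENNReal.ofReal p) :=
    ⟨by rw [← ENNReal.ofReal_one]; exact ENNReal.ofReal_le_ofReal hp1⟩
  set S : Set ℝ := {e | ∃ (v : E n → ℝ) (H : E n → E n), HasBoundaryValues Ω f v ∧
    IsSobolevWithGradient Ω (ENNReal.ofReal p) v H ∧ ∫ x in Ω, ‖H x‖ ^ p = e} with hS
  have hSne : S.Nonempty := ⟨_, F, classicalGradient F, hFf, hF.isSobolevWithGradient hΩ _, rfl⟩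
  have hSbdd : BddBelow S := ⟨0, by
    rintro _ ⟨v, H, -, -, rfl⟩
    exact integral_nonneg fun x => by positivity⟩
  set I := sInf S with hI
  have hImin : ∀ (v : E n → ℝ) (H : E n → E n), HasBoundaryValues Ω f v →
      IsSobolevWithGradient Ω (ENNReal.ofReal p) v H → I ≤ ∫ x in Ω, ‖H x‖ ^ p :=
    fun v H hv hvH => csInf_le hSbdd ⟨v, H, hv, hvH, rfl⟩
  have hseq : ∀ k : ℕ, ∃ (v : E n → ℝ) (H : E n → E n), HasBoundaryValues Ω f v ∧
      IsSobolevWithGradient Ω (ENNReal.ofReal p) v H ∧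
      ∫ x in Ω, ‖H x‖ ^ p < I + 1 / ((k : ℝ) + 1) := by
    intro k
    obtain ⟨e, ⟨v, H, hv, hvH, rfl⟩, he⟩ := exists_lt_of_csInf_lt hSne
      (lt_add_of_pos_right I (by positivity : 0 < 1 / ((k : ℝ) + 1)))
    exact ⟨v, H, hv, hvH, he⟩
  choose v H hv hvH hE using hseq
  have hdiff : ∀ k l, (1 / 2 * lpNormOn Ω p (H k - H l)) ^ p ≤
      (1 / ((k : ℝ) + 1) + 1 / ((l : ℝ) + 1)) / 2 := by
    intro k l
    have h1 := lpNormOn_half_sub_rpow_le hp2 (hvH k).2.2 (hvH l).2.2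
    have hadm : HasBoundaryValues Ω f fun x => 1 / 2 * (v k x + v l x) :=
      ⟨continuousOn_const.mul ((hv k).1.add (hv l).1), fun x hx => by
        simp only [(hv k).2 hx, (hv l).2 hx]; ring⟩
    have h2 := hImin _ _ hadm ⟨((hvH k).1.add (hvH l).1).const_mul (1 / 2), hadm.memLp hΩ _,
      ((hvH k).2.2.add (hvH l).2.2).const_smul (1 / 2 : ℝ)⟩
    have h3 := hE k
    have h4 := hE l
    linarith
  set h : ℕ → Lp (E n) (ENNReal.ofReal p) (volume.restrict Ω) :=
    fun k => (hvH k).2.2.toLp (H k) with hh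
  have hdist : ∀ k l, dist (h k) (h l) = lpNormOn Ω p (H k - H l) := fun k l => by
    rw [dist_edist, Lp.edist_toLp_toLp]; rfl
  have hcauchy : CauchySeq h := by
    refine Metric.cauchySeq_iff'.2 fun ε hε => ?_
    obtain ⟨K, hK⟩ := exists_nat_one_div_lt (by positivity : 0 < (ε / 2) ^ p)
    refine ⟨K, fun k hk => ?_⟩
    rw [hdist]
    have h1 : 1 / ((k : ℝ) + 1) ≤ 1 / ((K : ℝ) + 1) := by gcongr
    have h2 : (1 / 2 * lpNormOn Ω p (H k - H K)) ^ p < (ε / 2) ^ p :=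
      lt_of_le_of_lt (hdiff k K) (by linarith)
    have h3 := lpNormOn_nonneg Ω p (H k - H K)
    rw [Real.rpow_lt_rpow_iff (by positivity) (by positivity) hp0] at h2
    linarith
  obtain ⟨g, hg⟩ := cauchySeq_tendsto_of_complete hcauchy
  obtain ⟨C, hC, hsup⟩ := hΩ.exists_zero_boundary_sup_const hn hp
  -- Differences of competitors have zero boundary values, so `L^p` convergence of gradients forces
  -- uniform convergence of the functions.
  have hvdist : ∀ k l, ∀ x ∈ closure Ω, |v k x - v l x| ≤ C * dist (h k) (h l) := by
    intro k l x hx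
    rw [hdist]
    exact hsup _ _ ((hv k).sub (hv l)) ((hvH k).1.sub (hvH l).1) ((hvH k).2.2.sub (hvH l).2.2) x hx
  have hvc : UniformCauchySeqOn v atTop (closure Ω) := by
    refine Metric.uniformCauchySeqOn_iff.2 fun ε hε => ?_
    obtain ⟨K, hK⟩ := Metric.cauchySeq_iff.1 hcauchy (ε / (C + 1)) (by positivity)
    refine ⟨K, fun k hk l hl x hx => lt_of_le_of_lt (hvdist k l x hx) ?_⟩
    have h1 := hK k hk l hl
    rw [lt_div_iff₀ (by positivity)] at h1
    nlinarith [dist_nonneg (x := h k) (y := h l)]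
  have hlim : ∀ x, ∃ l, x ∈ closure Ω → Tendsto (fun k => v k x) atTop (𝓝 l) := by
    intro x
    by_cases hx : x ∈ closure Ω
    · obtain ⟨l, hl⟩ := cauchySeq_tendsto_of_complete (hvc.cauchySeq hx)
      exact ⟨l, fun _ => hl⟩
    · exact ⟨0, fun h => (hx h).elim⟩
  choose u hu using hlim
  have hunif : TendstoUniformlyOn v u atTop (closure Ω) :=
    hvc.tendstoUniformlyOn_of_tendsto fun x hx => hu x hx
  have hub : HasBoundaryValues Ω f u := HasBoundaryValues.of_tendstoUniformlyOn hv hunif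
  have hgm : MemLp (⇑g) (ENNReal.ofReal p) (volume.restrict Ω) := Lp.memLp g
  have hHg : Tendsto (fun k => lpNormOn Ω p (H k - ⇑g)) atTop (𝓝 0) := by
    refine (tendsto_iff_dist_tendsto_zero.1 hg).congr fun k => ?_
    conv_lhs => rw [← Lp.toLp_coeFn g hgm]
    rw [dist_edist, Lp.edist_toLp_toLp]
    rfl
  have huG : HasWeakGradient Ω u (⇑g) :=
    HasWeakGradient.of_tendsto hΩ.isOpen hΩ.isBounded hp1 (fun k => (hvH k).1)
      (hub.1.mono subset_closure) (hunif.mono subset_closure) (fun k => (hvH k).2.2) hgm hHg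
  refine ⟨u, hub, ⇑g, ⟨huG, hub.memLp hΩ _, hgm⟩, fun w K hw hwK => ?_⟩
  refine le_trans ?_ (hImin w K hw hwK)
  rw [setIntegral_norm_rpow_eq hp0 hgm]
  have h1 : Tendsto (fun k => ‖h k‖ ^ p) atTop (𝓝 (‖g‖ ^ p)) :=
    hg.norm.rpow_const (Or.inr hp0.le)
  have h2 : Tendsto (fun k : ℕ => I + 1 / ((k : ℝ) + 1)) atTop (𝓝 (I + 0)) :=
    tendsto_const_nhds.add tendsto_one_div_add_atTop_nhds_zero_nat
  rw [add_zero] at h2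
  have h3 : ‖g‖ = lpNormOn Ω p (⇑g) := rfl
  rw [← h3]
  refine le_of_tendsto_of_tendsto' h1 h2 fun k => ?_
  have h4 : ‖h k‖ = lpNormOn Ω p (H k) := Lp.norm_toLp _ _
  rw [h4, ← setIntegral_norm_rpow_eq hp0 (hvH k).2.2]
  exact (hE k).le

/-! ### Compactness and existence of a variational solution -/

/-- Equi-Hölder bounded sequences on a compact set have uniformly convergent subsequences. -/
theorem exists_subseq_tendstoUniformlyOn {K : Set (E n)} (hK : IsCompact K) {d : ℕ → E n → ℝ}
    {A β B : ℝ} (hβ : 0 < β) (hd : ∀ j, ∀ x ∈ K, ∀ y ∈ K, |d j x - d j y| ≤ A * ‖x - y‖ ^ β)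
    (hB : ∀ j, ∀ x ∈ K, |d j x| ≤ B) :
    ∃ (φ : ℕ → ℕ) (w : E n → ℝ), StrictMono φ ∧
      TendstoUniformlyOn (fun j => d (φ j)) w atTop K := by
  have : CompactSpace K := isCompact_iff_compactSpace.1 hK
  have hmod : Tendsto (fun t : ℝ => A * t ^ β) (𝓝 0) (𝓝 0) := by
    have h1 : Tendsto (fun t : ℝ => A * t ^ β) (𝓝 0) (𝓝 (A * 0 ^ β)) :=
      (Real.continuousAt_rpow_const 0 β (Or.inr hβ.le)).tendsto.const_mul A
    rwa [Real.zero_rpow hβ.ne', mul_zero] at h1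
  have heq : ∀ j, ∀ x y : K, dist (d j x) (d j y) ≤ A * dist x y ^ β := fun j x y => by
    rw [Real.dist_eq, Subtype.dist_eq, dist_eq_norm]
    exact hd j x x.2 y y.2
  have hcont : ∀ j, Continuous fun x : K => d j x := fun j =>
    (Metric.equicontinuous_of_continuity_modulus _ hmod (fun (j : ℕ) (x : K) => d j x)
      fun x y j => heq j x y).continuous j
  set W : ℕ → BoundedContinuousFunction K ℝ := fun j =>
    BoundedContinuousFunction.mkOfCompact ⟨fun x : K => d j x, hcont j⟩ with hW
  have hcomp : IsCompact (closure (Set.range W)) := by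
    refine BoundedContinuousFunction.arzela_ascoli (Set.Icc (-B) B) isCompact_Icc _ ?_ ?_
    · rintro _ x ⟨j, rfl⟩
      exact abs_le.1 (hB j x x.2)
    · refine Metric.equicontinuous_of_continuity_modulus _ hmod _ ?_
      rintro x y ⟨_, ⟨j, rfl⟩⟩
      exact heq j x y
  obtain ⟨w, -, φ, hφ, hlim⟩ := hcomp.tendsto_subseq fun j => subset_closure (Set.mem_range_self j)
  classical
  refine ⟨φ, fun x => if h : x ∈ K then w ⟨x, h⟩ else 0, hφ, ?_⟩
  rw [tendstoUniformlyOn_iff_tendstoUniformly_comp_coe]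
  have h1 := BoundedContinuousFunction.tendsto_iff_tendstoUniformly.1 hlim
  convert h1 using 1
  · funext j
    rfl
  · funext x
    simp

theorem lpNormOn_add_le {Ω : Set (E n)} {p : ℝ} (hp : 1 ≤ p) {G H : E n → E n}
    (hG : MemLp G (ENNReal.ofReal p) (volume.restrict Ω))
    (hH : MemLp H (ENNReal.ofReal p) (volume.restrict Ω)) :
    lpNormOn Ω p (G - H) ≤ lpNormOn Ω p G + lpNormOn Ω p H := by
  have h1 : 1 ≤ ENNReal.ofReal p := by
    rw [← ENNReal.ofReal_one]; exact ENNReal.ofReal_le_ofReal hp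
  rw [lpNormOn, lpNormOn, lpNormOn, ← ENNReal.toReal_add hG.2.ne hH.2.ne]
  exact ENNReal.toReal_mono (ENNReal.add_ne_top.2 ⟨hG.2.ne, hH.2.ne⟩) (eLpNorm_sub_le hG.1 hH.1 h1)

theorem lpNormOn_le_of_norm_le {Ω : Set (E n)} (hΩ : Bornology.IsBounded Ω) {p : ℝ} (hp : 0 < p)
    {G : E n → E n} {L : ℝ} (hL : 0 ≤ L) (hG : ∀ x, ‖G x‖ ≤ L) :
    lpNormOn Ω p G ≤ (volume Ω).toReal ^ (1 / p) * L := by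
  have h := eLpNorm_le_of_ae_bound (μ := volume.restrict Ω) (p := ENNReal.ofReal p)
    (Eventually.of_forall hG)
  rw [Measure.restrict_apply_univ, ENNReal.toReal_ofReal hp.le] at h
  have h2 := ENNReal.toReal_mono (ENNReal.mul_ne_top (ENNReal.rpow_ne_top_of_nonneg
    (by positivity) hΩ.measure_lt_top.ne) ENNReal.ofReal_ne_top) h
  rwa [ENNReal.toReal_mul, ← ENNReal.toReal_rpow, ENNReal.toReal_ofReal hL, ← one_div] at h2

/-- The gradients of `p`-energy minimizers are bounded in `L^q` uniformly in `p ≥ q`. -/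
theorem IsPEnergyMinimizer.exists_gradient_le {Ω : Set (E n)} (hΩ : IsBoundedDomain Ω) {q p : ℝ}
    (hq : 1 ≤ q) (hqp : q ≤ p) {f F u : E n → ℝ} {L : ℝ≥0} (hF : LipschitzWith L F)
    (hFf : HasBoundaryValues Ω f F) (hu : IsPEnergyMinimizer Ω p f u) :
    ∃ G, HasWeakGradient Ω u G ∧ MemLp G (ENNReal.ofReal q) (volume.restrict Ω) ∧
      lpNormOn Ω q G ≤ (volume Ω).toReal ^ (1 / q) * L := by
  have := isFiniteMeasure_restrict hΩ.isBounded
  have hp0 : 0 < p := by linarith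
  obtain ⟨-, G, hG, hmin⟩ := hu
  refine ⟨G, hG.1, hG.2.2.mono_exponent (ENNReal.ofReal_le_ofReal hqp), ?_⟩
  have hFs := hF.isSobolevWithGradient hΩ (ENNReal.ofReal p)
  have h1 := hmin F _ hFf hFs
  rw [setIntegral_norm_rpow_eq hp0 hG.2.2, setIntegral_norm_rpow_eq hp0 hFs.2.2,
    Real.rpow_le_rpow_iff (lpNormOn_nonneg _ _ _) (lpNormOn_nonneg _ _ _) hp0] at h1
  have h2 := lpNormOn_le_mul hΩ.isBounded (by linarith) hqp hG.2.2
  have h3 := lpNormOn_le_of_norm_le hΩ.isBounded hp0 L.coe_nonneg hF.norm_classicalGradient_le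
  have hexp : 0 ≤ 1 / q - 1 / p := sub_nonneg.2 (one_div_le_one_div_of_le (by linarith) hqp)
  -- The volume powers from Hölder and from the energy of `F` multiply to `1/q`, removing the
  -- dependence on `p`.
  calc lpNormOn Ω q G ≤ lpNormOn Ω p G * (volume Ω).toReal ^ (1 / q - 1 / p) := h2
    _ ≤ (volume Ω).toReal ^ (1 / p) * L * (volume Ω).toReal ^ (1 / q - 1 / p) :=
        mul_le_mul_of_nonneg_right (h1.trans h3) (by positivity)
    _ = ((volume Ω).toReal ^ (1 / p) * (volume Ω).toReal ^ (1 / q - 1 / p)) * L := by ring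
    _ = (volume Ω).toReal ^ (1 / q) * L := by
        rw [← Real.rpow_add_of_nonneg ENNReal.toReal_nonneg (by positivity) hexp]
        congr 2; ring

/-- All the minimizers are measured in the single exponent `n + 1 > n`. Morrey applied to their
differences with `F` gives one Hölder bound and one sup bound, and Arzelà–Ascoli gives a uniform
limit along a subsequence. -/
theorem IsBoundedDomain.exists_isVariationalSolution (hn : 0 < n) {Ω : Set (E n)}
    (hΩ : IsBoundedDomain Ω) {f F : E n → ℝ} {L : ℝ≥0} (hF : LipschitzWith L F)
    (hFf : HasBoundaryValues Ω f F) : ∃ u, IsVariationalSolution Ω f u := by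
  have hn1 : (1 : ℝ) ≤ n := by exact_mod_cast hn
  have hnq : (n : ℝ) < n + 1 := by linarith
  have hq : (1 : ℝ) ≤ n + 1 := by linarith
  -- Starting at `n + 1` makes every exponent exceed `n` and, as `n ≥ 1`, be at least 2 as Clarkson
  -- requires.
  set p : ℕ → ℝ := fun j => n + 1 + j with hp
  have hqp : ∀ j, (n : ℝ) + 1 ≤ p j := fun j => by simp [hp]
  have hnp : ∀ j, (n : ℝ) < p j := fun j => hnq.trans_le (hqp j)
  choose v hv using fun j => hΩ.exists_isPEnergyMinimizer hn (hnp j) (by linarith [hqp j]) hF hFf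
  choose G hG1 hG2 hG3 using fun j => (hv j).exists_gradient_le hΩ hq (hqp j) hF hFf
  have hFs := hF.isSobolevWithGradient hΩ (ENNReal.ofReal (n + 1))
  set N := 2 * ((volume Ω).toReal ^ (1 / ((n : ℝ) + 1)) * L) with hN
  have hGN : ∀ j, lpNormOn Ω (n + 1) (G j - classicalGradient F) ≤ N := fun j => by
    have h1 := lpNormOn_add_le hq (hG2 j) hFs.2.2
    have h2 := lpNormOn_le_of_norm_le hΩ.isBounded (by linarith : (0 : ℝ) < n + 1) L.coe_nonneg
      hF.norm_classicalGradient_le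
    linarith [hG3 j]
  obtain ⟨C, hC, hhol⟩ := exists_zero_boundary_holder_const hn hnq
  obtain ⟨C', hC', hsup⟩ := hΩ.exists_zero_boundary_sup_const hn hnq
  obtain ⟨φ, w, hφ, hw⟩ := exists_subseq_tendstoUniformlyOn hΩ.isCompact_closure
    (d := fun j x => v j x - F x) (A := C * N) (β := 1 - n / (n + 1)) (B := C' * N)
    (by rw [sub_pos, div_lt_one (by linarith)]; exact hnq)
    (fun j x hx y hy => by
      refine (hhol Ω hΩ.isOpen hΩ.isBounded _ _ ((hv j).1.sub hFf) ((hG1 j).sub hFs.1)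
        ((hG2 j).sub hFs.2.2) x hx y hy).trans ?_
      exact mul_le_mul_of_nonneg_right (mul_le_mul_of_nonneg_left (hGN j) hC) (by positivity))
    (fun j x hx => by
      refine (hsup _ _ ((hv j).1.sub hFf) ((hG1 j).sub hFs.1) ((hG2 j).sub hFs.2.2) x hx).trans ?_
      exact mul_le_mul_of_nonneg_left (hGN j) hC')
  refine ⟨fun x => w x + F x, fun j => p (φ j), fun j => v (φ j), fun j => hnp _, ?_,
    fun j => hv _, ?_⟩
  · have : Tendsto p atTop atTop := tendsto_const_nhds.add_atTop tendsto_natCast_atTop_atTop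
    exact this.comp hφ.tendsto_atTop
  · rw [Metric.tendstoUniformlyOn_iff] at hw ⊢
    intro ε hε
    filter_upwards [hw ε hε] with j hj x hx
    have := hj x hx
    rw [Real.dist_eq] at this ⊢
    convert this using 2
    ring

/-! ### Minimizers against strict subsolutions of the `p`-Laplace equation -/

/-- Bernoulli's inequality for `t/r`: the tangent line of `t^p` at `r` lies below the graph. -/
theorem add_mul_rpow_sub_le_rpow {p r t : ℝ} (hp : 1 ≤ p) (hr : 0 < r) (ht : 0 ≤ t) :
    r ^ p + p * r ^ (p - 1) * (t - r) ≤ t ^ p := by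
  have h := one_add_mul_self_le_rpow_one_add (s := t / r - 1) (by
    have := div_nonneg ht hr.le
    linarith) hp
  have h1 : 1 + (t / r - 1) = t / r := by ring
  rw [h1, Real.div_rpow ht hr.le, le_div_iff₀ (Real.rpow_pos_of_pos hr p)] at h
  have h2 : r ^ p = r ^ (p - 1) * r := by
    rw [← Real.rpow_add_one hr.ne']
    ring_nf
  have h3 : r * (t / r - 1) = t - r := by
    field_simp
  calc r ^ p + p * r ^ (p - 1) * (t - r) = (1 + p * (t / r - 1)) * r ^ p := by
        rw [← h3, h2]; ring
    _ ≤ t ^ p := h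

theorem convexOn_norm_rpow {p : ℝ} (hp : 1 ≤ p) :
    ConvexOn ℝ Set.univ fun x : E n => ‖x‖ ^ p := by
  refine ⟨convex_univ, fun x _ y _ a b ha hb hab => ?_⟩
  have h1 : ‖a • x + b • y‖ ≤ a * ‖x‖ + b * ‖y‖ := by
    refine (norm_add_le _ _).trans_eq ?_
    rw [norm_smul, norm_smul, Real.norm_of_nonneg ha, Real.norm_of_nonneg hb]
  refine (Real.rpow_le_rpow (norm_nonneg _) h1 (by linarith)).trans ?_
  exact (convexOn_rpow hp).2 (norm_nonneg x) (norm_nonneg y) ha hb hab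

/-- The first variation bound for the convex function `‖·‖ ^ p`. -/
theorem norm_add_smul_sub_rpow_le {p s : ℝ} (hp : 1 ≤ p) (hs : 0 ≤ s) (hs1 : s ≤ 1) {a : E n}
    (ha : a ≠ 0) (G : E n) :
    ‖G + s • (a - G)‖ ^ p ≤ ‖G‖ ^ p + p * (‖a‖ ^ (p - 2) * inner ℝ a (s • (a - G))) := by
  have ha0 : 0 < ‖a‖ := norm_pos_iff.2 ha
  have h1 := (convexOn_norm_rpow (n := n) hp).2 (Set.mem_univ G) (Set.mem_univ a)
    (sub_nonneg.2 hs1) hs (by ring)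
  have h2 : G + s • (a - G) = (1 - s) • G + s • a := by
    rw [smul_sub, sub_smul, one_smul]
    abel
  have h3 := add_mul_rpow_sub_le_rpow hp ha0 (norm_nonneg G)
  have h4 : ‖a‖ ^ (p - 1) = ‖a‖ ^ (p - 2) * ‖a‖ := by
    rw [← Real.rpow_add_one ha0.ne']
    ring_nf
  have h5 : inner ℝ a (a - G) = ‖a‖ ^ 2 - inner ℝ a G := by
    rw [inner_sub_right, real_inner_self_eq_norm_sq]
  have h6 := real_inner_le_norm a G
  have h7 : 0 ≤ p * ‖a‖ ^ (p - 2) := by positivity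
  -- The tangent line at `‖a‖` and Cauchy–Schwarz settle the full step `s = 1`; convexity along the
  -- segment scales the bound by `s`.
  have h8 : ‖a‖ ^ p - ‖G‖ ^ p ≤ p * (‖a‖ ^ (p - 2) * inner ℝ a (a - G)) := by
    rw [h5]
    rw [h4] at h3
    nlinarith [mul_le_mul_of_nonneg_left h6 h7]
  rw [h2, inner_smul_right]
  simp only [smul_eq_mul] at h1
  nlinarith [mul_le_mul_of_nonneg_left h8 hs]

/-- The `p`-Laplacian flux `|∇φ| ^ (2 q) ∂ᵢφ`, where `q = (p - 2) / 2`. -/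
def gradFlux (q : ℝ) (φ : E n → ℝ) (i : Fin n) (x : E n) : ℝ :=
  (∑ j, partialDeriv j φ x ^ 2) ^ q * partialDeriv i φ x

theorem norm_classicalGradient_sq (φ : E n → ℝ) (x : E n) :
    ‖classicalGradient φ x‖ ^ 2 = ∑ j, partialDeriv j φ x ^ 2 := by
  simp [EuclideanSpace.norm_sq_eq]

theorem sum_gradFlux_mul {q : ℝ} (φ : E n → ℝ) (x v : E n) :
    ∑ i, gradFlux q φ i x * v i = ‖classicalGradient φ x‖ ^ (2 * q) *
      inner ℝ (classicalGradient φ x) v := by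
  rw [Real.rpow_mul (norm_nonneg _), Real.rpow_two, norm_classicalGradient_sq, PiLp.inner_apply,
    Finset.mul_sum]
  refine Finset.sum_congr rfl fun i _ => ?_
  simp [gradFlux]
  ring

/-- Used contrapositively: a positive infinity-Laplacian forces a nonzero gradient, and there the
flux is `C¹`. -/
theorem infLaplacian_eq_zero_of_sum_sq {φ : E n → ℝ} {x : E n}
    (h : ∑ j, partialDeriv j φ x ^ 2 = 0) : infLaplacian φ x = 0 := by
  have h1 := (Finset.sum_eq_zero_iff_of_nonneg fun j _ => sq_nonneg (partialDeriv j φ x)).1 h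
  refine Finset.sum_eq_zero fun i hi => Finset.sum_eq_zero fun j _ => ?_
  rw [pow_eq_zero_iff two_ne_zero |>.1 (h1 i hi)]
  ring

theorem ContDiffAt.partialDeriv {φ : E n → ℝ} {x : E n} (h : ContDiffAt ℝ 2 φ x) (i : Fin n) :
    ContDiffAt ℝ 1 (_root_.partialDeriv i φ) x :=
  (h.fderiv_right (m := 1) (by norm_num)).clm_apply contDiffAt_const

theorem contDiffAt_gradFlux {q : ℝ} {φ : E n → ℝ} {x : E n} (h : ContDiffAt ℝ 2 φ x)
    (hS : 0 < ∑ j, partialDeriv j φ x ^ 2) (i : Fin n) : ContDiffAt ℝ 1 (gradFlux q φ i) x :=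
  ((ContDiffAt.sum fun j _ => (h.partialDeriv j).pow 2).rpow_const_of_ne hS.ne').mul
    (h.partialDeriv i)

/-- The `p`-Laplacian in expanded form. As `q` grows, the infinity-Laplacian dominates the bracket,
which links the sign of `Δ_∞ φ` to large exponents. -/
theorem sum_partialDeriv_gradFlux {q : ℝ} {φ : E n → ℝ} {x : E n} (h : ContDiffAt ℝ 2 φ x)
    (hS : 0 < ∑ j, partialDeriv j φ x ^ 2) :
    ∑ i, partialDeriv i (gradFlux q φ i) x = (∑ j, partialDeriv j φ x ^ 2) ^ (q - 1) *
      ((∑ j, partialDeriv j φ x ^ 2) * ∑ i, partialDeriv i (partialDeriv i φ) x +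
        2 * q * infLaplacian φ x) := by
  have hd : ∀ j, HasFDerivAt (partialDeriv j φ) (fderiv ℝ (partialDeriv j φ) x) x := fun j =>
    (h.differentiableAt_partialDeriv j).hasFDerivAt
  have hsum : HasFDerivAt (fun y => ∑ j, partialDeriv j φ y ^ 2)
      (∑ j, (2 * partialDeriv j φ x) • fderiv ℝ (partialDeriv j φ) x) x := by
    refine HasFDerivAt.fun_sum fun j _ => ?_
    simpa using (hd j).pow 2
  set S := ∑ j, partialDeriv j φ x ^ 2 with hSdef
  have hSq : S ^ q = S ^ (q - 1) * S := by
    rw [← Real.rpow_add_one hS.ne']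
    ring_nf
  have key : ∀ i, partialDeriv i (gradFlux q φ i) x = S ^ (q - 1) *
      (S * partialDeriv i (partialDeriv i φ) x + 2 * q *
        ∑ j, partialDeriv i φ x * partialDeriv j φ x * partialDeriv i (partialDeriv j φ) x) := by
    intro i
    have h1 : HasFDerivAt (gradFlux q φ i) _ x :=
      (hsum.rpow_const (p := q) (Or.inl hS.ne')).mul (hd i)
    rw [h1.partialDeriv_eq]
    simp only [_root_.add_apply, _root_.smul_apply, _root_.sum_apply, smul_eq_mul, ← hSdef]
    change S ^ q * partialDeriv i (partialDeriv i φ) x + partialDeriv i φ x *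
      (q * S ^ (q - 1) * ∑ j, 2 * partialDeriv j φ x * partialDeriv i (partialDeriv j φ) x) = _
    simp only [mul_assoc, ← Finset.mul_sum]
    rw [hSq]
    ring
  simp_rw [key]
  rw [← Finset.mul_sum, Finset.sum_add_distrib, ← Finset.mul_sum, ← Finset.mul_sum]
  rfl

/-- The primitive of `Real.smoothTransition` serves as a `C¹` positive part whose derivative lies in
`[0, 1]`. The chain rule then applies, and adding it to the minimizer turns the gradient into a
convex combination. -/
theorem primitive_smoothTransition_eq_zero {t : ℝ} (ht : t ≤ 0) :
    primitive Real.smoothTransition t = 0 := by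
  rw [primitive, intervalIntegral.integral_congr (g := fun _ => 0), intervalIntegral.integral_zero]
  intro s hs
  rw [Set.uIcc_of_ge ht] at hs
  exact Real.smoothTransition.zero_of_nonpos hs.2

theorem primitive_smoothTransition_pos {t : ℝ} (ht : 0 < t) :
    0 < primitive Real.smoothTransition t :=
  intervalIntegral.intervalIntegral_pos_of_pos_on
    (Real.smoothTransition.continuous.intervalIntegrable _ _)
    (fun _ hs => Real.smoothTransition.pos_of_pos hs.1) ht

theorem primitive_smoothTransition_nonneg (t : ℝ) : 0 ≤ primitive Real.smoothTransition t := by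
  rcases le_or_gt t 0 with h | h
  · exact (primitive_smoothTransition_eq_zero h).ge
  · exact (primitive_smoothTransition_pos h).le

theorem contDiff_mul_of_tsupport_subset {χ g : E n → ℝ} {V : Set (E n)} {k : WithTop ℕ∞}
    (hχ : ContDiff ℝ k χ) (hχV : tsupport χ ⊆ V) (hg : ∀ x ∈ V, ContDiffAt ℝ k g x) :
    ContDiff ℝ k fun x => χ x * g x := by
  refine contDiff_iff_contDiffAt.2 fun x => ?_
  by_cases hx : x ∈ tsupport χ
  · exact hχ.contDiffAt.mul (hg x (hχV hx))
  · have : (fun x => χ x * g x) =ᶠ[𝓝 x] fun _ => 0 := by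
      filter_upwards [(isClosed_tsupport χ).isOpen_compl.mem_nhds hx] with y hy
      rw [image_eq_zero_of_notMem_tsupport hy, zero_mul]
    exact contDiffAt_const.congr_of_eventuallyEq this

theorem continuous_indicator_of_isCompact {V K : Set (E n)} (hV : IsOpen V) {w : E n → ℝ}
    (hw : ContinuousOn w V) (hK : IsCompact K) (hKV : K ⊆ V) (h0 : ∀ x ∈ V, x ∉ K → w x = 0) :
    Continuous (V.indicator w) := by
  refine continuous_iff_continuousAt.2 fun x => ?_
  by_cases hx : x ∈ K
  · refine (hw.continuousAt (hV.mem_nhds (hKV hx))).congr ?_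
    filter_upwards [hV.mem_nhds (hKV hx)] with y hy
    rw [Set.indicator_of_mem hy]
  · refine (continuousAt_const (y := (0 : ℝ))).congr ?_
    filter_upwards [hK.isClosed.isOpen_compl.mem_nhds hx] with y hy
    by_cases hyV : y ∈ V
    · rw [Set.indicator_of_mem hyV, h0 y hyV hy]
    · rw [Set.indicator_of_notMem hyV]

/-- Testing the weak gradient of a nonnegative, compactly supported function with a vector field
of positive divergence. -/
theorem HasWeakGradient.integral_sum_mul_neg {V K : Set (E n)} {η : E n → ℝ} {H : E n → E n}
    (hη : HasWeakGradient Set.univ η H) (hηc : Continuous η) (hη0 : ∀ x, 0 ≤ η x)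
    (hV : IsOpen V) (hK : IsCompact K) (hKV : K ⊆ V) (hηK : ∀ x, x ∉ K → η x = 0)
    (hHK : ∀ x, x ∉ K → H x = 0) {X : Fin n → E n → ℝ}
    (hX : ∀ i, ∀ x ∈ V, ContDiffAt ℝ 1 (X i) x)
    (hdiv : ∀ x ∈ V, 0 < ∑ i, partialDeriv i (X i) x) {x₁ : E n} (hx₁ : 0 < η x₁) :
    Integrable (fun x => ∑ i, X i x * H x i) ∧ ∫ x, ∑ i, X i x * H x i < 0 := by
  -- The field is `C¹` only on `V`; the cutoff makes it a global `C¹` test field, unchanged near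
  -- `K`, where `η` and `H` live.
  obtain ⟨χ, hχ, hχc, hχV, hχ1, -⟩ := exists_smooth_cutoff hK hV hKV
  have hZ : ∀ i, ContDiff ℝ 1 fun x => χ x * X i x := fun i =>
    contDiff_mul_of_tsupport_subset (hχ.of_le (by simp)) hχV (hX i)
  have hZc : ∀ i, HasCompactSupport fun x => χ x * X i x := fun i => hχc.mul_right
  have hcong : ∀ i, ∀ x ∈ K, (fun x => χ x * X i x) =ᶠ[𝓝 x] X i := fun i x hx => by
    filter_upwards [hχ1 x hx] with y hy
    rw [hy, Pi.one_apply, one_mul]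
  have hXH : (fun x => ∑ i, X i x * H x i) = fun x => ∑ i, H x i * (χ x * X i x) := by
    funext x
    refine Finset.sum_congr rfl fun i _ => ?_
    by_cases hx : x ∈ K
    · have e : χ x * X i x = X i x := (hcong i x hx).eq_of_nhds
      rw [e, mul_comm]
    · simp [hHK x hx]
  have hint : ∀ i, Integrable fun x => H x i * (χ x * X i x) := fun i =>
    (hη.2.1.apply i).integrable_mul (hZ i).continuous (hZc i) (Set.subset_univ _)
  rw [hXH]
  refine ⟨integrable_finsetSum _ fun i _ => hint i, ?_⟩
  rw [integral_finsetSum _ fun i _ => hint i]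
  have hibp : ∀ i, ∫ x, H x i * (χ x * X i x) =
      -∫ x, η x * partialDeriv i (fun x => χ x * X i x) x := fun i => by
    rw [hη.integral_eq_of_contDiff_one isOpen_univ (hZ i) (hZc i) (Set.subset_univ _) i, neg_neg]
  have hcd : ∀ i, Continuous (partialDeriv i fun x => χ x * X i x) := fun i =>
    (hZ i).continuous_partialDeriv (by simp) i
  have hηs : HasCompactSupport η := HasCompactSupport.intro hK hηK
  have hint2 : ∀ i, Integrable fun x => η x * partialDeriv i (fun x => χ x * X i x) x := fun i =>
    (hηc.mul (hcd i)).integrable_of_hasCompactSupport hηs.mul_right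
  rw [Finset.sum_congr rfl fun i _ => hibp i, Finset.sum_neg_distrib, neg_lt_zero,
    ← integral_finsetSum _ fun i _ => hint2 i]
  have hval : ∀ x ∈ K, ∑ i, η x * partialDeriv i (fun x => χ x * X i x) x =
      η x * ∑ i, partialDeriv i (X i) x := fun x hx => by
    rw [Finset.mul_sum]
    exact Finset.sum_congr rfl fun i _ => by rw [(hcong i x hx).partialDeriv_eq]
  have hx₁K : x₁ ∈ K := by
    by_contra h
    exact hx₁.ne' (hηK x₁ h)
  refine Continuous.integral_pos_of_hasCompactSupport_nonneg_nonzero (x := x₁)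
    (continuous_finsetSum _ fun i _ => hηc.mul (hcd i)) (HasCompactSupport.intro hK fun x hx => ?_)
    (fun x => ?_) ?_
  · simp [hηK x hx]
  · by_cases hx : x ∈ K
    · rw [Pi.zero_apply, hval x hx]
      exact mul_nonneg (hη0 x) (hdiv x (hKV hx)).le
    · simp [hηK x hx]
  · rw [hval x₁ hx₁K]
    exact (mul_pos hx₁ (hdiv x₁ (hKV hx₁K))).ne'

/-- Comparison of a minimizer with a strict classical subsolution of the `p`-Laplace equation. -/
theorem IsPEnergyMinimizer.le_of_strict_subsolution {Ω V K : Set (E n)} (hΩ : IsBoundedDomain Ω)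
    {p : ℝ} (hp : 2 ≤ p) {f v : E n → ℝ} (hv : IsPEnergyMinimizer Ω p f v) (hV : IsOpen V)
    (hVΩ : V ⊆ Ω) (hK : IsCompact K) (hKV : K ⊆ V) {φ : E n → ℝ} (hφ : ContDiffOn ℝ 2 φ V)
    (hS : ∀ x ∈ V, 0 < ∑ j, partialDeriv j φ x ^ 2)
    (hdiv : ∀ x ∈ V, 0 < ∑ i, partialDeriv i (gradFlux ((p - 2) / 2) φ i) x)
    (hout : ∀ x ∈ V, x ∉ K → φ x ≤ v x) : ∀ x ∈ V, φ x ≤ v x := by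
  intro x₁ hx₁
  by_contra! hlt
  obtain ⟨hvb, G, ⟨hvG, hvp, hGp⟩, hmin⟩ := hv
  have hp0 : 0 < p := by linarith
  have hθ := Real.smoothTransition.continuous
  set h := primitive Real.smoothTransition with hh
  have hdh : deriv h = Real.smoothTransition := deriv_primitive hθ
  have hvc : ContinuousOn v V := hvb.1.mono (hVΩ.trans subset_closure)
  have hψc : ContinuousOn (fun x => φ x - v x) V := hφ.continuousOn.sub hvc
  have hψG : HasWeakGradient V (fun x => φ x - v x) fun x => classicalGradient φ x - G x :=
    (hasWeakGradient_classicalGradient hV (hφ.of_le (by norm_num))).sub (hvG.mono hVΩ)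
  have hcomp := hψG.comp_contDiff hV hψc (contDiff_primitive hθ) (C := 1) fun t => by
    rw [deriv_primitive hθ, abs_of_nonneg (Real.smoothTransition.nonneg t)]
    exact Real.smoothTransition.le_one t
  rw [← hh, hdh] at hcomp
  set s : E n → ℝ := fun x => Real.smoothTransition (φ x - v x) with hs
  have hw0 : ∀ x ∈ V, x ∉ K → h (φ x - v x) = 0 := fun x hx hxK =>
    primitive_smoothTransition_eq_zero (sub_nonpos.2 (hout x hx hxK))
  have hH0 : ∀ x ∈ V, x ∉ K → s x • (classicalGradient φ x - G x) = 0 := fun x hx hxK => by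
    rw [hs]
    simp only
    rw [Real.smoothTransition.zero_of_nonpos (sub_nonpos.2 (hout x hx hxK)), zero_smul]
  set η : E n → ℝ := V.indicator fun x => h (φ x - v x) with hη
  set H : E n → E n := V.indicator fun x => s x • (classicalGradient φ x - G x) with hH
  have hηH : HasWeakGradient Set.univ η H := hcomp.indicator_of_isCompact hV hK hKV hw0 hH0
  have hηc : Continuous η := continuous_indicator_of_isCompact hV
    ((contDiff_primitive hθ).continuous.comp_continuousOn hψc) hK hKV hw0
  have hηK : ∀ x, x ∉ K → η x = 0 := fun x hx => by
    by_cases hxV : x ∈ V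
    · rw [hη, Set.indicator_of_mem hxV, hw0 x hxV hx]
    · rw [hη, Set.indicator_of_notMem hxV]
  have hHK : ∀ x, x ∉ K → H x = 0 := fun x hx => by
    by_cases hxV : x ∈ V
    · rw [hH, Set.indicator_of_mem hxV, hH0 x hxV hx]
    · rw [hH, Set.indicator_of_notMem hxV]
  have hVat : ∀ x ∈ V, ContDiffAt ℝ 2 φ x := fun x hx => hφ.contDiffAt (hV.mem_nhds hx)
  obtain ⟨hint, hneg⟩ := hηH.integral_sum_mul_neg hηc
    (fun x => Set.indicator_nonneg (fun y _ => primitive_smoothTransition_nonneg _) x) hV hK hKV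
    hηK hHK (fun i x hx => contDiffAt_gradFlux (q := (p - 2) / 2) (hVat x hx) (hS x hx) i) hdiv
    (x₁ := x₁) (by
      rw [hη, Set.indicator_of_mem hx₁]
      exact primitive_smoothTransition_pos (sub_pos.2 hlt))
  -- The competitor raises `v` where it lies below `φ`. Its gradient `G + H` lies between `G` and
  -- `∇φ` pointwise, which gives both integrability and the first variation bound.
  have hcb : HasBoundaryValues Ω f fun x => v x + η x := by
    refine ⟨hvb.1.add hηc.continuousOn, fun x hx => ?_⟩
    have : x ∉ K := fun hxK => by
      rw [hΩ.isOpen.frontier_eq] at hx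
      exact hx.2 (hVΩ (hKV hxK))
    simp only [hηK x this, add_zero]
    exact hvb.2 hx
  have hconv : ∀ x, ‖G x + H x‖ ≤ ‖G x‖ + K.indicator (fun x => ‖classicalGradient φ x‖) x := by
    intro x
    by_cases hxK : x ∈ K
    · rw [Set.indicator_of_mem hxK, hH, Set.indicator_of_mem (hKV hxK)]
      have h0 : 0 ≤ s x := Real.smoothTransition.nonneg _
      have h1 : s x ≤ 1 := Real.smoothTransition.le_one _
      have e : G x + s x • (classicalGradient φ x - G x) =
          (1 - s x) • G x + s x • classicalGradient φ x := by
        rw [smul_sub, sub_smul, one_smul]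
        abel
      rw [e]
      refine (norm_add_le _ _).trans ?_
      rw [norm_smul, norm_smul, Real.norm_of_nonneg h0, Real.norm_of_nonneg (sub_nonneg.2 h1)]
      nlinarith [norm_nonneg (G x), norm_nonneg (classicalGradient φ x)]
    · rw [Set.indicator_of_notMem hxK, hHK x hxK, add_zero, add_zero]
  have hgc : ContinuousOn (classicalGradient φ) K := by
    have : ContinuousOn (fun x => fun i => partialDeriv i φ x) K := continuousOn_pi.2 fun i =>
      (hφ.continuousOn_partialDeriv hV (by norm_num) i).mono hKV
    exact (PiLp.continuous_toLp 2 _).comp_continuousOn this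
  obtain ⟨B, hB⟩ := hK.exists_bound_of_continuousOn hgc
  have := isFiniteMeasure_restrict hΩ.isBounded
  have hHm : AEStronglyMeasurable H (volume.restrict Ω) :=
    ((locallyIntegrableOn_univ.1 hηH.2.1).aestronglyMeasurable).restrict
  have hGH : MemLp (fun x => G x + H x) (ENNReal.ofReal p) (volume.restrict Ω) := by
    refine MemLp.of_le (hGp.norm.add (memLp_const |B|)) (hGp.1.add hHm)
      (Eventually.of_forall fun x => (hconv x).trans ?_)
    refine le_trans ?_ (le_abs_self _)
    refine add_le_add_right ?_ _
    by_cases hxK : x ∈ K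
    · rw [Set.indicator_of_mem hxK]
      exact (hB x hxK).trans (le_abs_self B)
    · rw [Set.indicator_of_notMem hxK]
      exact abs_nonneg B
  have hle := hmin _ (fun x => G x + H x) hcb ⟨hvG.add (hηH.mono (Set.subset_univ _)),
    hcb.memLp hΩ _, hGH⟩
  -- The variation is linearized at `∇φ`, not at `G`, so its integral is the flux of `φ` against
  -- `H`. Positive divergence makes that negative, and the competitor would beat the minimizer.
  have hpt : ∀ x, ‖G x + H x‖ ^ p ≤
      ‖G x‖ ^ p + p * ∑ i, gradFlux ((p - 2) / 2) φ i x * H x i := by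
    intro x
    by_cases hxK : x ∈ K
    · have hxV := hKV hxK
      rw [sum_gradFlux_mul, hH, Set.indicator_of_mem hxV, mul_div_cancel₀ _ two_ne_zero]
      refine norm_add_smul_sub_rpow_le (by linarith) (Real.smoothTransition.nonneg _)
        (Real.smoothTransition.le_one _) (fun h0 => ?_) (G x)
      have := hS x hxV
      rw [← norm_classicalGradient_sq, h0] at this
      simp at this
    · simp [hHK x hxK]
  have hset : ∫ x in Ω, ∑ i, gradFlux ((p - 2) / 2) φ i x * H x i =
      ∫ x, ∑ i, gradFlux ((p - 2) / 2) φ i x * H x i :=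
    setIntegral_eq_integral_of_forall_compl_eq_zero fun x hx => by
      simp [hHK x fun hxK => hx (hVΩ (hKV hxK))]
  have hG1 := hGp.integrable_rpow_norm hp0
  have hint' := hint.restrict (s := Ω)
  have hmono := integral_mono (hGH.integrable_rpow_norm hp0) (hG1.add (hint'.const_mul p)) hpt
  have hadd := integral_add hG1 (hint'.const_mul p)
  rw [integral_const_mul, hset] at hadd
  have := mul_neg_of_pos_of_neg hp0 hneg
  have e := hmono.trans_eq hadd
  linarith

/-! ### Variational solutions are viscosity solutions -/

theorem partialDeriv_add_const (i : Fin n) (φ : E n → ℝ) (c : ℝ) :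
    partialDeriv i (fun x => φ x + c) = partialDeriv i φ := by
  funext x
  simp [partialDeriv]

/-- If `Δ_∞ φ > 0` at a contact from below, then for large `p` a slightly raised `φ` is a strict
`p`-subsolution near `x₀`. Strict contact puts it below the minimizers on an annulus, so comparison
puts it below them at `x₀`, against uniform convergence. -/
theorem IsVariationalSolution.isViscositySupersolution {Ω : Set (E n)} (hΩ : IsBoundedDomain Ω)
    {f w : E n → ℝ} (hw : IsVariationalSolution Ω f w) : IsViscositySupersolution Ω w := by
  obtain ⟨p, v, -, hp, hv, hunif⟩ := hw
  have hwb : HasBoundaryValues Ω f w := .of_tendstoUniformlyOn (fun j => (hv j).1) hunif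
  refine ⟨hwb.1.mono subset_closure, fun x₀ hx₀ φ hφ ht => ?_⟩
  by_contra! hpos
  have hat : ∀ x ∈ Ω, ContDiffAt ℝ 2 φ x := fun x hx => hφ.contDiffAt (hΩ.isOpen.mem_nhds hx)
  have hd1 : ∀ i, ContinuousOn (partialDeriv i φ) Ω := fun i x hx =>
    ((hat x hx).partialDeriv i).continuousAt.continuousWithinAt
  have hd2 : ∀ i j, ContinuousOn (partialDeriv i (partialDeriv j φ)) Ω := fun i j =>
    ContDiffOn.continuousOn_partialDeriv hΩ.isOpen
      (fun x hx => ((hat x hx).partialDeriv j).contDiffWithinAt) le_rfl i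
  have hinf : ContinuousOn (infLaplacian φ) Ω := continuousOn_finsetSum _ fun i _ =>
    continuousOn_finsetSum _ fun j _ => ((hd1 i).mul (hd1 j)).mul (hd2 i j)
  obtain ⟨r, hr, hball⟩ := Metric.nhds_basis_closedBall.mem_iff.1 <|
    Filter.inter_mem (hΩ.isOpen.mem_nhds hx₀)
      ((hinf.continuousAt (hΩ.isOpen.mem_nhds hx₀)).eventually (lt_mem_nhds hpos))
  have hBΩ : Metric.closedBall x₀ r ⊆ Ω := fun x hx => (hball hx).1
  have hBc : IsCompact (Metric.closedBall x₀ r) := isCompact_closedBall _ _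
  obtain ⟨c, hc, hcB⟩ := hBc.exists_forall_le' (hinf.mono hBΩ) fun x hx => (hball hx).2
  -- The part of the expanded `p`-Laplacian independent of `p`, bounded on the ball.
  set M : E n → ℝ := fun x => (∑ j, partialDeriv j φ x ^ 2) *
    ∑ i, partialDeriv i (partialDeriv i φ) x with hM
  have hMc : ContinuousOn M Ω := (continuousOn_finsetSum _ fun j _ => (hd1 j).pow 2).mul
    (continuousOn_finsetSum _ fun i _ => hd2 i i)
  obtain ⟨B, hB⟩ := hBc.exists_bound_of_continuousOn (hMc.mono hBΩ)
  have hAc : IsCompact (Metric.closedBall x₀ r \ Metric.ball x₀ (r / 2)) :=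
    hBc.diff Metric.isOpen_ball
  obtain ⟨μ, hμ, hμA⟩ := hAc.exists_forall_le' (f := fun x => w x - φ x) (a := 0)
    ((hwb.1.mono (Set.sdiff_subset.trans (hBΩ.trans subset_closure))).sub
      (hφ.continuousOn.mono (Set.sdiff_subset.trans hBΩ))) fun x hx => by
    refine sub_pos.2 (ht.2 x (hBΩ hx.1) fun h => hx.2 ?_)
    rw [h]
    exact Metric.mem_ball_self (by linarith)
  -- The threshold gives `p j ≥ 2` and `(p j - 2) c ≥ |B| + c`, enough to beat `M`. The tolerance
  -- `μ/2` matches the amount by which `φ` is raised: on the annulus `w - φ ≥ μ` leaves the other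
  -- half.
  obtain ⟨j, hj, hpj⟩ := ((Metric.tendstoUniformlyOn_iff.1 hunif (μ / 2) (by linarith)).and
    (hp.eventually_ge_atTop (|B| / c + 3))).exists
  have hBc0 : 0 ≤ |B| / c := by positivity
  have hS : ∀ x ∈ Metric.ball x₀ r, 0 < ∑ j, partialDeriv j φ x ^ 2 := fun x hx => by
    refine (Finset.sum_nonneg fun j _ => sq_nonneg _).lt_of_ne fun h => ?_
    exact (hball (Metric.ball_subset_closedBall hx)).2.ne'
      (infLaplacian_eq_zero_of_sum_sq h.symm)
  have hle := (hv j).le_of_strict_subsolution hΩ (by linarith) Metric.isOpen_ball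
    (Metric.ball_subset_closedBall.trans hBΩ) (isCompact_closedBall x₀ (r / 2))
    (Metric.closedBall_subset_ball (by linarith)) (φ := fun x => φ x + μ / 2)
    ((hφ.mono (Metric.ball_subset_closedBall.trans hBΩ)).add contDiffOn_const)
    (fun x hx => by simpa only [partialDeriv_add_const] using hS x hx)
    (fun x hx => ?_) (fun x hx hxK => ?_) x₀ (Metric.mem_ball_self hr)
  · have h1 := hj x₀ (subset_closure hx₀)
    rw [Real.dist_eq, abs_lt] at h1
    have h2 := ht.1
    linarith [h1.1]
  · have e : gradFlux ((p j - 2) / 2) (fun x => φ x + μ / 2) = gradFlux ((p j - 2) / 2) φ := by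
      funext i x
      simp only [gradFlux, partialDeriv_add_const]
    have hxB := Metric.ball_subset_closedBall hx
    rw [e, sum_partialDeriv_gradFlux (hat x (hBΩ hxB)) (hS x hx)]
    refine mul_pos (Real.rpow_pos_of_pos (hS x hx) _) ?_
    have h1 := (abs_le.1 ((hB x hxB).trans (le_abs_self B))).1
    have h2 := hcB x hxB
    have h3 : |B| < (p j - 2) * c := by
      have : |B| = |B| / c * c := by field_simp
      nlinarith
    have h4 : (p j - 2) * c ≤ (p j - 2) * infLaplacian φ x :=
      mul_le_mul_of_nonneg_left h2 (by linarith)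
    have h5 : 2 * ((p j - 2) / 2) = p j - 2 := by ring
    rw [h5]
    change 0 < M x + _
    linarith
  · have hxA : x ∈ Metric.closedBall x₀ r \ Metric.ball x₀ (r / 2) :=
      ⟨Metric.ball_subset_closedBall hx, fun h => hxK (Metric.ball_subset_closedBall h)⟩
    have h1 := hj x (subset_closure (hBΩ hxA.1))
    rw [Real.dist_eq, abs_lt] at h1
    have h2 := hμA x hxA
    linarith [h1.2]

theorem HasBoundaryValues.neg {Ω : Set (E n)} {f u : E n → ℝ} (h : HasBoundaryValues Ω f u) :
    HasBoundaryValues Ω (fun x => -f x) fun x => -u x :=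
  ⟨h.1.neg, fun _ hx => congrArg Neg.neg (h.2 hx)⟩

theorem IsSobolevWithGradient.neg {Ω : Set (E n)} {p : ℝ≥0∞} {u : E n → ℝ} {G : E n → E n}
    (h : IsSobolevWithGradient Ω p u G) :
    IsSobolevWithGradient Ω p (fun x => -u x) fun x => -G x :=
  ⟨h.1.neg, h.2.1.neg, h.2.2.neg⟩

theorem IsPEnergyMinimizer.neg {Ω : Set (E n)} {p : ℝ} {f u : E n → ℝ}
    (h : IsPEnergyMinimizer Ω p f u) :
    IsPEnergyMinimizer Ω p (fun x => -f x) fun x => -u x := by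
  obtain ⟨hb, G, hG, hmin⟩ := h
  refine ⟨hb.neg, _, hG.neg, fun v H hv hH => ?_⟩
  have hv' := hv.neg
  simp only [neg_neg] at hv'
  simpa only [norm_neg] using hmin _ _ hv' hH.neg

theorem IsVariationalSolution.neg {Ω : Set (E n)} {f u : E n → ℝ}
    (h : IsVariationalSolution Ω f u) :
    IsVariationalSolution Ω (fun x => -f x) fun x => -u x := by
  obtain ⟨p, v, hpn, hp, hv, hunif⟩ := h
  exact ⟨p, fun j x => -v j x, hpn, hp, fun j => (hv j).neg, hunif.neg⟩

/-- The `p`-energy is even, so `-w` is variational for `-f`; its supersolution property is the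
subsolution property of `w`. -/
theorem IsVariationalSolution.isViscosityDirichletSolution {Ω : Set (E n)}
    (hΩ : IsBoundedDomain Ω) {f w : E n → ℝ} (hw : IsVariationalSolution Ω f w) :
    IsViscosityDirichletSolution Ω f w := by
  have hsub := (hw.neg.isViscositySupersolution hΩ).neg
  simp only [neg_neg] at hsub
  refine ⟨?_, hw.isViscositySupersolution hΩ, hsub⟩
  obtain ⟨p, v, -, -, hv, hunif⟩ := hw
  exact .of_tendstoUniformlyOn (fun j => (hv j).1) hunif

/-- A Lipschitz extension to the whole space with the same constant reduces the claim to Rademacher,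
and its gradient is bounded pointwise by `L`. -/
theorem exists_isSobolevWithGradient_top {Ω : Set (E n)} (hΩ : IsBoundedDomain Ω) {u : E n → ℝ}
    {L : ℝ≥0} (hu : LipschitzOnWith L u (closure Ω)) :
    ∃ G : E n → E n, IsSobolevWithGradient Ω ∞ u G ∧ eLpNorm G ∞ (volume.restrict Ω) ≤ L := by
  obtain ⟨U, hU, hUu⟩ := hu.extend_real
  have hUS := hU.isSobolevWithGradient hΩ ∞
  have heq : Set.EqOn U u Ω := fun x hx => (hUu (subset_closure hx)).symm
  refine ⟨classicalGradient U, ⟨hUS.1.congr hΩ.isOpen heq fun _ _ => rfl, ?_, hUS.2.2⟩, ?_⟩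
  · exact hUS.2.1.ae_eq ((ae_restrict_iff' hΩ.isOpen.measurableSet).2 (Eventually.of_forall heq))
  · rw [eLpNorm_exponent_top]
    refine eLpNormEssSup_le_of_ae_nnnorm_bound (Eventually.of_forall fun x => ?_)
    exact hU.norm_classicalGradient_le x

end

/-! ### The main theorem -/

theorem mainTheorem1 :
    ∃ C : ℝ≥0 → ℝ≥0, ∀ (n : ℕ), 0 < n → ∀ (Ω : Set (E n)), IsBoundedDomain Ω →
      ∀ (L : ℝ≥0) (f : E n → ℝ), LipschitzOnWith L f (frontier Ω) →
        ∃ u : E n → ℝ,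
          -- existence and uniqueness (as a function on the closure) of the viscosity solution
          IsViscosityDirichletSolution Ω f u ∧
          (∀ w : E n → ℝ, IsViscosityDirichletSolution Ω f w → Set.EqOn w u (closure Ω)) ∧
          -- it is Lipschitz and in `W^{1,∞}`, with the gradient bounded in terms of `L` only
          LipschitzOnWith (C L) u (closure Ω) ∧
          (∃ G : E n → E n, IsSobolevWithGradient Ω ∞ u G ∧
            eLpNorm G ∞ (volume.restrict Ω) ≤ (C L : ℝ≥0∞)) ∧
          -- the viscosity solution is the variational one, and conversely
          (∀ w : E n → ℝ, IsViscosityDirichletSolution Ω f w ↔ IsVariationalSolution Ω f w) := by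
  refine ⟨id, fun n hn Ω hΩ L f hf => ?_⟩
  obtain ⟨F, hF, hFf⟩ := hf.extend_real
  obtain ⟨u, hu⟩ := hΩ.exists_isVariationalSolution hn hF (f := f)
    ⟨hF.continuous.continuousOn, hFf.symm⟩
  have hud := hu.isViscosityDirichletSolution hΩ
  have huniq : ∀ w : E n → ℝ, IsViscosityDirichletSolution Ω f w → Set.EqOn w u (closure Ω) :=
    fun w hw => IsViscosityDirichletSolution.eqOn hn hΩ hw hud
  have hlip := IsViscosityDirichletSolution.lipschitzOnWith hΩ hud hf
  refine ⟨u, hud, huniq, hlip, exists_isSobolevWithGradient_top hΩ hlip, fun w => ⟨fun hw => ?_,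
    fun hw => hw.isViscosityDirichletSolution hΩ⟩⟩
  obtain ⟨p, v, hpn, hp, hv, hunif⟩ := hu
  -- Uniform convergence on the closure sees only values there, where `w` and `u` coincide; the
  -- minimizers that produced `u` therefore serve for `w`.
  exact ⟨p, v, hpn, hp, hv, hunif.congr_right (huniq w hw).symm⟩
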